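/- All graphs are finite and simple. A fall $k$-colouring of a graph $G$ is a proper colouring of $G$ that uses exactly $k$ colours and in which every vertex is adjacent to a vertex of every colour other than its own. The fall spectrum $\mathcal{F}(G)$ is the set of all integers $k$ for which $G$ has a fall $k$-colouring, and $G$ is fall-unique if $\mathcal{F}(G)$ is a singleton. Fall Colouring is the problem to decide, given a graph $G$ and an integer $k\ge 0$, whether $k\in\mathcal{F}(G)$. Fall Chromatic Number and Fall Achromatic Number are the problems to compute the minimum, respectively the maximum, of $\mathcal{F}(G)$ for a given graph $G$ (and $0$ if $\mathcal{F}(G)=\emptyset$). A graph is $H$-free if it does not contain $H$ as an induced subgraph; $P_3+P_1$ is the disjoint union of a path on three vertices and a single vertex, and $3P_1$ is the graph of three isolated vertices. A co-component of $G$ is the subgraph of $G$ induced by the vertex set of a connected component of the complement $\overline{G}$. (1) Fall Colouring, Fall Chromatic Number and Fall Achromatic Number, restricted to $(P_3+P_1)$-free input graphs, are solvable in polynomial time (on a random access machine with addition and subtraction). (2) Let $G$ be a $(P_3+P_1)$-free graph. If $G$ has a fall colouring, then $G$ is fall-unique. If $G_1,\dots,G_r$ are the co-components of $G$, then $\mathcal{F}(G)=\{k_1+\dots+k_r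 : k_i\in\mathcal{F}(G_i)\text{ for all } i\}$. Every $G_i$ is $3P_1$-free or a disjoint union of complete graphs, and: (a) if $G_i$ is $3P_1$-free, let $S$ be the set of vertices of $G_i$ that are adjacent to all other vertices of $G_i$. If $\overline{G_i-S}$ has a perfect matching, then $\mathcal{F}(G_i)=\{|S|+\tfrac12|V(G_i)\setminus S|\}$; otherwise $\mathcal{F}(G_i)=\emptyset$. (b) if $G_i$ is a disjoint union of complete graphs, then $\mathcal{F}(G_i)=\{p\}$ if all connected components of $G_i$ have the same number $p$ of vertices, and $\mathcal{F}(G_i)=\emptyset$ otherwise. -/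

import Mathlib

open SimpleGraph

/-! ### Fall colourings -/

namespace FallColouring

variable {V W : Type*}

/-- `c` is a fall colouring with exactly `k` colours: every colour is used, and every vertex is
adjacent to a vertex of every colour different from its own. -/
def IsFallColouring {G : SimpleGraph V} {k : ℕ} (c : G.Coloring (Fin k)) : Prop :=
  Function.Surjective c ∧ ∀ (v : V) (j : Fin k), j ≠ c v → ∃ w, G.Adj v w ∧ c w = j

/-- The fall spectrum of `G`: the set of all `k` for which `G` has a fall `k`-colouring. -/
def fallSpectrum (G : SimpleGraph V) : Set ℕ :=
  {k | ∃ c : G.Coloring (Fin k), IsFallColouring c}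

/-- `G` is fall-unique: its fall spectrum is a singleton. -/
def FallUnique (G : SimpleGraph V) : Prop :=
  ∃ k, fallSpectrum G = {k}

/-- The fall chromatic number of a finite graph, `0` if there is no fall colouring. -/
noncomputable def fallChromaticNumber (G : SimpleGraph V) : ℕ :=
  sInf (fallSpectrum G)

/-- The fall achromatic number of a finite graph, `0` if there is no fall colouring. -/
noncomputable def fallAchromaticNumber (G : SimpleGraph V) : ℕ :=
  sSup (fallSpectrum G)

/-! ### Graph classes -/

/-- `G` is `H`-free: it does not contain `H` as an induced subgraph. -/
def IsFree (H : SimpleGraph W) (G : SimpleGraph V) : Prop :=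
  ¬ H ⊴ G

/-- The graph `P₃ + P₁`. -/
abbrev P3addP1 : SimpleGraph (Fin 3 ⊕ Fin 1) :=
  pathGraph 3 ⊕g pathGraph 1

/-- The graph `3P₁`: three pairwise non-adjacent vertices. -/
abbrev threeP1 : SimpleGraph (Fin 3) :=
  ⊥

/-- `G` is a disjoint union of complete graphs. -/
def IsDisjointUnionOfCliques (G : SimpleGraph V) : Prop :=
  ∀ D : G.ConnectedComponent, G.IsClique D.supp

/-- The co-component of `G` on the vertex set of a connected component of the complement. -/
abbrev coComponent (G : SimpleGraph V) (C : Gᶜ.ConnectedComponent) : SimpleGraph C.supp :=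
  G.induce C.supp

/-- The graph obtained from `G` by deleting all its dominating vertices. -/
abbrev deleteDominating (G : SimpleGraph V) : SimpleGraph ↥(G.universalVertsᶜ) :=
  G.induce G.universalVertsᶜ

/-- `G` has a perfect matching. -/
def HasPerfectMatching (G : SimpleGraph V) : Prop :=
  ∃ M : G.Subgraph, M.IsPerfectMatching

end FallColouring

/-! ### Random access machines

Programs of a random access machine in structured form, with natural-number variables and
finitely many arrays (all those that the program mentions).  The arithmetic operations are addition
and truncated subtraction; there is no multiplication, so that one unit of time increases the
largest bit length of a stored number by at most a constant, and the unit-cost time below is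
polynomially related to the time of a Turing machine. -/

namespace RAM

/-- The contents of the variables and of the (infinitely long) arrays. -/
structure State where
  /-- value of a variable -/
  var : ℕ → ℕ
  /-- entry of an array -/
  arr : ℕ → ℕ → ℕ

/-- Arithmetic expressions; `get a e` is the entry of array `a` at the index given by `e`. -/
inductive Expr
  | lit (n : ℕ)
  | var (x : ℕ)
  | get (a : ℕ) (e : Expr)
  | add (e₁ e₂ : Expr)
  | sub (e₁ e₂ : Expr)

namespace Expr

/-- The value of an expression. -/
def eval (s : State) : Expr → ℕ
  | lit n => n
  | var x => s.var x
  | get a e => s.arr a (e.eval s)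
  | add e₁ e₂ => e₁.eval s + e₂.eval s
  | sub e₁ e₂ => e₁.eval s - e₂.eval s

/-- The time for the evaluation of an expression: the number of its operations. -/
def cost : Expr → ℕ
  | lit _ => 1
  | var _ => 1
  | get _ e => e.cost + 1
  | add e₁ e₂ => e₁.cost + e₂.cost + 1
  | sub e₁ e₂ => e₁.cost + e₂.cost + 1

end Expr

/-- Programs. A condition `e` holds if its value is not zero. -/
inductive Prog
  | skip
  | assign (x : ℕ) (e : Expr)
  | store (a : ℕ) (i e : Expr)
  | seq (p q : Prog)
  | cond (e : Expr) (p q : Prog)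
  | loop (e : Expr) (p : Prog)

/-- The state after the assignment of `n` to the variable `x`. -/
def State.setVar (s : State) (x n : ℕ) : State where
  var := Function.update s.var x n
  arr := s.arr

/-- The state after the assignment of `n` to the entry with index `i` of the array `a`. -/
def State.setArr (s : State) (a i n : ℕ) : State where
  var := s.var
  arr := Function.update s.arr a (Function.update (s.arr a) i n)

/-- `Runs p s t s'`: started in the state `s`, the program `p` halts after time `t` in the
state `s'`. -/
inductive Runs : Prog → State → ℕ → State → Prop
  | skip (s : State) : Runs .skip s 1 s
  | assign (x : ℕ) (e : Expr) (s : State) :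
      Runs (.assign x e) s (e.cost + 1) (s.setVar x (e.eval s))
  | store (a : ℕ) (i e : Expr) (s : State) :
      Runs (.store a i e) s (i.cost + e.cost + 1) (s.setArr a (i.eval s) (e.eval s))
  | seq {p q : Prog} {s s' s'' : State} {t t' : ℕ} :
      Runs p s t s' → Runs q s' t' s'' → Runs (.seq p q) s (t + t') s''
  | cond_true {e : Expr} {p q : Prog} {s s' : State} {t : ℕ} :
      e.eval s ≠ 0 → Runs p s t s' → Runs (.cond e p q) s (e.cost + 1 + t) s'
  | cond_false {e : Expr} {p q : Prog} {s s' : State} {t : ℕ} :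
      e.eval s = 0 → Runs q s t s' → Runs (.cond e p q) s (e.cost + 1 + t) s'
  | loop_true {e : Expr} {p : Prog} {s s' s'' : State} {t t' : ℕ} :
      e.eval s ≠ 0 → Runs p s t s' → Runs (.loop e p) s' t' s'' →
        Runs (.loop e p) s (e.cost + 1 + t + t') s''
  | loop_false {e : Expr} {p : Prog} {s : State} :
      e.eval s = 0 → Runs (.loop e p) s (e.cost + 1) s

/-- The machine is deterministic: running time and final state are determined by the program and
the initial state. -/
theorem Runs.det {p : Prog} {s s₁ s₂ : State} {t₁ t₂ : ℕ} (h₁ : Runs p s t₁ s₁)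
    (h₂ : Runs p s t₂ s₂) : t₁ = t₂ ∧ s₁ = s₂ := by
  induction h₁ generalizing t₂ s₂ with
  | skip | assign | store => cases h₂; exact ⟨rfl, rfl⟩
  | seq _ _ ih ih' =>
    cases h₂ with
    | seq g g' =>
      obtain ⟨rfl, rfl⟩ := ih g
      obtain ⟨rfl, rfl⟩ := ih' g'
      exact ⟨rfl, rfl⟩
  | cond_true he _ ih =>
    cases h₂ with
    | cond_true _ g => obtain ⟨rfl, rfl⟩ := ih g; exact ⟨rfl, rfl⟩
    | cond_false he' _ => exact absurd he' he
  | cond_false he _ ih =>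
    cases h₂ with
    | cond_true he' _ => exact absurd he he'
    | cond_false _ g => obtain ⟨rfl, rfl⟩ := ih g; exact ⟨rfl, rfl⟩
  | loop_true he _ _ ih ih' =>
    cases h₂ with
    | loop_true _ g g' =>
      obtain ⟨rfl, rfl⟩ := ih g
      obtain ⟨rfl, rfl⟩ := ih' g'
      exact ⟨rfl, rfl⟩
    | loop_false he' => exact absurd he' he
  | loop_false he =>
    cases h₂ with
    | loop_true he' _ _ => exact absurd he he'
    | loop_false _ => exact ⟨rfl, rfl⟩

/-- The initial state on the input `l`: array `0` holds `l`, variable `0` holds its length, and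
everything else is `0`. -/
def start (l : List ℕ) : State where
  var x := if x = 0 then l.length else 0
  arr a i := if a = 0 then l.getD i 0 else 0

/-- The size of an input: the total bit length of its entries, plus one for each entry. -/
def inputSize (l : List ℕ) : ℕ :=
  (l.map fun x => Nat.size x + 1).sum

/-- The function `f` can be computed in polynomial time on the instances in the class `P`, where
instances are presented to the machine through `enc`: there are one program and one polynomial such
that on every instance `x` in `P` the program halts, within a time bounded by the polynomial in the
size of the input, with the value `f x` in variable `0`. -/
def PolyTimeOn {I : Type*} (P : I → Prop) (enc : I → List ℕ) (f : I → ℕ) : Prop :=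
  ∃ (prog : Prog) (b : Polynomial ℕ), ∀ x, P x →
    ∃ (t : ℕ) (s : State), Runs prog (start (enc x)) t s ∧
      t ≤ b.eval (inputSize (enc x)) ∧ s.var 0 = f x

open Classical in
/-- The decision problem `Q` can be solved in polynomial time on the instances in the class `P`
(answer `1` for yes and `0` for no). -/
def PolyTimeDecidableOn {I : Type*} (P : I → Prop) (enc : I → List ℕ) (Q : I → Prop) : Prop :=
  PolyTimeOn P enc fun x => if Q x then 1 else 0

end RAM

namespace FallColouring

/-- Finite graphs as inputs of algorithms: the vertices are `0, …, n - 1`. -/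
abbrev InputGraph : Type :=
  Σ n : ℕ, SimpleGraph (Fin n)

open Classical in
/-- A graph is given by its number `n` of vertices and its adjacency matrix, row by row. -/
noncomputable def encodeGraph (G : InputGraph) : List ℕ :=
  G.1 :: List.ofFn fun t : Fin (G.1 * G.1) => if G.2.Adj t.divNat t.modNat then 1 else 0

/-- A graph together with a number `k`. -/
noncomputable def encodeGraphNat (x : InputGraph × ℕ) : List ℕ :=
  x.2 :: encodeGraph x.1

end FallColouring

/-! A fall colouring of `G` restricts to a fall colouring of each co-component, and fall colourings
of the co-components with disjoint sets of colours combine to one of `G`, since vertices of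
different co-components are adjacent. If `G` is `(P₃ + P₁)`-free and the complement of a
co-component contains a triangle, then that complement is complete multipartite: every edge with a
vertex adjacent to one end of a triangle extends to a triangle that dominates the component. So the
co-component is a disjoint union of complete graphs, and a fall colouring meets each of them in
every colour exactly once. If the complement contains no triangle, then all colour classes have at
most two vertices, a vertex is alone in its class if and only if it is universal, and the other
classes form a perfect matching of the complement.

Whether a perfect matching exists is decided by Edmonds' algorithm, applied to the complement
without the vertices in triangles. For every even vertex `u` of the search, which is one that an
alternating path from the uncovered root can reach by a matching edge, the algorithm stores the
matching `M u` that is obtained by exchanging the edges of such a path, so that `u` is uncovered in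
place of the root. Shrinking a blossom then amounts to comparing these matchings, and blossoms need
not be stored. A search that cannot be continued has more blossoms than odd vertices, all blossoms
have odd size and an edge that leaves a blossom ends in an odd vertex, hence the root is uncovered
by every matching in which no further vertex becomes uncovered. -/

/-! ### Running times -/

namespace RAM

/-- `HaltsWithin p s T Q`: started in the state `s`, the program `p` halts within time `T` in a
state that satisfies `Q`. -/
def HaltsWithin (p : Prog) (s : State) (T : ℕ) (Q : State → Prop) : Prop :=
  ∃ t s', Runs p s t s' ∧ t ≤ T ∧ Q s'

namespace State

/-- `s'` arises from `s` without changing the variables below `k`. This is the frame condition of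
all programs below, which use the variables from `k` on as their workspace. -/
def AgreeBelow (k : ℕ) (s s' : State) : Prop :=
  ∀ x < k, s'.var x = s.var x

variable {s s' s'' : State} {k x y m : ℕ}

@[simp] theorem setVar_var_self : (s.setVar x m).var x = m := by
  simp only [setVar, Function.update_self]

@[simp] theorem setVar_arr : (s.setVar x m).arr = s.arr := rfl

@[simp] theorem setArr_var {a i : ℕ} : (s.setArr a i m).var = s.var := rfl

theorem setVar_var_of_ne (h : y ≠ x) : (s.setVar x m).var y = s.var y :=
  Function.update_of_ne h _ _

theorem setArr_arr_self {a i : ℕ} :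
    (s.setArr a i m).arr a = Function.update (s.arr a) i m := by
  simp only [setArr, Function.update_self]

theorem setArr_arr_of_ne {a b i : ℕ} (h : b ≠ a) : (s.setArr a i m).arr b = s.arr b :=
  Function.update_of_ne h _ _

theorem AgreeBelow.refl (k : ℕ) (s : State) : AgreeBelow k s s :=
  fun _ _ => rfl

theorem AgreeBelow.trans (h : AgreeBelow k s s') (h' : AgreeBelow k s' s'') :
    AgreeBelow k s s'' :=
  fun x hx => (h' x hx).trans (h x hx)

theorem AgreeBelow.mono {l : ℕ} (h : AgreeBelow k s s') (hl : l ≤ k) : AgreeBelow l s s' :=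
  fun x hx => h x (hx.trans_le hl)

theorem AgreeBelow.setVar (h : AgreeBelow k s s') (hx : k ≤ x) :
    AgreeBelow k s (s'.setVar x m) :=
  fun y hy => (setVar_var_of_ne (by omega)).trans (h y hy)

end State

open State

section Rules

variable {p q : Prog} {s : State} {T T' : ℕ} {Q Q' : State → Prop}

theorem HaltsWithin.mono (h : HaltsWithin p s T Q) (hT : T ≤ T') (hQ : ∀ s', Q s' → Q' s') :
    HaltsWithin p s T' Q' := by
  obtain ⟨t, s', hr, ht, hs'⟩ := h
  exact ⟨t, s', hr, ht.trans hT, hQ s' hs'⟩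

theorem HaltsWithin.imp (h : HaltsWithin p s T Q) (hQ : ∀ s', Q s' → Q' s') :
    HaltsWithin p s T Q' :=
  h.mono le_rfl hQ

theorem HaltsWithin.assign {x : ℕ} {e : Expr} (h : Q (s.setVar x (e.eval s))) :
    HaltsWithin (.assign x e) s (e.cost + 1) Q :=
  ⟨_, _, .assign x e s, le_rfl, h⟩

theorem HaltsWithin.store {a : ℕ} {i e : Expr} (h : Q (s.setArr a (i.eval s) (e.eval s))) :
    HaltsWithin (.store a i e) s (i.cost + e.cost + 1) Q :=
  ⟨_, _, .store a i e s, le_rfl, h⟩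

theorem HaltsWithin.seq (h : HaltsWithin p s T fun s' => HaltsWithin q s' T' Q) :
    HaltsWithin (.seq p q) s (T + T') Q := by
  obtain ⟨t, s', hr, ht, t', s'', hr', ht', hQ⟩ := h
  exact ⟨_, s'', hr.seq hr', add_le_add ht ht', hQ⟩

theorem HaltsWithin.cond {e : Expr} (h : e.eval s ≠ 0 → HaltsWithin p s T Q)
    (h' : e.eval s = 0 → HaltsWithin q s T Q) :
    HaltsWithin (.cond e p q) s (e.cost + 1 + T) Q := by
  by_cases he : e.eval s = 0
  · obtain ⟨t, s', hr, ht, hQ⟩ := h' he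
    exact ⟨_, s', .cond_false he hr, by omega, hQ⟩
  · obtain ⟨t, s', hr, ht, hQ⟩ := h he
    exact ⟨_, s', .cond_true he hr, by omega, hQ⟩

end Rules

/-- Run `p` for all values of the variable `c` below the value of the variable `1`. -/
def forLoop (c : ℕ) (p : Prog) : Prog :=
  .seq (.assign c (.lit 0)) (.loop (.sub (.var 1) (.var c))
    (.seq p (.assign c (.add (.var c) (.lit 1)))))

theorem haltsWithin_forLoop {c n B : ℕ} {p : Prog} (hc : c ≠ 1) (I : ℕ → State → Prop)
    (hI : ∀ i s m, I i s → I i (s.setVar c m))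
    (hp : ∀ i < n, ∀ s, I i s → s.var c = i → s.var 1 = n →
      HaltsWithin p s B fun s' => I (i + 1) s' ∧ s'.var c = i ∧ s'.var 1 = n)
    {s : State} (h0 : I 0 s) (hn : s.var 1 = n) :
    HaltsWithin (forLoop c p) s ((n + 1) * (B + 8) + 2) fun s' => I n s' ∧ s'.var 1 = n := by
  have rounds : ∀ m i s, i + m = n → I i s → s.var c = i → s.var 1 = n →
      HaltsWithin (.loop (.sub (.var 1) (.var c)) (.seq p (.assign c (.add (.var c) (.lit 1))))) s
        (m * (B + 8) + 4) fun s' => I n s' ∧ s'.var 1 = n := by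
    intro m
    induction m with
    | zero =>
      rintro i s rfl hIs hc hn
      exact ⟨_, s, .loop_false (by simp only [Expr.eval]; omega), by simp [Expr.cost], hIs, hn⟩
    | succ m ih =>
      intro i s hi hIs hcs hn
      obtain ⟨t, s', hr, ht, hI', hc', hn'⟩ := hp i (by omega) s hIs hcs hn
      obtain ⟨t', s'', hr', ht', hQ⟩ := ih (i + 1) (s'.setVar c (i + 1)) (by omega)
        (hI _ _ _ hI') setVar_var_self (by rw [setVar_var_of_ne hc.symm, hn'])
      have hinc := Runs.assign c (.add (.var c) (.lit 1)) s'
      simp only [Expr.eval, hc', Expr.cost] at hinc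
      refine ⟨_, s'', .loop_true (by simp only [Expr.eval]; omega) (hr.seq hinc) hr', ?_, hQ⟩
      simp only [Expr.cost]
      linarith
  refine (HaltsWithin.seq (.assign (rounds n 0 _ (by omega) (hI _ _ _ h0) setVar_var_self ?_))).mono
    ?_ fun _ => id
  · rw [setVar_var_of_ne hc.symm, hn]
  · simp only [Expr.cost]
    linarith

/-- Sum up the values that `p` leaves in the variable `k + 2`, for all values of the variable
`k + 1` below the value of the variable `1`. The sum is left in the variable `k`. -/
def sumLoop (k : ℕ) (p : Prog) : Prog :=
  .seq (.assign k (.lit 0)) (forLoop (k + 1) (.seq p (.assign k (.add (.var k) (.var (k + 2))))))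

theorem haltsWithin_sumLoop {k n B : ℕ} {p : Prog} (hk : 1 < k) (v : Fin n → ℕ) {s : State}
    (hn : s.var 1 = n)
    (hp : ∀ (i : Fin n) (s' : State), s'.arr = s.arr → AgreeBelow k s s' → s'.var (k + 1) = i →
      HaltsWithin p s' B fun s'' => s''.var (k + 2) = v i ∧ s''.arr = s'.arr ∧
        AgreeBelow (k + 2) s' s'') :
    HaltsWithin (sumLoop k p) s ((n + 1) * (B + 12) + 4) fun s' =>
      s'.var k = ∑ i, v i ∧ s'.arr = s.arr ∧ AgreeBelow k s s' := by
  let w : ℕ → ℕ := fun i => if h : i < n then v ⟨i, h⟩ else 0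
  have hw : ∑ i ∈ Finset.range n, w i = ∑ i, v i := by
    simp [Finset.sum_range, w]
  refine (HaltsWithin.seq (.assign (haltsWithin_forLoop (n := n) (B := B + 4) (by omega)
    (fun i s' => s'.var k = ∑ j ∈ Finset.range i, w j ∧ s'.arr = s.arr ∧ AgreeBelow k s s')
    ?_ ?_ ?_ ?_))).mono ?_ fun s' hs' => ?_
  · rintro i s' m ⟨hv, ha, hf⟩
    exact ⟨by rw [setVar_var_of_ne (by omega), hv], ha, hf.setVar (by omega)⟩
  · rintro i hi s' ⟨hv, ha, hf⟩ hc hn'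
    refine ((hp ⟨i, hi⟩ s' ha hf hc).imp fun s'' ⟨hv', ha', hf'⟩ => .assign ?_).seq
    refine ⟨⟨?_, ha'.trans ha, (hf.trans (hf'.mono (by omega))).setVar le_rfl⟩, ?_, ?_⟩
    · simp [Expr.eval, hf' k, hv, hv', Finset.sum_range_succ, w, hi]
    · rw [setVar_var_of_ne (by omega), hf' _ (by omega), hc]
    · rw [setVar_var_of_ne (by omega), hf' _ (by omega), hn']
  · exact ⟨by simp [Expr.eval], rfl, (AgreeBelow.refl k s).setVar le_rfl⟩
  · rw [setVar_var_of_ne (by omega), hn]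
  · simp only [Expr.cost]
    linarith
  · exact ⟨hs'.1.1.trans hw, hs'.1.2⟩

theorem flatIndex_eq_iff {n : ℕ} (i j i' j' : Fin n) :
    (i * n + j : ℕ) = i' * n + j' ↔ i = i' ∧ j = j' := by
  rw [← Prod.mk.injEq, ← (finProdFinEquiv (m := n) (n := n)).injective.eq_iff, Fin.ext_iff]
  simp [mul_comm n, add_comm]

theorem flatIndex_lt {n : ℕ} (i j : Fin n) : (i * n + j : ℕ) < n * n := by
  simpa [mul_comm n, add_comm] using (finProdFinEquiv (i, j)).isLt

/-- For all pairs of values of the variables `k` and `k + 1` below the value of the variable `1`,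
store the value that `p` leaves in the variable `k + 2`. The array `a` is filled row by row. -/
def fill (a k : ℕ) (p : Prog) : Prog :=
  forLoop k (forLoop (k + 1)
    (.seq p (.store a (.add (.get 1 (.var k)) (.var (k + 1))) (.var (k + 2)))))

section Fill

variable {a k n B : ℕ} {v : Fin n → Fin n → ℕ} {s s' : State}

/-- The entries with index below `m` of the array `a` of `s'` are those of the matrix `v`, and the
other arrays and the variables below `k` are as in `s`. -/
structure FilledBelow (a k : ℕ) (v : Fin n → Fin n → ℕ) (s : State) (m : ℕ) (s' : State) :
    Prop where
  entry : ∀ i j : Fin n, (i * n + j : ℕ) < m → s'.arr a (i * n + j) = v i j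
  other : ∀ b, b ≠ a → s'.arr b = s.arr b
  agree : AgreeBelow k s s'

theorem FilledBelow.setVar {m x l : ℕ} (h : FilledBelow a k v s m s') (hx : k ≤ x) :
    FilledBelow a k v s m (s'.setVar x l) :=
  ⟨h.entry, h.other, h.agree.setVar hx⟩

theorem FilledBelow.store {s'' : State} {i j : Fin n}
    (h : FilledBelow a k v s (i * n + j) s') (ha : s''.arr = s'.arr)
    (hf : AgreeBelow (k + 2) s' s'') :
    FilledBelow a k v s (i * n + j + 1) (s''.setArr a (i * n + j) (v i j)) where
  entry i' j' hlt := by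
    rw [setArr_arr_self, ha]
    rcases (Nat.lt_succ_iff.1 hlt).lt_or_eq with hlt | heq
    · rw [Function.update_of_ne hlt.ne, h.entry i' j' hlt]
    · obtain ⟨rfl, rfl⟩ := (flatIndex_eq_iff ..).1 heq
      rw [Function.update_self]
  other b hb := by rw [setArr_arr_of_ne hb, ha, h.other b hb]
  agree := h.agree.trans (hf.mono (by omega))

theorem haltsWithin_fill {p : Prog} (hk : 1 < k) (ha : a ≠ 1) (v : Fin n → Fin n → ℕ)
    (hn : s.var 1 = n) (hrow : ∀ i < n, s.arr 1 i = i * n)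
    (hp : ∀ (i j : Fin n) (s' : State), (∀ b, b ≠ a → s'.arr b = s.arr b) → AgreeBelow k s s' →
      s'.var k = i → s'.var (k + 1) = j → HaltsWithin p s' B fun s'' =>
        s''.var (k + 2) = v i j ∧ s''.arr = s'.arr ∧ AgreeBelow (k + 2) s' s'') :
    HaltsWithin (fill a k p) s ((n + 1) * ((n + 1) * (B + 14) + 10) + 2)
      (FilledBelow a k v s (n * n)) := by
  have hcell : ∀ i j : Fin n, ∀ s', FilledBelow a k v s (i * n + j) s' → s'.var k = i →
      s'.var (k + 1) = j → s'.var 1 = n →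
      HaltsWithin (.seq p (.store a (.add (.get 1 (.var k)) (.var (k + 1))) (.var (k + 2)))) s'
        (B + 6) fun s'' => (FilledBelow a k v s (i * n + j + 1) s'' ∧ s''.var k = i) ∧
          s''.var (k + 1) = j ∧ s''.var 1 = n := by
    intro i j s' hF hi hj hn'
    refine ((hp i j s' hF.other hF.agree hi hj).imp fun s'' ⟨hv, ha', hf⟩ => .store ?_).seq
    have hrow' : s''.arr 1 i = i * n := by rw [ha', hF.other 1 ha.symm, hrow i i.2]
    simp only [Expr.eval, hf k (by omega), hf (k + 1) (by omega), hi, hj, hrow', hv, setArr_var]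
    exact ⟨⟨hF.store ha' hf, trivial⟩, trivial, (hf 1 (by omega)).trans hn'⟩
  have hline : ∀ i : Fin n, ∀ s', FilledBelow a k v s (i * n) s' → s'.var k = i →
      s'.var 1 = n → HaltsWithin (forLoop (k + 1)
        (.seq p (.store a (.add (.get 1 (.var k)) (.var (k + 1))) (.var (k + 2))))) s'
        ((n + 1) * (B + 14) + 2) fun s'' => (FilledBelow a k v s (i * n + n) s'' ∧
          s''.var k = i) ∧ s''.var 1 = n := by
    intro i s' hF hi hn'
    refine haltsWithin_forLoop (B := B + 6) (by omega)
      (fun j s' => FilledBelow a k v s (i * n + j) s' ∧ s'.var k = i) ?_ ?_ ⟨hF, hi⟩ hn'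
    · exact fun j s' m h => ⟨h.1.setVar (by omega), by rw [setVar_var_of_ne (by omega), h.2]⟩
    · exact fun j hj s' h hc hn' => hcell i ⟨j, hj⟩ s' h.1 h.2 hc hn'
  refine (haltsWithin_forLoop (B := (n + 1) * (B + 14) + 2) (by omega)
    (fun i => FilledBelow a k v s (i * n)) (fun i s' m h => h.setVar le_rfl) ?_ ?_ hn).imp
    fun s' h => h.1
  · intro i hi s' hF hc hn'
    refine (hline ⟨i, hi⟩ s' hF hc hn').imp fun s'' ⟨⟨h, h'⟩, h''⟩ => ⟨?_, h', h''⟩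
    rwa [Nat.succ_mul]
  · exact ⟨fun i j h => by omega, fun _ _ => rfl, .refl k s⟩

end Fill

/-! ### Programs on square arrays -/

/-- Terms over a domain `Fin n` and binary arrays of natural numbers. Variables are named by
numbers and range over the domain. -/
inductive ArrayTerm
  | lit (c : ℕ)
  | idx (x : ℕ)
  | get (a x y : ℕ)
  | add (t u : ArrayTerm)
  | sub (t u : ArrayTerm)
  | ite (c t u : ArrayTerm)
  | sum (x : ℕ) (t : ArrayTerm)

/-- Binary arrays of natural numbers over the domain `Fin n`, named by numbers. -/
abbrev Arrays (n : ℕ) := ℕ → Fin n → Fin n → ℕ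

/-- The value of a term; subtraction is truncated, and a condition holds if it is not zero. -/
def ArrayTerm.eval {n : ℕ} (X : Arrays n) : ArrayTerm → (ℕ → Fin n) → ℕ
  | .lit c, _ => c
  | .idx x, e => e x
  | .get a x y, e => X a (e x) (e y)
  | .add t u, e => t.eval X e + u.eval X e
  | .sub t u, e => t.eval X e - u.eval X e
  | .ite c t u, e => if c.eval X e ≠ 0 then t.eval X e else u.eval X e
  | .sum x t, e => ∑ i : Fin n, t.eval X (Function.update e x i)

/-- The machine program for a term: `ρ` tells where the variables are kept, the value is left in
the variable `k`, and no variable below `k` is changed. -/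
def ArrayTerm.compile : ArrayTerm → (ℕ → ℕ) → ℕ → Prog
  | .lit c, _, k => .assign k (.lit c)
  | .idx x, ρ, k => .assign k (.var (ρ x))
  | .get a x y, ρ, k => .assign k (.get (a + 3) (.add (.get 1 (.var (ρ x))) (.var (ρ y))))
  | .add t u, ρ, k => .seq (.seq (t.compile ρ k) (u.compile ρ (k + 1)))
      (.assign k (.add (.var k) (.var (k + 1))))
  | .sub t u, ρ, k => .seq (.seq (t.compile ρ k) (u.compile ρ (k + 1)))
      (.assign k (.sub (.var k) (.var (k + 1))))
  | .ite c t u, ρ, k => .seq (c.compile ρ k) (.cond (.var k) (t.compile ρ k) (u.compile ρ k))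
  | .sum x t, ρ, k => sumLoop k (t.compile (Function.update ρ x (k + 1)) (k + 2))

/-- The state `s` represents the arrays `X`: variable `1` holds the size `n` of the domain, array
`1` the multiples of `n`, which replace the missing multiplication, and array `a + 3` the entries of
`X a` row by row. -/
structure Represents {n : ℕ} (X : Arrays n) (s : State) : Prop where
  size : s.var 1 = n
  row : ∀ i < n, s.arr 1 i = i * n
  entry : ∀ a (i j : Fin n), s.arr (a + 3) (i * n + j) = X a i j

theorem Represents.congr {n k : ℕ} {X : Arrays n} {s s' : State} (h : Represents X s)
    (hf : AgreeBelow k s s') (hk : 1 < k) (ha : s'.arr = s.arr) : Represents X s' :=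
  ⟨(hf 1 hk).trans h.size, fun i hi => by rw [ha, h.row i hi],
    fun a i j => by rw [ha, h.entry]⟩

/-- In polynomial time, the program `p` leaves the value of the term `τ` in the variable `k`, if `ρ`
tells where the values of the variables of `τ` are kept. -/
def Computes (p : Prog) (τ : ArrayTerm) (ρ : ℕ → ℕ) (k : ℕ) : Prop :=
  ∃ b : Polynomial ℕ, ∀ {n : ℕ} (X : Arrays n) (e : ℕ → Fin n) (s : State), Represents X s →
    (∀ x, s.var (ρ x) = e x) → HaltsWithin p s (b.eval n) fun s' =>
      s'.var k = τ.eval X e ∧ s'.arr = s.arr ∧ AgreeBelow k s s'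

section Computes

variable {p q : Prog} {τ υ : ArrayTerm} {ρ : ℕ → ℕ} {k : ℕ}

theorem computes_assign {e : Expr} (h : ∀ {n : ℕ} (X : Arrays n) (ε : ℕ → Fin n) (s : State),
    Represents X s → (∀ x, s.var (ρ x) = ε x) → e.eval s = τ.eval X ε) :
    Computes (.assign k e) τ ρ k :=
  ⟨.C (e.cost + 1), fun X ε s hX hε => (HaltsWithin.assign ⟨by rw [setVar_var_self, h X ε s hX hε],
    rfl, (AgreeBelow.refl k s).setVar le_rfl⟩).mono (by simp) fun _ => id⟩

theorem Computes.binary (hρ : ∀ x, ρ x < k) (hk : 1 < k) (hp : Computes p τ ρ k)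
    (hq : Computes q υ ρ (k + 1)) {e : Expr} {ω : ArrayTerm}
    (h : ∀ {n : ℕ} (X : Arrays n) (ε : ℕ → Fin n) (s : State), s.var k = τ.eval X ε →
      s.var (k + 1) = υ.eval X ε → e.eval s = ω.eval X ε) :
    Computes (.seq (.seq p q) (.assign k e)) ω ρ k := by
  obtain ⟨b, hb⟩ := hp
  obtain ⟨b', hb'⟩ := hq
  refine ⟨b + b' + .C (e.cost + 1), fun {n} X ε s hX hε => ?_⟩
  simp only [Polynomial.eval_add, Polynomial.eval_C]
  refine HaltsWithin.seq (HaltsWithin.seq ((hb X ε s hX hε).imp fun s₁ ⟨hv₁, ha₁, hf₁⟩ => ?_))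
  refine (hb' X ε s₁ (hX.congr hf₁ hk ha₁) fun x => by rw [hf₁ _ (hρ x), hε]).imp
    fun s₂ ⟨hv₂, ha₂, hf₂⟩ => .assign ⟨?_, ha₂.trans ha₁,
      (hf₁.trans (hf₂.mono (by omega))).setVar le_rfl⟩
  rw [setVar_var_self, h X ε s₂ (by rw [hf₂ k (by omega), hv₁]) hv₂]

theorem Computes.ite {r : Prog} {ω : ArrayTerm} (hρ : ∀ x, ρ x < k) (hk : 1 < k)
    (hr : Computes r ω ρ k) (hp : Computes p τ ρ k) (hq : Computes q υ ρ k) :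
    Computes (.seq r (.cond (.var k) p q)) (.ite ω τ υ) ρ k := by
  obtain ⟨b₀, hb₀⟩ := hr
  obtain ⟨b, hb⟩ := hp
  obtain ⟨b', hb'⟩ := hq
  refine ⟨b₀ + (.C 2 + (b + b')), fun {n} X ε s hX hε => ?_⟩
  simp only [Polynomial.eval_add, Polynomial.eval_C]
  refine HaltsWithin.seq ((hb₀ X ε s hX hε).imp fun s₁ ⟨hv₁, ha₁, hf₁⟩ => ?_)
  have hX₁ := hX.congr hf₁ hk ha₁
  have hε₁ : ∀ x, s₁.var (ρ x) = ε x := fun x => by rw [hf₁ _ (hρ x), hε]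
  refine HaltsWithin.cond (fun h => (hb X ε s₁ hX₁ hε₁).mono (by omega) ?_)
    (fun h => (hb' X ε s₁ hX₁ hε₁).mono (by omega) ?_) <;>
  · rintro s₂ ⟨hv₂, ha₂, hf₂⟩
    rw [Expr.eval, hv₁] at h
    exact ⟨by simp [hv₂, ArrayTerm.eval, h], ha₂.trans ha₁, hf₁.trans hf₂⟩

theorem Computes.sum {x : ℕ} (hρ : ∀ x, ρ x < k) (hk : 1 < k)
    (hp : Computes p τ (Function.update ρ x (k + 1)) (k + 2)) :
    Computes (sumLoop k p) (.sum x τ) ρ k := by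
  obtain ⟨b, hb⟩ := hp
  refine ⟨(.X + 1) * (b + .C 12) + .C 4, fun {n} X ε s hX hε => ?_⟩
  refine (haltsWithin_sumLoop (B := b.eval n) hk
    (fun i => τ.eval X (Function.update ε x i)) hX.size fun i s' ha hf hi => ?_).mono
    (by simp) fun s' hs' => ?_
  · refine hb X (Function.update ε x i) s' (hX.congr hf hk ha) fun y => ?_
    by_cases hy : y = x
    · simp [hy, hi]
    · rw [Function.update_of_ne hy, Function.update_of_ne hy, hf _ (hρ y), hε]
  · exact hs'

end Computes

theorem ArrayTerm.computes_compile (τ : ArrayTerm) {ρ : ℕ → ℕ} {k : ℕ} (hρ : ∀ x, ρ x < k)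
    (hk : 1 < k) : Computes (τ.compile ρ k) τ ρ k := by
  have hρ' : ∀ x, ρ x < k + 1 := fun x => (hρ x).trans k.lt_succ_self
  induction τ generalizing ρ k with
  | lit c => exact computes_assign fun _ _ _ _ _ => rfl
  | idx x => exact computes_assign fun _ _ _ _ hε => hε x
  | get a x y =>
    exact computes_assign fun X ε s hX hε => by simp [Expr.eval, eval, hε, hX.row, hX.entry]
  | add t u iht ihu =>
    exact (iht hρ hk hρ').binary hρ hk (ihu hρ' (by omega) fun x => (hρ' x).trans (by omega))
      fun X ε s h h' => by simp [Expr.eval, eval, h, h']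
  | sub t u iht ihu =>
    exact (iht hρ hk hρ').binary hρ hk (ihu hρ' (by omega) fun x => (hρ' x).trans (by omega))
      fun X ε s h h' => by simp [Expr.eval, eval, h, h']
  | ite c t u ihc iht ihu =>
    exact (ihc hρ hk hρ').ite hρ hk (iht hρ hk hρ') (ihu hρ hk hρ')
  | sum x t ih =>
    have hup : ∀ y, Function.update ρ x (k + 1) y < k + 2 := fun y => by
      by_cases hy : y = x
      · simp [hy]
      · rw [Function.update_of_ne hy]
        exact (hρ y).trans (by omega)
    exact (ih hup (by omega) fun y => (hup y).trans (by omega)).sum hρ hk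

/-- Programs on arrays: `set a t` redefines all entries of the array `a` at once, where the
variable `1` of `t` stands for the second index and the other ones for the first; `iter c` repeats
`c` as often as the domain has elements. -/
inductive ArrayProg
  | set (a : ℕ) (t : ArrayTerm)
  | seq (c d : ArrayProg)
  | iter (c : ArrayProg)

/-- The environment for the entry with indices `i` and `j`. -/
def pairEnv {n : ℕ} (i j : Fin n) : ℕ → Fin n :=
  fun x => if x = 1 then j else i

/-- The effect of a program on the arrays. -/
def ArrayProg.eval {n : ℕ} : ArrayProg → Arrays n → Arrays n
  | .set a t, X => Function.update X a fun i j => t.eval X (pairEnv i j)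
  | .seq c d, X => d.eval (c.eval X)
  | .iter c, X => c.eval^[n] X

/-- The location of the variables of a term during `fill`. -/
def pairLoc (k : ℕ) : ℕ → ℕ :=
  fun x => if x = 1 then k + 1 else k

/-- The machine program for a program on arrays; no variable below `k` is changed. The new entries
of an array are collected in array `2` first, since they may depend on the old ones. -/
def ArrayProg.compile : ArrayProg → ℕ → Prog
  | .set a t, k => .seq (fill 2 k (t.compile (pairLoc k) (k + 2)))
      (fill (a + 3) k (.assign (k + 2) (.get 2 (.add (.get 1 (.var k)) (.var (k + 1))))))
  | .seq c d, k => .seq (c.compile k) (d.compile k)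
  | .iter c, k => forLoop k (c.compile (k + 1))

/-- In polynomial time, `p` has the effect of the program `c` on the represented arrays, without
changing the variables below `k` and the input. -/
def Executes (p : Prog) (c : ArrayProg) (k : ℕ) : Prop :=
  ∃ b : Polynomial ℕ, ∀ {n : ℕ} (X : Arrays n) (s : State), Represents X s →
    HaltsWithin p s (b.eval n) fun s' =>
      Represents (c.eval X) s' ∧ s'.arr 0 = s.arr 0 ∧ AgreeBelow k s s'

section Executes

variable {k : ℕ}

theorem executes_set (a : ℕ) (τ : ArrayTerm) (hk : 1 < k) :
    Executes (ArrayProg.compile (.set a τ) k) (.set a τ) k := by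
  obtain ⟨b, hb⟩ := τ.computes_compile (ρ := pairLoc k) (k := k + 2)
    (fun x => by unfold pairLoc; split <;> omega) (by omega)
  refine ⟨((.X + 1) * ((.X + 1) * (b + .C 14) + .C 10) + .C 2) +
    ((.X + 1) * ((.X + 1) * .C 20 + .C 10) + .C 2), fun {n} X s hX => ?_⟩
  simp only [Polynomial.eval_add, Polynomial.eval_mul, Polynomial.eval_C, Polynomial.eval_X,
    Polynomial.eval_one]
  let v : Fin n → Fin n → ℕ := fun i j => τ.eval X (pairEnv i j)
  refine HaltsWithin.seq ((haltsWithin_fill hk (by omega) v hX.size hX.row ?_).imp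
    fun s₁ h₁ => (haltsWithin_fill (B := 6) hk (by omega) v ?_ ?_ ?_).imp fun s₂ h₂ => ?_)
  · intro i j s' ha hf hi hj
    refine hb X (pairEnv i j) s' ⟨(hf 1 hk).trans hX.size, fun i hi => ?_, fun a i j => ?_⟩
      fun x => ?_
    · rw [ha 1 (by omega), hX.row i hi]
    · rw [ha _ (by omega), hX.entry]
    · unfold pairLoc pairEnv
      split <;> simp only [hi, hj]
  · rw [h₁.agree 1 hk, hX.size]
  · exact fun i hi => by rw [h₁.other 1 (by omega), hX.row i hi]
  · intro i j s' ha _ hi hj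
    refine HaltsWithin.assign ⟨?_, rfl, (AgreeBelow.refl _ _).setVar le_rfl⟩
    simp only [setVar_var_self, Expr.eval, hi, hj]
    rw [ha 1 (by omega), ha 2 (by omega), h₁.other 1 (by omega), hX.row i i.2,
      h₁.entry i j (flatIndex_lt i j)]
  · refine ⟨⟨?_, fun i hi => ?_, fun a' i j => ?_⟩, ?_, h₁.agree.trans h₂.agree⟩
    · rw [h₂.agree 1 hk, h₁.agree 1 hk, hX.size]
    · rw [h₂.other 1 (by omega), h₁.other 1 (by omega), hX.row i hi]
    · by_cases ha : a' = a
      · subst ha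
        rw [h₂.entry i j (flatIndex_lt i j), ArrayProg.eval, Function.update_self]
      · rw [h₂.other _ (by omega), h₁.other _ (by omega), hX.entry, ArrayProg.eval,
          Function.update_of_ne ha]
    · rw [h₂.other 0 (by omega), h₁.other 0 (by omega)]

variable {p q : Prog} {c d : ArrayProg}

theorem Executes.seq (hp : Executes p c k) (hq : Executes q d k) :
    Executes (.seq p q) (.seq c d) k := by
  obtain ⟨b, hb⟩ := hp
  obtain ⟨b', hb'⟩ := hq
  refine ⟨b + b', fun X s hX => ?_⟩
  rw [Polynomial.eval_add]
  exact HaltsWithin.seq ((hb X s hX).imp fun s₁ ⟨hX₁, ha₁, hf₁⟩ =>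
    (hb' _ s₁ hX₁).imp fun s₂ ⟨hX₂, ha₂, hf₂⟩ => ⟨hX₂, ha₂.trans ha₁, hf₁.trans hf₂⟩)

theorem Executes.iter (hk : 1 < k) (hp : Executes p c (k + 1)) :
    Executes (forLoop k p) (.iter c) k := by
  obtain ⟨b, hb⟩ := hp
  refine ⟨(.X + 1) * (b + .C 8) + .C 2, fun {n} X s hX => ?_⟩
  refine (haltsWithin_forLoop (B := b.eval n) (by omega) (fun i s' =>
    Represents (c.eval^[i] X) s' ∧ s'.arr 0 = s.arr 0 ∧ AgreeBelow k s s') ?_ ?_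
    ⟨hX, rfl, .refl k s⟩ hX.size).mono (by simp) fun s' h => h.1
  · exact fun i s' m ⟨hX', ha, hf⟩ => ⟨hX'.congr ((AgreeBelow.refl k s').setVar le_rfl) hk rfl, ha,
      hf.setVar le_rfl⟩
  · rintro i - s' ⟨hX', ha, hf⟩ hc hn
    refine (hb _ s' hX').imp fun s'' ⟨hX'', ha', hf'⟩ =>
      ⟨⟨?_, ha'.trans ha, hf.trans (hf'.mono (by omega))⟩, ?_, ?_⟩
    · rwa [Function.iterate_succ_apply']
    · rw [hf' k (by omega), hc]
    · rw [hf' 1 (by omega), hn]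

theorem ArrayProg.executes_compile (c : ArrayProg) (hk : 1 < k) :
    Executes (c.compile k) c k := by
  induction c generalizing k with
  | set a τ => exact executes_set a τ hk
  | seq c d ihc ihd => exact (ihc hk).seq (ihd hk)
  | iter c ih => exact (ih (by omega)).iter hk

end Executes

section Setup

variable {n : ℕ}

/-- The arrays before the computation: array `0` holds `A`, the other ones are zero. -/
def inputArrays (A : Fin n → Fin n → ℕ) : Arrays n :=
  fun a i j => if a = 0 then A i j else 0

/-- The input `l` holds at the position `off` the number `n`, and after it the entries of `A` row by
row. -/
structure HoldsMatrix (l : List ℕ) (off : ℕ) (A : Fin n → Fin n → ℕ) : Prop where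
  size : l.getD off 0 = n
  entry : ∀ i j : Fin n, l.getD (off + 1 + (i * n + j)) 0 = A i j

/-- Leave the multiples of the value of the variable `1` in the array `1`. -/
def tabulateMultiples : Prog :=
  forLoop 2 (.seq (.store 1 (.var 2) (.var 3)) (.assign 3 (.add (.var 3) (.var 1))))

theorem haltsWithin_tabulateMultiples {s : State} (hn : s.var 1 = n) (h3 : s.var 3 = 0) :
    HaltsWithin tabulateMultiples s ((n + 1) * 15 + 2) fun s' =>
      s'.var 1 = n ∧ (∀ i < n, s'.arr 1 i = i * n) ∧ ∀ a, a ≠ 1 → s'.arr a = s.arr a := by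
  refine (haltsWithin_forLoop (n := n) (B := 7) (by omega) (fun i s' => s'.var 3 = i * n ∧
    (∀ i' < i, s'.arr 1 i' = i' * n) ∧ ∀ a, a ≠ 1 → s'.arr a = s.arr a) ?_ ?_ ?_ hn).imp
    fun s' h => ⟨h.2, h.1.2⟩
  · rintro i s' m ⟨hv, h⟩
    exact ⟨by rw [setVar_var_of_ne (by omega), hv], h⟩
  · rintro i - s' ⟨hv, hrow, ha⟩ hc hn'
    refine HaltsWithin.seq (.store (.assign ⟨⟨?_, fun i' hi' => ?_, fun a h => ?_⟩, ?_, ?_⟩))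
    · simp [Expr.eval, hv, hn', Nat.succ_mul]
    · rw [setVar_arr, setArr_arr_self]
      simp only [Expr.eval, hc, hv]
      rcases (Nat.lt_succ_iff.1 hi').lt_or_eq with h | rfl
      · rw [Function.update_of_ne h.ne, hrow i' h]
      · rw [Function.update_self]
    · rw [setVar_arr, setArr_arr_of_ne h, ha a h]
    · rw [setVar_var_of_ne (by omega), setArr_var, hc]
    · rw [setVar_var_of_ne (by omega), setArr_var, hn']
  · exact ⟨by simp [h3], fun i hi => absurd hi (by omega), fun _ _ => rfl⟩

/-- Make the tables that represent the matrix found in the input at the position `off`. -/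
def setup (off : ℕ) : Prog :=
  .seq (.assign 1 (.get 0 (.lit off))) (.seq tabulateMultiples
    (fill 3 2 (.assign 4 (.get 0 (.add (.lit (off + 1)) (.add (.get 1 (.var 2)) (.var 3)))))))

theorem haltsWithin_setup {off : ℕ} {l : List ℕ} {A : Fin n → Fin n → ℕ}
    (h : HoldsMatrix l off A) :
    HaltsWithin (setup off) (start l) (3 + ((n + 1) * 15 + 2 +
      ((n + 1) * ((n + 1) * 22 + 10) + 2))) fun s' =>
        Represents (inputArrays A) s' ∧ s'.arr 0 = (start l).arr 0 := by
  refine HaltsWithin.seq (.assign (.seq ((haltsWithin_tabulateMultiples (n := n) ?_ ?_).imp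
    fun s₁ ⟨hn₁, hrow₁, harr₁⟩ => (haltsWithin_fill (B := 8) (by omega) (by omega) A hn₁ hrow₁
      fun i j s' harr _ hi hj => ?_).imp fun s₂ h₂ => ?_)))
  · simp only [setVar_var_self, Expr.eval, start, if_true, h.size]
  · rw [setVar_var_of_ne (by omega)]
    rfl
  · refine HaltsWithin.assign ⟨?_, rfl, (AgreeBelow.refl _ _).setVar le_rfl⟩
    simp only [setVar_var_self, Expr.eval, hi, hj]
    rw [harr 0 (by omega), harr 1 (by omega), hrow₁ i i.2, harr₁ 0 (by omega)]
    exact h.entry i j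
  · refine ⟨⟨?_, fun i hi => ?_, fun a i j => ?_⟩, ?_⟩
    · rw [h₂.agree 1 (by omega), hn₁]
    · rw [h₂.other 1 (by omega), hrow₁ i hi]
    · by_cases ha : a = 0
      · subst ha
        exact h₂.entry i j (flatIndex_lt i j)
      · rw [h₂.other _ (by omega), harr₁ _ (by omega)]
        simp [start, inputArrays, ha]
    · rw [h₂.other 0 (by omega), harr₁ 0 (by omega)]
      rfl

/-- Leave the sum of the diagonal entries of the array `a` in the variable `k`. -/
def sumDiagonal (a k : ℕ) : Prog :=
  sumLoop k (.assign (k + 2) (.get (a + 3) (.add (.get 1 (.var (k + 1))) (.var (k + 1)))))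

theorem haltsWithin_sumDiagonal {a k : ℕ} {X : Arrays n} {s : State} (hk : 1 < k)
    (hX : Represents X s) :
    HaltsWithin (sumDiagonal a k) s ((n + 1) * 18 + 4) fun s' =>
      s'.var k = ∑ i, X a i i ∧ s'.arr = s.arr ∧ AgreeBelow k s s' := by
  refine haltsWithin_sumLoop (B := 6) hk (fun i => X a i i) hX.size fun i s' ha _ hi =>
    .assign ⟨?_, rfl, (AgreeBelow.refl _ _).setVar le_rfl⟩
  simp only [setVar_var_self, Expr.eval, hi, ha, hX.row i i.2, hX.entry]

theorem exists_haltsWithin_sumDiagonal_eval (c : ArrayProg) (a₁ a₂ off : ℕ) :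
    ∃ (prog : Prog) (b : Polynomial ℕ), ∀ {n : ℕ} {A : Fin n → Fin n → ℕ} {l : List ℕ},
      HoldsMatrix l off A → HaltsWithin prog (start l) (b.eval n) fun s' =>
        s'.var 3 = ∑ i, c.eval (inputArrays A) a₁ i i ∧
        s'.var 4 = ∑ i, c.eval (inputArrays A) a₂ i i ∧ s'.arr 0 = (start l).arr 0 := by
  obtain ⟨b, hb⟩ := c.executes_compile (k := 3) (by omega)
  refine ⟨.seq (setup off) (.seq (c.compile 3) (.seq (sumDiagonal a₁ 3) (sumDiagonal a₂ 4))),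
    .C 3 + ((.X + 1) * .C 15 + .C 2 + ((.X + 1) * ((.X + 1) * .C 22 + .C 10) + .C 2)) +
      (b + (((.X + 1) * .C 18 + .C 4) + ((.X + 1) * .C 18 + .C 4))), fun {n A l} h => ?_⟩
  simp only [Polynomial.eval_add, Polynomial.eval_mul, Polynomial.eval_C, Polynomial.eval_X,
    Polynomial.eval_one]
  refine .seq ((haltsWithin_setup h).imp fun s₁ ⟨hX₁, ha₁⟩ => .seq ((hb _ s₁ hX₁).imp
    fun s₂ ⟨hX₂, ha₂, _⟩ => .seq ((haltsWithin_sumDiagonal (by omega) hX₂).imp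
      fun s₃ ⟨hv₃, ha₃, hf₃⟩ => (haltsWithin_sumDiagonal (by omega)
        (hX₂.congr hf₃ (by omega) ha₃)).imp fun s₄ ⟨hv₄, ha₄, hf₄⟩ => ⟨?_, hv₄, ?_⟩)))
  · rw [hf₄ 3 (by omega), hv₃]
  · rw [ha₄, ha₃, ha₂, ha₁]

end Setup

theorem length_le_inputSize (l : List ℕ) : l.length ≤ inputSize l := by
  simp [inputSize]

theorem inputSize_le_inputSize_cons (x : ℕ) (l : List ℕ) : inputSize l ≤ inputSize (x :: l) := by
  simp [inputSize]

theorem monotone_eval (b : Polynomial ℕ) : Monotone fun n => b.eval n := fun m n h => by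
  simp only [Polynomial.eval_eq_sum, Polynomial.sum_def]
  gcongr

end RAM

namespace FallColouring

open RAM

section Encoding

open Classical in
/-- The adjacency matrix as an array. -/
noncomputable def adjArray {n : ℕ} (G : SimpleGraph (Fin n)) : Fin n → Fin n → ℕ :=
  fun i j => if G.Adj i j then 1 else 0

open Classical in
theorem holdsMatrix_encodeGraph (G : InputGraph) :
    HoldsMatrix (encodeGraph G) 0 (adjArray G.2) where
  size := rfl
  entry i j := by
    have hij := (finProdFinEquiv (m := G.1) (n := G.1)).symm_apply_apply (i, j)
    simp only [finProdFinEquiv, Equiv.coe_fn_mk, Equiv.coe_fn_symm_mk, Prod.mk.injEq] at hij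
    have hlt : (i * G.1 + j : ℕ) < (List.ofFn fun t : Fin (G.1 * G.1) =>
      if G.2.Adj t.divNat t.modNat then 1 else 0).length := by
        simpa using flatIndex_lt i j
    rw [encodeGraph, zero_add, add_comm 1, List.getD_cons_succ, List.getD_eq_getElem _ _ hlt,
      List.getElem_ofFn, adjArray]
    simp only [mul_comm (i : ℕ), add_comm _ (j : ℕ), hij.1, hij.2]

theorem holdsMatrix_encodeGraphNat (G : InputGraph) (k : ℕ) :
    HoldsMatrix (encodeGraphNat (G, k)) 1 (adjArray G.2) where
  size := rfl
  entry i j := by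
    rw [← (holdsMatrix_encodeGraph G).entry i j, encodeGraphNat, add_assoc 1, add_comm 1,
      List.getD_cons_succ, zero_add]

theorem le_inputSize_encodeGraph (G : InputGraph) : G.1 ≤ inputSize (encodeGraph G) := by
  refine le_trans ?_ (length_le_inputSize _)
  simp only [encodeGraph, List.length_cons, List.length_ofFn]
  exact (Nat.le_mul_self G.1).trans (Nat.le_succ _)

end Encoding

theorem polyTimeOn_of_arrayProg {P : InputGraph → Prop} {f : InputGraph → ℕ} (c : ArrayProg)
    (a₁ a₂ : ℕ)
    (h : ∀ G, P G → f G = if ∑ i, c.eval (inputArrays (adjArray G.2)) a₁ i i = 0 then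
      ∑ i, c.eval (inputArrays (adjArray G.2)) a₂ i i else 0) :
    PolyTimeOn P encodeGraph f := by
  obtain ⟨prog, b, hb⟩ := exists_haltsWithin_sumDiagonal_eval c a₁ a₂ 0
  refine ⟨.seq prog (.cond (.var 3) (.assign 0 (.lit 0)) (.assign 0 (.var 4))), b + .C 4,
    fun G hG => ?_⟩
  refine HaltsWithin.mono (.seq ((hb (holdsMatrix_encodeGraph G)).imp fun s ⟨h₃, h₄, _⟩ =>
    .cond (T := 2) (Q := fun s' => s'.var 0 = f G) (fun h0 => .assign ?_) fun h0 => .assign ?_))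
    ?_ fun _ => id
  · rw [State.setVar_var_self, h G hG, ← h₃]
    exact (if_neg h0).symm
  · rw [State.setVar_var_self, h G hG, ← h₃, ← h₄]
    exact (if_pos h0).symm
  · rw [Polynomial.eval_add, Polynomial.eval_C]
    exact Nat.add_le_add_right (monotone_eval b (le_inputSize_encodeGraph G)) _

/-- An expression that vanishes exactly if variable `3` does and variable `4` holds the first entry
of the input. Two natural numbers are equal iff both truncated differences are zero. -/
def mismatchExpr : Expr :=
  .add (.var 3) (.add (.sub (.var 4) (.get 0 (.lit 0))) (.sub (.get 0 (.lit 0)) (.var 4)))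

theorem mismatchExpr_eval_eq_zero_iff {s : State} :
    mismatchExpr.eval s = 0 ↔ s.var 3 = 0 ∧ s.var 4 = s.arr 0 0 := by
  simp only [mismatchExpr, Expr.eval]
  omega

theorem polyTimeDecidableOn_of_arrayProg {P : InputGraph → Prop} {Q : InputGraph × ℕ → Prop}
    (c : ArrayProg) (a₁ a₂ : ℕ)
    (h : ∀ G k, P G → (Q (G, k) ↔ ∑ i, c.eval (inputArrays (adjArray G.2)) a₁ i i = 0 ∧
      ∑ i, c.eval (inputArrays (adjArray G.2)) a₂ i i = k)) :
    PolyTimeDecidableOn (fun x => P x.1) encodeGraphNat Q := by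
  classical
  obtain ⟨prog, b, hb⟩ := exists_haltsWithin_sumDiagonal_eval c a₁ a₂ 1
  refine ⟨.seq prog (.cond mismatchExpr (.assign 0 (.lit 0)) (.assign 0 (.lit 1))), b + .C 14,
    fun ⟨G, k⟩ hG => ?_⟩
  have hQ : ∀ {s : State}, s.var 3 = ∑ i, c.eval (inputArrays (adjArray G.2)) a₁ i i →
      s.var 4 = ∑ i, c.eval (inputArrays (adjArray G.2)) a₂ i i →
      s.arr 0 = (start (encodeGraphNat (G, k))).arr 0 →
      (mismatchExpr.eval s = 0 ↔ Q (G, k)) := fun h₃ h₄ ha => by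
    rw [mismatchExpr_eval_eq_zero_iff, h₃, h₄, ha, h G k hG]
    rfl
  refine HaltsWithin.mono (.seq ((hb (holdsMatrix_encodeGraphNat G k)).imp fun s ⟨h₃, h₄, ha⟩ =>
    .cond (T := 2) (Q := fun s' => s'.var 0 = if Q (G, k) then 1 else 0)
      (fun h0 => .assign ?_) fun h0 => .assign ?_)) ?_ fun _ => id
  · exact (if_neg fun hq => h0 ((hQ h₃ h₄ ha).2 hq)).symm
  · exact (if_pos ((hQ h₃ h₄ ha).1 h0)).symm
  · rw [Polynomial.eval_add, Polynomial.eval_C]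
    exact Nat.add_le_add_right (monotone_eval b ((le_inputSize_encodeGraph G).trans
      (inputSize_le_inputSize_cons k _))) _

end FallColouring

/-! ### Maximum matchings -/

namespace FallColouring

variable {α : Type*} {B : SimpleGraph α}

/-- A matching of `B`, encoded as the involution that exchanges the ends of every matching edge
and fixes the uncovered vertices. -/
structure IsMate (B : SimpleGraph α) (f : α → α) : Prop where
  involutive : Function.Involutive f
  adj : ∀ {y}, f y ≠ y → B.Adj y (f y)

open Classical in
/-- The matching `f` together with the edge `uv`, for uncovered vertices `u` and `v`. -/
noncomputable def link (u v : α) (f : α → α) (y : α) : α :=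
  if y = u then v else if y = v then u else f y

theorem IsMate.link {u v : α} {f : α → α} (hf : IsMate B f) (hu : f u = u) (hv : f v = v)
    (huv : B.Adj u v) : IsMate B (link u v f) := by
  have := hf.involutive
  have := @hf.adj
  have := huv.symm
  constructor
  · intro y
    unfold FallColouring.link
    grind [Function.Involutive]
  · intro y
    unfold FallColouring.link
    grind

theorem link_eq_self_iff {u v : α} (huv : u ≠ v) (f : α → α) (y : α) :
    link u v f y = y ↔ y ≠ u ∧ y ≠ v ∧ f y = y := by
  unfold link
  grind

open Classical in
/-- The matching that agrees with `f` on `s` and with `g` off `s`, except that `x` is left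
uncovered. -/
noncomputable def glue (s : Set α) (x : α) (f g : α → α) (y : α) : α :=
  if y ∈ s then f y else if y = x then x else g y

theorem IsMate.glue {s : Set α} {x : α} {f g : α → α} (hf : IsMate B f) (hg : IsMate B g)
    (hfs : ∀ y ∈ s, f y ∈ s) (hgs : ∀ y ∉ s, y ≠ x → g y ∉ s ∧ g y ≠ x) :
    IsMate B (glue s x f g) := by
  have := hf.involutive
  have := @hf.adj
  have := hg.involutive
  have := @hg.adj
  constructor
  · intro y
    unfold FallColouring.glue
    grind [Function.Involutive]
  · intro y
    unfold FallColouring.glue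
    grind

theorem glue_eq_self_iff {s : Set α} {x : α} {f g : α → α} {y : α} :
    glue s x f g y = y ↔ y ∈ s ∧ f y = y ∨ y ∉ s ∧ (y = x ∨ g y = y) := by
  unfold glue
  grind

/-- A stage of Edmonds' blossom algorithm. The vertices in `even` are those known to be reachable
from `root` by an alternating path of even length; instead of blossoms, the search stores for each
`u ∈ even` the matching `mate u` obtained by switching along such a path. In particular
`mate root` is the current matching. -/
structure Search (α : Type*) where
  root : α
  even : Set α
  mate : α → α → α

namespace Search

variable (S : Search α)

/-- The vertices of the search tree that are matched into `even` without being in `even`. -/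
def odd : Set α := {a | a ∉ S.even ∧ S.mate S.root a ∈ S.even}

/-- The odd vertices on the path from the root to `u`: those at which switching changes the
matching. -/
def path (u : α) : Set α := {a ∈ S.odd | S.mate u a ≠ S.mate S.root a}

/-- The predecessor of the odd vertex `a` in the search tree. -/
def pred (a : α) : α := S.mate (S.mate S.root a) a

/-- The part of the invariant of the search that concerns the matchings: switching to `u` moves the
uncovered vertex from the root to `u` and changes the matching only inside the tree, where the root
is the only uncovered even vertex, and matching edges between even vertices join vertices with the
same path. -/
structure IsSwitching (B : SimpleGraph α) : Prop where
  root_mem : S.root ∈ S.even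
  isMate : ∀ {u}, u ∈ S.even → IsMate B (S.mate u)
  fixed_iff : ∀ {u y}, u ∈ S.even →
    (S.mate u y = y ↔ y = u ∨ S.mate S.root y = y ∧ y ≠ S.root)
  eq_root : ∀ {y}, y ∈ S.even → S.mate S.root y = y → y = S.root
  outside : ∀ {u y}, u ∈ S.even → y ∉ S.even → y ∉ S.odd → S.mate u y = S.mate S.root y
  path_congr : ∀ {u y}, u ∈ S.even → y ∈ S.even → S.mate u y ∈ S.even →
    S.path y = S.path (S.mate u y)

/-- The part of the invariant of the search that concerns the paths: the sets `path u` are the sets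
of odd vertices above the vertices of a rooted tree whose vertices are the odd vertices and the
classes of even vertices with the same path, each odd vertex `a` lying between the class of `pred a`
and that of its mate. -/
structure IsTree : Prop where
  pred_mem : ∀ {a}, a ∈ S.odd → S.pred a ∈ S.even
  mate_of_mem_path : ∀ {u a}, u ∈ S.even → a ∈ S.path u → S.mate u a = S.pred a
  path_mate : ∀ {a}, a ∈ S.odd → S.path (S.mate S.root a) = insert a (S.path (S.pred a))
  notMem_path_pred : ∀ {a}, a ∈ S.odd → a ∉ S.path (S.pred a)
  path_pred_subset : ∀ {u a}, u ∈ S.even → a ∈ S.path u → S.path (S.pred a) ⊆ S.path u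
  path_chain : ∀ {u a z}, u ∈ S.even → a ∈ S.path u → z ∈ S.path u →
    z = a ∨ z ∈ S.path (S.pred a) ∨ a ∈ S.path (S.pred z)

/-- The invariant of the search. -/
structure IsValid (B : SimpleGraph α) : Prop extends S.IsSwitching B, S.IsTree

variable {S}

theorem notMem_path_root (a : α) : a ∉ S.path S.root := fun h => h.2 rfl

theorem mem_odd_of_mem_path {u a : α} (h : a ∈ S.path u) : a ∈ S.odd := h.1

theorem notMem_even_of_mem_path {u a : α} (h : a ∈ S.path u) : a ∉ S.even := h.1.1

theorem mate_of_notMem_path {u a : α} (ha : a ∈ S.odd) (h : a ∉ S.path u) :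
    S.mate u a = S.mate S.root a := by
  by_contra hne
  exact h ⟨ha, hne⟩

/-- The search that has found no vertex but its root. -/
def single (r : α) (f : α → α) : Search α := ⟨r, {r}, fun _ => f⟩

theorem isValid_single {r : α} {f : α → α} (hf : IsMate B f) (hr : f r = r) :
    (single r f).IsValid B := by
  have hodd : ∀ a, a ∉ (single r f).odd := by
    rintro a ⟨ha, ha'⟩
    refine ha (show a = r from ?_)
    rw [← hf.involutive a, show f a = r from ha', hr]
  have hpath : ∀ u a, a ∉ (single r f).path u := fun u a h => hodd a h.1
  constructor <;> constructor <;> grind [single]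

namespace IsValid

variable (h : S.IsValid B)
include h

theorem mate_root_root : S.mate S.root S.root = S.root :=
  (h.fixed_iff h.root_mem).2 (Or.inl rfl)

theorem mate_self {u : α} (hu : u ∈ S.even) : S.mate u u = u :=
  (h.fixed_iff hu).2 (Or.inl rfl)

theorem mate_mate {u : α} (hu : u ∈ S.even) (y : α) : S.mate u (S.mate u y) = y :=
  (h.isMate hu).involutive y

theorem mem_path_mate {a : α} (ha : a ∈ S.odd) : a ∈ S.path (S.mate S.root a) := by
  rw [h.path_mate ha]
  exact Set.mem_insert a _

theorem mate_odd {u a : α} (hu : u ∈ S.even) (ha : a ∈ S.odd) :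
    S.mate u a = S.pred a ∨ S.mate u a = S.mate S.root a := by
  by_cases hp : a ∈ S.path u
  · exact Or.inl (h.mate_of_mem_path hu hp)
  · exact Or.inr (mate_of_notMem_path ha hp)

theorem mate_odd_mem_even {u a : α} (hu : u ∈ S.even) (ha : a ∈ S.odd) : S.mate u a ∈ S.even := by
  rcases h.mate_odd hu ha with he | he <;> rw [he]
  exacts [h.pred_mem ha, ha.2]

theorem mate_even_mem {u y : α} (hu : u ∈ S.even) (hy : y ∈ S.even) :
    S.mate u y ∈ S.even ∨ S.mate u y ∈ S.odd := by
  by_contra! hc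
  have hout := h.outside hu hc.1 hc.2
  rw [h.mate_mate hu] at hout
  exact hc.2 ⟨hc.1, hout ▸ hy⟩

theorem eq_pred_or_eq_mate {u y : α} (hu : u ∈ S.even) (ho : S.mate u y ∈ S.odd) :
    S.mate u y ∈ S.path u ∧ y = S.pred (S.mate u y) ∨
      S.mate u y ∉ S.path u ∧ y = S.mate S.root (S.mate u y) := by
  by_cases hp : S.mate u y ∈ S.path u
  · exact Or.inl ⟨hp, by rw [← h.mate_of_mem_path hu hp, h.mate_mate hu]⟩
  · exact Or.inr ⟨hp, by rw [← mate_of_notMem_path ho hp, h.mate_mate hu]⟩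

end IsValid

open Classical in
/-- The search after the even vertex `v` is joined to the matching edge of a vertex `w` outside the
tree. -/
noncomputable def grow (S : Search α) (v w : α) : Search α where
  root := S.root
  even := insert (S.mate S.root w) S.even
  mate u := if u = S.mate S.root w then
    link w v (glue {w} (S.mate S.root w) id (S.mate v)) else S.mate u

theorem root_grow (v w : α) : (S.grow v w).root = S.root := rfl

theorem mem_even_grow {v w y : α} :
    y ∈ (S.grow v w).even ↔ y = S.mate S.root w ∨ y ∈ S.even := Iff.rfl

theorem mate_grow_new (v w : α) : (S.grow v w).mate (S.mate S.root w) =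
    link w v (glue {w} (S.mate S.root w) id (S.mate v)) := if_pos rfl

section Grow

variable {v w : α} (hw : w ∉ S.even) (hw' : w ∉ S.odd)
include hw hw'

theorem mate_grow {u : α} (hu : u ∈ S.even) : (S.grow v w).mate u = S.mate u :=
  if_neg fun (e : u = S.mate S.root w) => hw' ⟨hw, e ▸ hu⟩

variable (h : S.IsValid B)
include h

theorem IsValid.mate_root_notMem : S.mate S.root w ∉ S.even ∧ S.mate S.root w ∉ S.odd :=
  ⟨fun e => hw' ⟨hw, e⟩, fun e => hw (by simpa only [h.mate_mate h.root_mem] using e.2)⟩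

theorem IsValid.pred_grow {a : α} (ha : a ∈ S.odd) : (S.grow v w).pred a = S.pred a := by
  simp only [pred, root_grow, mate_grow hw hw' h.root_mem, mate_grow hw hw' ha.2]

theorem IsValid.pred_grow_new : (S.grow v w).pred w = v := by
  simp only [pred, root_grow, mate_grow hw hw' h.root_mem, mate_grow_new, link, if_true]

theorem IsValid.isMate_grow_new (hv : v ∈ S.even) (hvw : B.Adj v w) :
    IsMate B ((S.grow v w).mate (S.mate S.root w)) := by
  have hout := h.outside hv hw hw'
  have hout' := h.outside hv (h.mate_root_notMem hw hw').1 (h.mate_root_notMem hw hw').2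
  rw [h.mate_mate h.root_mem] at hout'
  have hid : IsMate B id := ⟨fun _ => rfl, fun hy => absurd rfl hy⟩
  rw [mate_grow_new]
  refine (hid.glue (h.isMate hv) (fun y hy => hy) fun y hy hyx => ⟨fun e => ?_, fun e => ?_⟩).link
    ?_ ?_ hvw.symm
  · exact hyx (by rw [← h.mate_mate hv y, show S.mate v y = w from e, hout])
  · exact hy (by rw [← h.mate_mate hv y, e, hout']; exact Set.mem_singleton w)
  · exact if_pos (Set.mem_singleton w)
  · have : v ≠ S.mate S.root w := fun e => (h.mate_root_notMem hw hw').1 (e ▸ hv)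
    exact glue_eq_self_iff.2 (Or.inr ⟨fun e => hw (e ▸ hv), Or.inr (h.mate_self hv)⟩)

variable (hne : S.mate S.root w ≠ w)
include hne

theorem IsValid.odd_grow : (S.grow v w).odd = insert w S.odd := by
  have := (h.mate_root_notMem hw hw').1
  ext a
  have := h.mate_mate h.root_mem a
  have := h.mate_mate h.root_mem w
  simp only [odd, root_grow, mate_grow hw hw' h.root_mem, mem_even_grow, Set.mem_insert_iff,
    Set.mem_ofPred_eq]
  grind

theorem IsValid.path_grow {u : α} (hu : u ∈ S.even) : (S.grow v w).path u = S.path u := by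
  have := h.outside hu hw hw'
  ext a
  simp only [path, h.odd_grow hw hw' hne, mate_grow hw hw' hu, mate_grow hw hw' h.root_mem,
    root_grow, Set.mem_ofPred_eq, Set.mem_insert_iff]
  grind

variable (hv : v ∈ S.even)
include hv

theorem IsValid.path_grow_new :
    (S.grow v w).path (S.mate S.root w) = insert w (S.path v) := by
  have := h.mate_root_notMem hw hw'
  have hodd : ∀ a ∈ S.odd, a ∉ S.even := fun a ha => ha.1
  ext a
  simp only [path, h.odd_grow hw hw' hne, mate_grow hw hw' h.root_mem, root_grow, mate_grow_new,
    Set.mem_ofPred_eq, Set.mem_insert_iff]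
  unfold link glue
  grind

theorem IsValid.path_congr_grow {u y : α} (hu : u ∈ (S.grow v w).even)
    (hy : y ∈ (S.grow v w).even) (hm : (S.grow v w).mate u y ∈ (S.grow v w).even) :
    (S.grow v w).path y = (S.grow v w).path ((S.grow v w).mate u y) := by
  have hpath : ∀ {u}, u ∈ S.even → (S.grow v w).path u = S.path u := h.path_grow hw hw' hne
  have hold : ∀ u ∈ S.even, S.mate u y ∈ (S.grow v w).even →
      (S.grow v w).path y = (S.grow v w).path (S.mate u y) := by
    intro u hu hm
    have hout := h.outside hu hw hw'
    have hinv := h.mate_mate hu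
    rcases hy with rfl | hy
    · rw [← hout, hinv] at hm
      exact absurd (hm.resolve_right hw) hne.symm
    · have hm := hm.resolve_left fun e => hw (by rwa [← hinv w, hout, ← e, hinv])
      rw [hpath hy, hpath hm]
      exact h.path_congr hu hy hm
  rcases hu with rfl | hu
  · have := hold v hv
    have : w ∉ (S.grow v w).even := by simp only [mem_even_grow]; tauto
    rw [mate_grow_new] at hm ⊢
    unfold link glue at hm ⊢
    grind
  · rw [mate_grow hw hw' hu] at hm ⊢
    exact hold u hu hm

theorem IsValid.isSwitching_grow (hvw : B.Adj v w) : (S.grow v w).IsSwitching B := by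
  have := h.mate_root_notMem hw hw'
  have hmate : ∀ {u}, u ∈ S.even → (S.grow v w).mate u = S.mate u := mate_grow hw hw'
  have hodd := h.odd_grow (v := v) hw hw' hne
  refine ⟨Or.inr h.root_mem, ?_, ?_, ?_, ?_, h.path_congr_grow hw hw' hne hv⟩ <;>
    simp only [root_grow, mem_even_grow, hmate h.root_mem, hodd, Set.mem_insert_iff]
  · rintro u (rfl | hu)
    · exact h.isMate_grow_new hw hw' hv hvw
    · exact hmate hu ▸ h.isMate hu
  · rintro u y (rfl | hu)
    · rw [mate_grow_new, link_eq_self_iff hvw.symm.ne, glue_eq_self_iff]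
      have := h.fixed_iff (y := y) hv
      have := h.eq_root hv
      have := h.mate_root_root
      grind
    · rw [hmate hu]
      exact h.fixed_iff hu
  · have := h.mate_mate h.root_mem w
    rintro y (rfl | hy)
    · grind
    · exact h.eq_root hy
  · rintro u y (rfl | hu) hy ho
    · have := h.outside (y := y) hv
      rw [mate_grow_new]
      unfold link glue
      grind
    · rw [hmate hu]
      exact h.outside hu (by tauto) (by tauto)

theorem IsValid.mate_grow_of_mem_path {u a : α} (hu : u ∈ (S.grow v w).even)
    (ha : a ∈ (S.grow v w).path u) : (S.grow v w).mate u a = (S.grow v w).pred a := by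
  rcases hu with rfl | hu
  · rw [h.path_grow_new hw hw' hne hv] at ha
    have := h.mate_of_mem_path (a := a) hv
    have := mem_odd_of_mem_path (S := S) (u := v) (a := a)
    have := notMem_even_of_mem_path (S := S) (u := v) (a := a)
    have := h.mate_root_notMem hw hw'
    have hpred : a ∈ S.odd → (S.grow v w).pred a = S.pred a := h.pred_grow hw hw'
    have hpred' := h.pred_grow_new (v := v) hw hw'
    rw [mate_grow_new]
    unfold link glue
    grind
  · rw [h.path_grow hw hw' hne hu] at ha
    rw [mate_grow hw hw' hu, h.pred_grow hw hw' ha.1]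
    exact h.mate_of_mem_path hu ha

theorem IsValid.isTree_grow : (S.grow v w).IsTree := by
  have hpath : ∀ {u}, u ∈ S.even → (S.grow v w).path u = S.path u := h.path_grow hw hw' hne
  have hnew := h.path_grow_new hw hw' hne hv
  have hpred : ∀ {a}, a ∈ S.odd → (S.grow v w).path ((S.grow v w).pred a) = S.path (S.pred a) :=
    fun ha => by rw [h.pred_grow hw hw' ha, hpath (h.pred_mem ha)]
  have hpred' : (S.grow v w).path ((S.grow v w).pred w) = S.path v := by
    rw [h.pred_grow_new hw hw', hpath hv]
  refine ⟨?_, h.mate_grow_of_mem_path hw hw' hne hv, ?_, ?_, ?_, ?_⟩ <;>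
    simp only [root_grow, mem_even_grow, mate_grow hw hw' h.root_mem, h.odd_grow hw hw' hne,
      Set.mem_insert_iff]
  · rintro a (rfl | ha)
    · exact Or.inr ((h.pred_grow_new hw hw').symm ▸ hv)
    · exact Or.inr (h.pred_grow hw hw' ha ▸ h.pred_mem ha)
  · rintro a (rfl | ha)
    · rw [hnew, hpred']
    · rw [hpath ha.2, hpred ha]
      exact h.path_mate ha
  · rintro a (rfl | ha)
    · exact hpred' ▸ fun e => hw' e.1
    · exact hpred ha ▸ h.notMem_path_pred ha
  · rintro u a (rfl | hu) ha
    · rw [hnew] at ha ⊢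
      rcases ha with rfl | ha
      · exact hpred' ▸ Set.subset_insert a _
      · exact hpred ha.1 ▸ (h.path_pred_subset hv ha).trans (Set.subset_insert w _)
    · rw [hpath hu] at ha ⊢
      exact hpred ha.1 ▸ h.path_pred_subset hu ha
  · rintro u a z (rfl | hu) ha hz
    · rw [hnew] at ha hz
      rcases ha with rfl | ha <;> rcases hz with rfl | hz
      · exact Or.inl rfl
      · exact Or.inr (Or.inl (hpred' ▸ hz))
      · exact Or.inr (Or.inr (hpred' ▸ ha))
      · exact hpred ha.1 ▸ hpred hz.1 ▸ h.path_chain hv ha hz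
    · rw [hpath hu] at ha hz
      exact hpred ha.1 ▸ hpred hz.1 ▸ h.path_chain hu ha hz

theorem IsValid.grow (hvw : B.Adj v w) : (S.grow v w).IsValid B :=
  ⟨h.isSwitching_grow hw hw' hne hv hvw, h.isTree_grow hw hw' hne hv⟩

end Grow

/-- The vertices of the search tree that are proper descendants of the odd vertex `x`. -/
def below (S : Search α) (x : α) : Set α :=
  {y | y ∈ S.even ∧ x ∈ S.path y ∨ y ∈ S.odd ∧ x ∈ S.path (S.pred y)}

/-- The matching that leaves `x` uncovered, for an odd vertex `x` on the path to `u` but not on the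
path to its neighbour `v`: below `x` the matching is switched along the path to `u`, elsewhere along
the path to `v`, and `u` is matched with `v`. -/
noncomputable def cycle (S : Search α) (u v x : α) : α → α :=
  link u v (glue (S.below x) x (S.mate u) (S.mate v))

open Classical in
/-- The search after the even vertices `u` and `v` are found to be adjacent: the odd vertices on
the cycle formed by the paths to `u` and `v` become even, and the cycle becomes a single class. -/
noncomputable def merge (S : Search α) (u v : α) : Search α where
  root := S.root
  even := S.even ∪ symmDiff (S.path u) (S.path v)
  mate x := if x ∈ S.path u \ S.path v then S.cycle u v x
    else if x ∈ S.path v \ S.path u then S.cycle v u x else S.mate x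

theorem merge_comm (u v : α) : S.merge u v = S.merge v u := by
  simp only [merge, symmDiff_comm (S.path u), Search.mk.injEq, true_and]
  funext x
  have : x ∈ S.path u \ S.path v → x ∉ S.path v \ S.path u := fun h h' => h.2 h'.1
  grind

theorem root_merge (u v : α) : (S.merge u v).root = S.root := rfl

theorem mem_even_merge {u v y : α} :
    y ∈ (S.merge u v).even ↔ y ∈ S.even ∨ y ∈ symmDiff (S.path u) (S.path v) := Iff.rfl

theorem mate_merge_of_mem {u v x : α} (hx : x ∈ S.path u \ S.path v) :
    (S.merge u v).mate x = S.cycle u v x := if_pos hx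

theorem mate_merge_of_notMem {u v x : α} (hx : x ∉ symmDiff (S.path u) (S.path v)) :
    (S.merge u v).mate x = S.mate x := by
  rw [Set.mem_symmDiff] at hx
  simp only [merge, Set.mem_sdiff]
  grind

theorem mem_odd_of_mem_symmDiff {u v x : α} (hx : x ∈ symmDiff (S.path u) (S.path v)) :
    x ∈ S.odd := by
  rcases hx with hx | hx <;> exact hx.1.1

theorem notMem_symmDiff_of_mem_even {u v x : α} (hx : x ∈ S.even) :
    x ∉ symmDiff (S.path u) (S.path v) :=
  fun e => (mem_odd_of_mem_symmDiff e).1 hx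

theorem mate_merge {u v x : α} (hx : x ∈ S.even) : (S.merge u v).mate x = S.mate x :=
  mate_merge_of_notMem (notMem_symmDiff_of_mem_even hx)

namespace IsValid

variable (h : S.IsValid B)
include h

theorem mate_mem_below {w x y : α} (hw : w ∈ S.even) (hy : y ∈ S.below x) :
    S.mate w y ∈ S.below x ∨ S.mate w y = x ∧ x ∉ S.path w := by
  rcases hy with ⟨he, hp⟩ | ⟨ho, hp⟩
  · rcases h.mate_even_mem hw he with hm | hm
    · exact Or.inl (Or.inl ⟨hm, h.path_congr hw he hm ▸ hp⟩)
    · rcases h.eq_pred_or_eq_mate hw hm with ⟨-, e⟩ | ⟨hn, e⟩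
      · exact Or.inl (Or.inr ⟨hm, e ▸ hp⟩)
      · rw [e, h.path_mate hm] at hp
        rcases hp with rfl | hp
        · exact Or.inr ⟨rfl, hn⟩
        · exact Or.inl (Or.inr ⟨hm, hp⟩)
  · left
    rcases h.mate_odd hw ho with e | e <;> rw [e]
    · exact Or.inl ⟨h.pred_mem ho, hp⟩
    · exact Or.inl ⟨ho.2, h.path_mate ho ▸ Set.mem_insert_of_mem y hp⟩

theorem notMem_below_self {x : α} (hx : x ∈ S.odd) : x ∉ S.below x := by
  rintro (⟨he, -⟩ | ⟨-, hp⟩)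
  exacts [hx.1 he, h.notMem_path_pred hx hp]

variable {u v x : α} (hu : u ∈ S.even) (hv : v ∈ S.even) (huv : B.Adj u v)
  (hx : x ∈ S.path u) (hx' : x ∉ S.path v)
include hv hx hx'

omit h hx in
theorem notMem_below_of_notMem_path : v ∉ S.below x := by
  rintro (⟨-, hp⟩ | ⟨ho, -⟩)
  exacts [hx' hp, ho.1 hv]

theorem mate_notMem_below {y : α} (hy : y ∉ S.below x) (hyx : y ≠ x) :
    S.mate v y ∉ S.below x ∧ S.mate v y ≠ x := by
  constructor
  · intro hb
    have := h.mate_mem_below hv hb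
    rw [h.mate_mate hv] at this
    tauto
  · intro e
    have ho := hx.1
    rw [← h.mate_mate hv y, e, mate_of_notMem_path ho hx'] at hy
    exact hy (Or.inl ⟨ho.2, h.mem_path_mate ho⟩)

include hu huv

theorem isMate_cycle : IsMate B (S.cycle u v x) := by
  refine ((h.isMate hu).glue (h.isMate hv) (fun y hy => ?_) fun y =>
    h.mate_notMem_below hv hx hx').link ?_ ?_ huv
  · exact (h.mate_mem_below hu hy).resolve_right fun e => e.2 hx
  · exact glue_eq_self_iff.2 (Or.inl ⟨Or.inl ⟨hu, hx⟩, h.mate_self hu⟩)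
  · exact glue_eq_self_iff.2
      (Or.inr ⟨notMem_below_of_notMem_path hv hx', Or.inr (h.mate_self hv)⟩)

omit hx' in
theorem cycle_eq_self_iff {y : α} :
    S.cycle u v x y = y ↔ y = x ∨ S.mate S.root y = y ∧ y ≠ S.root := by
  rw [cycle, link_eq_self_iff huv.ne, glue_eq_self_iff, h.fixed_iff hu, h.fixed_iff hv]
  have := h.notMem_below_self hx.1
  have := h.eq_root hu
  have := h.eq_root hv
  have := hx.1.1
  grind

end IsValid

theorem cycle_cases (u v x y : α) : y = u ∧ S.cycle u v x y = v ∨ y = v ∧ S.cycle u v x y = u ∨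
    y = x ∧ S.cycle u v x y = x ∨ S.cycle u v x y = S.mate u y ∨ S.cycle u v x y = S.mate v y := by
  unfold cycle link glue
  grind

section Merge

variable (h : S.IsValid B) {u v : α} (hu : u ∈ S.even) (hv : v ∈ S.even)
include h

theorem IsValid.odd_merge : (S.merge u v).odd = S.odd \ symmDiff (S.path u) (S.path v) := by
  ext a
  have hm : S.mate S.root a ∈ symmDiff (S.path u) (S.path v) → a ∈ S.even := fun hm => by
    have := (mem_odd_of_mem_symmDiff hm).2
    rwa [h.mate_mate h.root_mem] at this
  simp only [odd, root_merge, mate_merge h.root_mem, mem_even_merge, Set.mem_sdiff,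
    Set.mem_ofPred_eq]
  tauto

omit h in
theorem pred_merge {a : α} (hr : S.root ∈ S.even) (ha : a ∈ S.odd) :
    (S.merge u v).pred a = S.pred a := by
  simp only [pred, root_merge, mate_merge hr, mate_merge ha.2]

theorem IsValid.path_merge {y : α} (hy : y ∈ S.even) :
    (S.merge u v).path y = S.path y \ symmDiff (S.path u) (S.path v) := by
  ext a
  simp only [path, h.odd_merge, root_merge, mate_merge h.root_mem, mate_merge hy, Set.mem_sdiff,
    Set.mem_ofPred_eq]
  tauto

omit h in
theorem mate_merge_cases {x : α} (hx : x ∈ symmDiff (S.path u) (S.path v)) (y : α) :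
    y = u ∧ (S.merge u v).mate x y = v ∨ y = v ∧ (S.merge u v).mate x y = u ∨
      y = x ∧ (S.merge u v).mate x y = x ∨
      (S.merge u v).mate x y = S.mate u y ∨ (S.merge u v).mate x y = S.mate v y := by
  wlog hxu : x ∈ S.path u \ S.path v generalizing u v
  · have := this (symmDiff_comm (S.path u) _ ▸ hx) (hx.resolve_left hxu)
    rw [merge_comm] at this
    tauto
  rw [mate_merge_of_mem hxu]
  exact cycle_cases u v x y

include hu hv

theorem IsValid.path_merge_of_mem_symmDiff {x : α} (hx : x ∈ symmDiff (S.path u) (S.path v)) :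
    (S.merge u v).path x = S.path u ∩ S.path v := by
  wlog hxu : x ∈ S.path u \ S.path v generalizing u v
  · rw [merge_comm, Set.inter_comm]
    exact this hv hu (symmDiff_comm (S.path u) _ ▸ hx) (hx.resolve_left hxu)
  ext a
  simp only [path, h.odd_merge, root_merge, mate_merge h.root_mem, mate_merge_of_mem hxu,
    Set.mem_ofPred_eq, Set.mem_inter_iff, Set.mem_sdiff, Set.mem_symmDiff]
  have := cycle_cases (S := S) u v x a
  have : a ∈ S.odd → a ∉ S.even := fun ha => ha.1
  simp only [path, Set.mem_sdiff, Set.mem_ofPred_eq] at hxu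
  grind

theorem IsValid.path_pred_sdiff {y : α} (hy : y ∈ symmDiff (S.path u) (S.path v)) :
    S.path (S.pred y) \ symmDiff (S.path u) (S.path v) = S.path u ∩ S.path v := by
  wlog hyu : y ∈ S.path u \ S.path v generalizing u v
  · rw [symmDiff_comm, Set.inter_comm]
    exact this hv hu (symmDiff_comm (S.path u) _ ▸ hy) (hy.resolve_left hyu)
  ext z
  simp only [Set.mem_sdiff, Set.mem_symmDiff, Set.mem_inter_iff]
  have : z ∈ S.path (S.pred y) → z ∈ S.path u := fun hz => h.path_pred_subset hu hyu.1 hz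
  have := h.path_chain (z := z) hu hyu.1
  have hzv : z ∈ S.path v → y ∉ S.path (S.pred z) := fun hz hy =>
    hyu.2 (h.path_pred_subset hv hz hy)
  have := hyu.2
  grind

theorem IsValid.path_merge_mate {w y : α} (hw : w ∈ S.even)
    (hy : y ∈ symmDiff (S.path u) (S.path v)) :
    (S.merge u v).path (S.mate w y) = S.path u ∩ S.path v := by
  have ho := mem_odd_of_mem_symmDiff hy
  rw [h.path_merge (h.mate_odd_mem_even hw ho), ← h.path_pred_sdiff hu hv hy]
  rcases h.mate_odd hw ho with e | e <;> rw [e]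
  rw [h.path_mate ho, Set.insert_sdiff_of_mem _ hy]

theorem IsValid.path_merge_congr {w y : α} (hw : w ∈ S.even) (hy : y ∈ (S.merge u v).even)
    (hm : S.mate w y ∈ (S.merge u v).even) :
    (S.merge u v).path y = (S.merge u v).path (S.mate w y) := by
  rcases hy with hy | hy
  · rcases hm with hm | hm
    · rw [h.path_merge hy, h.path_merge hm, h.path_congr hw hy hm]
    · rw [h.path_merge_of_mem_symmDiff hu hv hm, ← h.path_merge_mate hu hv hw hm, h.mate_mate hw]
  · rw [h.path_merge_of_mem_symmDiff hu hv hy, h.path_merge_mate hu hv hw hy]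

theorem IsValid.path_merge_self : (S.merge u v).path u = (S.merge u v).path v := by
  rw [h.path_merge hu, h.path_merge hv]
  ext
  simp only [Set.mem_sdiff, Set.mem_symmDiff]
  tauto

theorem IsValid.isMate_merge (huv : B.Adj u v) {x : α}
    (hx : x ∈ symmDiff (S.path u) (S.path v)) : IsMate B ((S.merge u v).mate x) ∧
      ∀ y, (S.merge u v).mate x y = y ↔ y = x ∨ S.mate S.root y = y ∧ y ≠ S.root := by
  wlog hxu : x ∈ S.path u \ S.path v generalizing u v
  · rw [merge_comm]
    exact this hv hu huv.symm (symmDiff_comm (S.path u) _ ▸ hx) (hx.resolve_left hxu)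
  rw [mate_merge_of_mem hxu]
  exact ⟨h.isMate_cycle hu hv huv hxu.1 hxu.2, fun y => h.cycle_eq_self_iff hu hv huv hxu.1⟩

theorem IsValid.path_congr_merge {x y : α} (hx : x ∈ (S.merge u v).even)
    (hy : y ∈ (S.merge u v).even) (hm : (S.merge u v).mate x y ∈ (S.merge u v).even) :
    (S.merge u v).path y = (S.merge u v).path ((S.merge u v).mate x y) := by
  have huv := h.path_merge_self hu hv
  rcases hx with hx | hx
  · rw [mate_merge hx] at hm ⊢
    exact h.path_merge_congr hu hv hx hy hm
  · rcases mate_merge_cases hx y with ⟨rfl, e⟩ | ⟨rfl, e⟩ | ⟨rfl, e⟩ | e | e <;> rw [e] at hm ⊢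
    · exact huv
    · exact huv.symm
    · exact h.path_merge_congr hu hv hu hy hm
    · exact h.path_merge_congr hu hv hv hy hm

theorem IsValid.isSwitching_merge (huv : B.Adj u v) : (S.merge u v).IsSwitching B where
  root_mem := Or.inl h.root_mem
  isMate := by
    rintro x (hx | hx)
    · exact mate_merge hx ▸ h.isMate hx
    · exact (h.isMate_merge hu hv huv hx).1
  fixed_iff := by
    rintro x y (hx | hx) <;> rw [root_merge, mate_merge h.root_mem]
    · exact mate_merge hx ▸ h.fixed_iff hx
    · exact (h.isMate_merge hu hv huv hx).2 y
  eq_root := by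
    rintro y (hy | hy) he <;> rw [root_merge, mate_merge h.root_mem] at he
    · exact h.eq_root hy he
    · have ho := mem_odd_of_mem_symmDiff hy
      exact absurd (he ▸ ho.2) ho.1
  outside := by
    intro x y hx hy ho
    rw [h.odd_merge] at ho
    have ho : y ∉ S.odd := fun e => ho ⟨e, fun e => hy (Or.inr e)⟩
    have hy' : y ∉ S.even := fun e => hy (Or.inl e)
    rw [root_merge, mate_merge h.root_mem]
    rcases hx with hx | hx
    · rw [mate_merge hx, h.outside hx hy' ho]
    · rcases mate_merge_cases hx y with ⟨rfl, -⟩ | ⟨rfl, -⟩ | ⟨rfl, -⟩ | e | e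
      · exact absurd hu hy'
      · exact absurd hv hy'
      · exact absurd (mem_odd_of_mem_symmDiff hx) ho
      · rw [e, h.outside hu hy' ho]
      · rw [e, h.outside hv hy' ho]
  path_congr := h.path_congr_merge hu hv

theorem IsValid.mate_merge_of_mem_path {x a : α} (hx : x ∈ (S.merge u v).even)
    (ha : a ∈ (S.merge u v).path x) : (S.merge u v).mate x a = (S.merge u v).pred a := by
  have ho : a ∈ S.odd \ symmDiff (S.path u) (S.path v) := h.odd_merge ▸ ha.1
  rw [pred_merge h.root_mem ho.1]
  rcases hx with hx | hx
  · rw [h.path_merge hx] at ha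
    rw [mate_merge hx, h.mate_of_mem_path hx ha.1]
  · rw [h.path_merge_of_mem_symmDiff hu hv hx] at ha
    rcases mate_merge_cases hx a with ⟨rfl, -⟩ | ⟨rfl, -⟩ | ⟨rfl, -⟩ | e | e
    · exact absurd hu ho.1.1
    · exact absurd hv ho.1.1
    · exact absurd hx ho.2
    · rw [e, h.mate_of_mem_path hu ha.1]
    · rw [e, h.mate_of_mem_path hv ha.2]

theorem IsValid.isTree_merge : (S.merge u v).IsTree := by
  have hppred : ∀ {a}, a ∈ S.odd → (S.merge u v).path ((S.merge u v).pred a) =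
      S.path (S.pred a) \ symmDiff (S.path u) (S.path v) := fun ha => by
    rw [pred_merge h.root_mem ha, h.path_merge (h.pred_mem ha)]
  have hpath : ∀ {x}, x ∈ (S.merge u v).even → ∃ w ∈ S.even,
      (S.merge u v).path x = S.path w \ symmDiff (S.path u) (S.path v) := by
    rintro x (hx | hx)
    · exact ⟨x, hx, h.path_merge hx⟩
    · have ho := mem_odd_of_mem_symmDiff hx
      exact ⟨_, h.pred_mem ho, by
        rw [h.path_merge_of_mem_symmDiff hu hv hx, h.path_pred_sdiff hu hv hx]⟩
  have hodd : ∀ {a}, a ∈ (S.merge u v).odd → a ∈ S.odd \ symmDiff (S.path u) (S.path v) :=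
    fun ha => h.odd_merge ▸ ha
  refine ⟨fun ha => ?_, h.mate_merge_of_mem_path hu hv, fun {a} ha => ?_, fun {a} ha => ?_,
    fun {x a} hx ha => ?_, fun {x a z} hx ha hz => ?_⟩
  · rw [pred_merge h.root_mem (hodd ha).1]
    exact Or.inl (h.pred_mem (hodd ha).1)
  · obtain ⟨ho, ha⟩ := hodd ha
    rw [root_merge, mate_merge h.root_mem, h.path_merge ho.2, hppred ho, h.path_mate ho,
      Set.insert_sdiff_of_notMem _ ha]
  · rw [hppred (hodd ha).1]
    exact fun e => h.notMem_path_pred (hodd ha).1 e.1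
  · obtain ⟨w, hw, e⟩ := hpath hx
    rw [e] at ha ⊢
    exact hppred ha.1.1 ▸ Set.sdiff_subset_sdiff_left (h.path_pred_subset hw ha.1)
  · obtain ⟨w, hw, e⟩ := hpath hx
    rw [e] at ha hz
    rw [hppred ha.1.1, hppred hz.1.1]
    exact (h.path_chain hw ha.1 hz.1).imp_right (Or.imp (⟨·, hz.2⟩) (⟨·, ha.2⟩))

theorem IsValid.merge (huv : B.Adj u v) : (S.merge u v).IsValid B :=
  ⟨h.isSwitching_merge hu hv huv, h.isTree_merge hu hv⟩

end Merge

theorem IsValid.isMate_augment (h : S.IsValid B) {u w : α} (hu : u ∈ S.even) (hw : w ∉ S.even)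
    (hwf : S.mate S.root w = w) (huw : B.Adj u w) : IsMate B (link u w (S.mate u)) :=
  (h.isMate hu).link (h.mate_self hu)
    ((h.fixed_iff hu).2 (Or.inr ⟨hwf, fun e => hw (e ▸ h.root_mem)⟩)) huw

theorem IsValid.augment_eq_self_iff (h : S.IsValid B) {u w : α} (hu : u ∈ S.even)
    (huw : B.Adj u w) (y : α) :
    link u w (S.mate u) y = y ↔ y ≠ S.root ∧ y ≠ w ∧ S.mate S.root y = y := by
  rw [link_eq_self_iff huw.ne, h.fixed_iff hu]
  have := h.eq_root hu
  grind

theorem IsValid.mate_mem_class (h : S.IsValid B) {u y : α} (hu : u ∈ S.even)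
    (hy : y ∈ {y ∈ S.even | S.path y = S.path u}) :
    S.mate u y ∈ {y ∈ S.even | S.path y = S.path u} := by
  obtain ⟨hy, hp⟩ := hy
  rcases h.mate_even_mem hu hy with hm | hm
  · exact ⟨hm, (h.path_congr hu hy hm).symm.trans hp⟩
  · exfalso
    rcases h.eq_pred_or_eq_mate hu hm with ⟨ha, e⟩ | ⟨ha, e⟩
    · have := h.notMem_path_pred hm
      rw [← e, hp] at this
      exact this ha
    · have := h.mem_path_mate hm
      rw [← e, hp] at this
      exact ha this

end Search

theorem even_ncard_of_involutive {s : Set α} {f : α → α} (hf : Function.Involutive f)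
    (hs : Set.MapsTo f s s) (hne : ∀ y ∈ s, f y ≠ y) : Even s.ncard := by
  rcases s.finite_or_infinite with hfin | hinf
  · have h := Finset.sum_involution (s := hfin.toFinset) (f := fun _ => (1 : ZMod 2))
      (fun a _ => f a) (fun _ _ => by decide) (fun a ha _ => hne a (hfin.mem_toFinset.1 ha))
      (fun a ha => hfin.mem_toFinset.2 (hs (hfin.mem_toFinset.1 ha))) fun a _ => hf a
    rw [Finset.sum_const, nsmul_one, ZMod.natCast_eq_zero_iff_even] at h
    rwa [Set.ncard_eq_toFinset_card s hfin]
  · rw [hinf.ncard]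
    exact Even.zero

namespace Search

section Barrier

variable {S : Search α} [Finite α] (h : S.IsValid B)
include h

theorem IsValid.odd_ncard_class {u : α} (hu : u ∈ S.even) :
    Odd {y ∈ S.even | S.path y = S.path u}.ncard := by
  have hmem : u ∈ {y ∈ S.even | S.path y = S.path u} := ⟨hu, rfl⟩
  rw [← Set.ncard_sdiff_singleton_add_one hmem]
  refine Even.add_one (even_ncard_of_involutive (h.isMate hu).involutive ?_ ?_)
  · rintro y ⟨hy, hyu⟩
    refine ⟨h.mate_mem_class hu hy, fun e => hyu ?_⟩
    rw [← h.mate_mate hu y, show S.mate u y = u from e, h.mate_self hu]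
    rfl
  · rintro y ⟨hy, hyu⟩ e
    obtain ⟨hf, hr⟩ := ((h.fixed_iff hu).1 e).resolve_left hyu
    exact hr (h.eq_root hy.1 hf)

omit [Finite α] in
theorem IsValid.injOn_path_mate : Set.InjOn (fun a => S.path (S.mate S.root a)) S.odd := by
  intro a ha b hb (e : S.path _ = S.path _)
  by_contra hne
  have hab : a ∈ S.path (S.pred b) := by
    have ha' := h.mem_path_mate ha
    rw [e, h.path_mate hb] at ha'
    exact ha'.resolve_left hne
  have hba : b ∈ S.path (S.pred a) := by
    have hb' := h.mem_path_mate hb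
    rw [← e, h.path_mate ha] at hb'
    exact hb'.resolve_left (Ne.symm hne)
  exact h.notMem_path_pred ha (h.path_pred_subset (h.pred_mem ha) hba hab)

variable (hstuck : ∀ {u w}, u ∈ S.even → B.Adj u w → w ∈ S.odd ∨ w ∈ S.even ∧ S.path w = S.path u)
  {f : α → α} (hf : IsMate B f) (hcov : ∀ y ∈ S.even, f y ≠ y)
include hstuck hf hcov

theorem IsValid.exists_mem_class_odd {u : α} (hu : u ∈ S.even) :
    ∃ y, S.path y = S.path u ∧ f y ∈ S.odd := by
  by_contra! hc
  refine Nat.not_even_iff_odd.2 (h.odd_ncard_class hu)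
    (even_ncard_of_involutive hf.involutive (fun y hy => ?_) fun y hy => hcov y hy.1)
  obtain ⟨he, hp⟩ := (hstuck hy.1 (hf.adj (hcov y hy.1))).resolve_left (hc y hy.2)
  exact ⟨he, hp.trans hy.2⟩

theorem IsValid.false_of_stuck : False := by
  have hle : (S.path '' S.even).ncard ≤ S.odd.ncard := by
    refine (Set.ncard_le_ncard (t := (fun a => S.path (f a)) '' S.odd) ?_).trans Set.ncard_image_le
    rintro _ ⟨u, hu, rfl⟩
    obtain ⟨y, hy, ho⟩ := h.exists_mem_class_odd hstuck hf hcov hu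
    exact ⟨f y, ho, by simp only [hf.involutive y, hy]⟩
  have hlt : S.odd.ncard + 1 ≤ (S.path '' S.even).ncard := by
    rw [← h.injOn_path_mate.ncard_image, ← Set.ncard_insert_of_notMem (a := S.path S.root)]
    · refine Set.ncard_le_ncard (Set.insert_subset ⟨_, h.root_mem, rfl⟩ ?_)
      rintro _ ⟨a, ha, rfl⟩
      exact ⟨_, ha.2, rfl⟩
    · rintro ⟨a, ha, e : S.path _ = _⟩
      exact notMem_path_root a (e ▸ h.mem_path_mate ha)
  omega

end Barrier

end Search

/-- A matching that covers all vertices that are not isolated. -/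
structure IsCoveringMate (B : SimpleGraph α) (f : α → α) : Prop extends IsMate B f where
  ne : ∀ {y z}, B.Adj y z → f y ≠ y

namespace Search

/-- An edge that allows the algorithm to go on: if no search is under way, that is, if there are no
even vertices, any edge of an uncovered vertex; otherwise an edge from an even vertex to a vertex
outside the tree or to an even vertex with another path. -/
def IsCandidate (B : SimpleGraph α) (S : Search α) (u v : α) : Prop :=
  B.Adj u v ∧ (S.even = ∅ ∧ S.mate S.root u = u ∨
    u ∈ S.even ∧ (v ∉ S.even ∧ v ∉ S.odd ∨ v ∈ S.even ∧ S.path u ≠ S.path v))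

/-- The end of a search, after the even vertex `u` is found to be adjacent to the uncovered vertex
`v`. -/
noncomputable def augment (S : Search α) (u v : α) : Search α where
  root := S.root
  even := ∅
  mate _ := link u v (S.mate u)

open Classical in
/-- The step of the algorithm that processes the edge `uv`. -/
noncomputable def advance (S : Search α) (u v : α) : Search α :=
  if S.even = ∅ then single u (S.mate S.root)
  else if v ∈ S.even then S.merge u v
  else if S.mate S.root v = v then S.augment u v
  else S.grow u v

/-- The invariant of the algorithm: a matching is given, and if a search is under way, then it is
valid and its root is not isolated. -/
structure IsSound (B : SimpleGraph α) (S : Search α) : Prop where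
  isMate : IsMate B (S.mate S.root)
  isValid : S.even.Nonempty → S.IsValid B
  exists_adj : S.even.Nonempty → ∃ z, B.Adj S.root z

/-- The number of vertices covered by the current matching, and then the number of even vertices,
combined into a number that increases with each step. -/
noncomputable def progress (S : Search α) : ℕ :=
  {y | S.mate S.root y ≠ y}.ncard * (Nat.card α + 1) + S.even.ncard

variable {S : Search α}

theorem IsValid.mate_root_grow (h : S.IsValid B) {v w : α} (hne : S.mate S.root w ≠ w) :
    (S.grow v w).mate S.root = S.mate S.root :=
  if_neg fun e => hne <| by
    have hw : w = S.root := by rw [← h.mate_mate h.root_mem w, ← e, h.mate_root_root]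
    rw [hw, h.mate_root_root]

theorem IsValid.isSound (h : S.IsValid B) (hr : ∃ z, B.Adj S.root z) : S.IsSound B :=
  ⟨h.isMate h.root_mem, fun _ => h, fun _ => hr⟩

theorem IsSound.advance (h : S.IsSound B) {u v : α} (hc : S.IsCandidate B u v) :
    (S.advance u v).IsSound B := by
  obtain ⟨huv, ⟨he, hf⟩ | ⟨hu, hv⟩⟩ := hc
  · rw [Search.advance, if_pos he]
    exact (isValid_single h.isMate hf).isSound ⟨v, huv⟩
  have hne : S.even.Nonempty := ⟨u, hu⟩
  have hS := h.isValid hne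
  rw [Search.advance, if_neg hne.ne_empty]
  split_ifs with hv' hvf
  · exact (hS.merge hu hv' huv).isSound (h.exists_adj hne)
  · exact ⟨hS.isMate_augment hu hv' hvf huv, fun h => absurd h Set.not_nonempty_empty,
      fun h => absurd h Set.not_nonempty_empty⟩
  · exact (hS.grow hv' (hv.resolve_right fun e => hv' e.1).2 hvf hu huv).isSound (h.exists_adj hne)

theorem IsValid.exists_adj (h : S.IsValid B) (hr : ∃ z, B.Adj S.root z) {y : α}
    (hy : y ∈ S.even) : ∃ z, B.Adj y z := by
  by_cases e : S.mate S.root y = y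
  · exact h.eq_root hy e ▸ hr
  · exact ⟨_, (h.isMate h.root_mem).adj e⟩

section Finite

variable [Finite α]

theorem progress_lt_of_even_ssubset {T : Search α} (hm : T.mate T.root = S.mate S.root)
    (he : S.even ⊂ T.even) : S.progress < T.progress := by
  rw [progress, progress, hm]
  exact Nat.add_lt_add_left (Set.ncard_lt_ncard he) _

theorem progress_lt_of_covered_ssubset {T : Search α}
    (h : {y | S.mate S.root y ≠ y} ⊂ {y | T.mate T.root y ≠ y}) : S.progress < T.progress := by
  have hlt := Set.ncard_lt_ncard h
  have hle := Set.ncard_le_card S.even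
  rw [progress, progress]
  nlinarith

theorem IsValid.progress_lt_augment (h : S.IsValid B) {u v : α} (hu : u ∈ S.even)
    (huv : B.Adj u v) (hvf : S.mate S.root v = v) :
    S.progress < (S.augment u v).progress := by
  refine progress_lt_of_covered_ssubset ((Set.ssubset_iff_of_subset fun y hy => ?_).2
    ⟨v, ?_, not_not.2 hvf⟩)
  · exact fun e => hy ((h.augment_eq_self_iff hu huv y).1 e).2.2
  · exact fun e => ((h.augment_eq_self_iff hu huv v).1 e).2.1 rfl

theorem IsSound.progress_lt_advance (h : S.IsSound B) {u v : α} (hc : S.IsCandidate B u v) :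
    S.progress < (S.advance u v).progress := by
  obtain ⟨huv, ⟨he, _⟩ | ⟨hu, hv⟩⟩ := hc
  · rw [Search.advance, if_pos he]
    refine progress_lt_of_even_ssubset rfl ?_
    rw [he]
    exact Set.empty_ssubset.2 (Set.singleton_nonempty u)
  have hne : S.even.Nonempty := ⟨u, hu⟩
  have hS := h.isValid hne
  rw [Search.advance, if_neg hne.ne_empty]
  split_ifs with hv' hvf
  · obtain ⟨x, hx⟩ : (symmDiff (S.path u) (S.path v)).Nonempty :=
      Set.nonempty_iff_ne_empty.2 fun e =>
        (hv.resolve_left fun hv => hv.1 hv').2 (symmDiff_eq_bot.1 e)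
    refine progress_lt_of_even_ssubset (mate_merge hS.root_mem)
      ((Set.ssubset_iff_of_subset Set.subset_union_left).2 ⟨x, Or.inr hx, ?_⟩)
    exact fun hx' => notMem_symmDiff_of_mem_even hx' hx
  · exact hS.progress_lt_augment hu huv hvf
  · exact progress_lt_of_even_ssubset (hS.mate_root_grow hvf)
      (Set.ssubset_insert (hS.mate_root_notMem hv' (hv.resolve_right fun e => hv' e.1).2).1)

theorem progress_le : S.progress ≤ Nat.card α * (Nat.card α + 1) + Nat.card α :=
  Nat.add_le_add (Nat.mul_le_mul_right _ (Set.ncard_le_card _)) (Set.ncard_le_card _)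

theorem IsSound.isCoveringMate (h : S.IsSound B) (hfinal : ∀ u v, ¬ S.IsCandidate B u v)
    {f : α → α} (hf : IsCoveringMate B f) : IsCoveringMate B (S.mate S.root) := by
  refine ⟨h.isMate, fun {y z} hyz => ?_⟩
  obtain he | he := S.even.eq_empty_or_nonempty
  · exact fun e => hfinal y z ⟨hyz, Or.inl ⟨he, e⟩⟩
  · have hS := h.isValid he
    refine (hS.false_of_stuck (fun {u w} hu huw => ?_) hf.toIsMate fun y hy => ?_).elim
    · have := hfinal u w
      simp only [IsCandidate, huw, hu, true_and, not_or, not_and, ne_eq, not_not] at this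
      tauto
    · obtain ⟨z, hyz⟩ := hS.exists_adj (h.exists_adj he) hy
      exact hf.ne hyz

end Finite

end Search

end FallColouring

/-! ### The matching algorithm as a program -/

namespace RAM

namespace ArrayTerm

/-- The negation of a condition. -/
def not (t : ArrayTerm) : ArrayTerm := .ite t (.lit 0) (.lit 1)

/-- The conjunction of two conditions. -/
def and (t u : ArrayTerm) : ArrayTerm := .ite t u (.lit 0)

/-- The disjunction of two conditions. -/
def or (t u : ArrayTerm) : ArrayTerm := .ite t (.lit 1) u

/-- The condition that exactly one of two conditions holds. -/
def xor (t u : ArrayTerm) : ArrayTerm := .ite t (not u) u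

/-- The condition that two terms have the same value. -/
def eq (t u : ArrayTerm) : ArrayTerm := not (.add (.sub t u) (.sub u t))

/-- The condition that the value of `t` is less than that of `u`. -/
def lt (t u : ArrayTerm) : ArrayTerm := .sub u t

/-- The condition that `t` holds for some value of the variable `x`. -/
def ex (x : ℕ) (t : ArrayTerm) : ArrayTerm := .sum x t

/-- The value of `u` when the variable `x` stands for the value of `t`. -/
def bind (x : ℕ) (t u : ArrayTerm) : ArrayTerm := .sum x (.ite (eq (.idx x) t) u (.lit 0))

variable {n : ℕ} {X : Arrays n} {e : ℕ → Fin n} {t u c : ArrayTerm} {x y : ℕ}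

/-- The condition `t` is satisfied. -/
def Holds (X : Arrays n) (e : ℕ → Fin n) (t : ArrayTerm) : Prop := t.eval X e ≠ 0

instance : Decidable (Holds X e t) := inferInstanceAs (Decidable (t.eval X e ≠ 0))

@[simp] theorem eval_lit {m : ℕ} : (lit m).eval X e = m := rfl

@[simp] theorem eval_idx : (idx x).eval X e = e x := rfl

@[simp] theorem eval_get {a : ℕ} : (get a x y).eval X e = X a (e x) (e y) := rfl

@[simp] theorem eval_ite :
    (ite c t u).eval X e = if Holds X e c then t.eval X e else u.eval X e := rfl

@[simp] theorem holds_get {a : ℕ} : Holds X e (get a x y) ↔ X a (e x) (e y) ≠ 0 := Iff.rfl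

@[simp] theorem holds_not : Holds X e (not t) ↔ ¬ Holds X e t := by
  by_cases h : t.eval X e = 0 <;> simp [Holds, not, eval, h]

@[simp] theorem holds_and : Holds X e (and t u) ↔ Holds X e t ∧ Holds X e u := by
  by_cases h : t.eval X e = 0 <;> simp [Holds, and, eval, h]

@[simp] theorem holds_or : Holds X e (or t u) ↔ Holds X e t ∨ Holds X e u := by
  by_cases h : t.eval X e = 0 <;> simp [Holds, or, eval, h]

@[simp] theorem holds_xor : Holds X e (xor t u) ↔ ¬ (Holds X e t ↔ Holds X e u) := by
  by_cases ht : t.eval X e = 0 <;> by_cases hu : u.eval X e = 0 <;>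
    simp [Holds, xor, not, eval, ht, hu]

@[simp] theorem holds_eq : Holds X e (eq t u) ↔ t.eval X e = u.eval X e := by
  rw [eq, holds_not]
  simp only [Holds, eval]
  omega

@[simp] theorem holds_lt : Holds X e (lt t u) ↔ t.eval X e < u.eval X e := by
  simp only [Holds, lt, eval]
  omega

@[simp] theorem holds_ex : Holds X e (ex x t) ↔ ∃ i, Holds X (Function.update e x i) t := by
  simp [Holds, ex, eval]

theorem eval_sum_ite (i : Fin n) (hc : ∀ j, Holds X (Function.update e x j) c ↔ j = i) :
    (sum x (ite c t (.lit 0))).eval X e = t.eval X (Function.update e x i) := by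
  simp [eval, ← Holds.eq_def, hc]

theorem eval_bind (i : Fin n) (ht : ∀ j, t.eval X (Function.update e x j) = i) :
    (bind x t u).eval X e = u.eval X (Function.update e x i) :=
  eval_sum_ite i fun j => by rw [holds_eq, ht, eval_idx, Function.update_self, Fin.val_inj]

theorem holds_bind (i : Fin n) (ht : ∀ j, t.eval X (Function.update e x j) = i) :
    Holds X e (bind x t u) ↔ Holds X (Function.update e x i) u := by
  rw [Holds, eval_bind i ht, Holds]

/-- The condition that `φ 0 1` holds for the variables `0` and `1`, but `φ 2 3` does not hold for
any lexicographically smaller pair. -/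
def first (φ : ℕ → ℕ → ArrayTerm) : ArrayTerm :=
  .and (φ 0 1) (.not (.ex 2 (.ex 3 (.and (φ 2 3) (.or (.lt (.idx 2) (.idx 0))
    (.and (.eq (.idx 2) (.idx 0)) (.lt (.idx 3) (.idx 1))))))))

theorem exists_holds_first {φ : ℕ → ℕ → ArrayTerm} {p : Fin n → Fin n → Prop}
    (hφ : ∀ x y e, x < 4 → y < 4 → (Holds X e (φ x y) ↔ p (e x) (e y))) (hp : ∃ i j, p i j) :
    ∃ i j, p i j ∧ ∀ i' j', Holds X (pairEnv i' j') (first φ) ↔ i' = i ∧ j' = j := by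
  obtain ⟨i₀, j₀, h₀⟩ := hp
  obtain ⟨q, hq, hmin⟩ := WellFounded.has_min
    (wellFounded_lt (α := Fin n ×ₗ Fin n)) {q | p (ofLex q).1 (ofLex q).2} ⟨toLex (i₀, j₀), h₀⟩
  refine ⟨(ofLex q).1, (ofLex q).2, hq, fun i j => ?_⟩
  have hlex : Holds X (pairEnv i j) (first φ) ↔
      p i j ∧ ∀ r : Fin n ×ₗ Fin n, p (ofLex r).1 (ofLex r).2 → ¬ r < toLex (i, j) := by
    simp [first, hφ, pairEnv, Prod.Lex.lt_iff, Lex.forall, Fin.ext_iff]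
  rw [hlex]
  constructor
  · rintro ⟨hij, h⟩
    have e : toLex (i, j) = q := le_antisymm (not_lt.1 (h q hq)) (not_lt.1 (hmin _ hij))
    exact ⟨congrArg (fun r => (ofLex r).1) e, congrArg (fun r => (ofLex r).2) e⟩
  · rintro ⟨rfl, rfl⟩
    exact ⟨hq, hmin⟩

end ArrayTerm

end RAM

namespace FallColouring

open RAM RAM.ArrayTerm

variable {n : ℕ} {B : SimpleGraph (Fin n)} {S : Search (Fin n)} {X : Arrays n}

/-- The arrays hold the graph `B` (array `1`) and the components of the search `S` (arrays `2` to
`4`). The root is stored in all entries of an array, and a set of vertices as an array that does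
not depend on the second index. -/
structure Encodes (B : SimpleGraph (Fin n)) (S : Search (Fin n)) (X : Arrays n) : Prop where
  graph : ∀ i j, X 1 i j ≠ 0 ↔ B.Adj i j
  root : ∀ i j, X 2 i j = S.root
  even : ∀ i j, X 3 i j ≠ 0 ↔ i ∈ S.even
  mate : ∀ i j, X 4 i j = S.mate i j

theorem Encodes.congr {Y : Arrays n} (h : Encodes B S X) (hY : ∀ a < 5, Y a = X a) :
    Encodes B S Y where
  graph := by simpa only [hY 1 (by omega)] using h.graph
  root := by simpa only [hY 2 (by omega)] using h.root
  even := by simpa only [hY 3 (by omega)] using h.even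
  mate := by simpa only [hY 4 (by omega)] using h.mate

section Terms

variable (h : Encodes B S X) {x y u v : ℕ} {e : ℕ → Fin n}

/-- The partner of `x` in the current matching. This and the following terms use the variables `7`,
`8` and `9` internally. -/
def mateTerm (x : ℕ) : ArrayTerm := .bind 9 (.get 2 x x) (.get 4 9 x)

include h in
theorem Encodes.eval_mateTerm (hx : x < 9) :
    (mateTerm x).eval X e = S.mate S.root (e x) := by
  rw [mateTerm, eval_bind S.root fun j => by rw [eval_get, h.root], eval_get, h.mate,
    Function.update_self, Function.update_of_ne hx.ne]

/-- The condition that `x` is an odd vertex. -/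
def oddTerm (x : ℕ) : ArrayTerm := .and (.not (.get 3 x x)) (.bind 8 (mateTerm x) (.get 3 8 8))

include h in
theorem Encodes.holds_oddTerm (hx : x < 8) : Holds X e (oddTerm x) ↔ e x ∈ S.odd := by
  have hmate : ∀ j, (mateTerm x).eval X (Function.update e 8 j) = S.mate S.root (e x) := fun j => by
    rw [h.eval_mateTerm (by omega), Function.update_of_ne hx.ne]
  simp only [oddTerm, holds_and, holds_not, holds_get, holds_bind _ hmate, h.even,
    Function.update_self]
  rfl

/-- The condition that `x` is on the path to `u`. -/
def pathTerm (u x : ℕ) : ArrayTerm := .and (oddTerm x) (.not (.eq (.get 4 u x) (mateTerm x)))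

include h in
theorem Encodes.holds_pathTerm (hx : x < 8) : Holds X e (pathTerm u x) ↔ e x ∈ S.path (e u) := by
  simp only [pathTerm, holds_and, holds_not, holds_eq, eval_get, h.holds_oddTerm hx, h.mate,
    h.eval_mateTerm (x := x) (by omega), Fin.val_inj]
  rfl

/-- The predecessor of the odd vertex `x`. -/
def predTerm (x : ℕ) : ArrayTerm := .bind 8 (mateTerm x) (.get 4 8 x)

include h in
theorem Encodes.eval_predTerm (hx : x < 8) : (predTerm x).eval X e = S.pred (e x) := by
  have hmate : ∀ j, (mateTerm x).eval X (Function.update e 8 j) = S.mate S.root (e x) := fun j => by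
    rw [h.eval_mateTerm (by omega), Function.update_of_ne hx.ne]
  rw [predTerm, eval_bind _ hmate, eval_get, h.mate, Function.update_self,
    Function.update_of_ne hx.ne, Search.pred]

/-- The condition that `y` is below the odd vertex `x`. -/
def belowTerm (x y : ℕ) : ArrayTerm :=
  .or (.and (.get 3 y y) (pathTerm y x)) (.and (oddTerm y) (.bind 7 (predTerm y) (pathTerm 7 x)))

include h in
theorem Encodes.holds_belowTerm (hx : x < 7) (hy : y < 7) :
    Holds X e (belowTerm x y) ↔ e y ∈ S.below (e x) := by
  have hpred : ∀ j, (predTerm y).eval X (Function.update e 7 j) = S.pred (e y) := fun j => by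
    rw [h.eval_predTerm (by omega), Function.update_of_ne hy.ne]
  simp only [belowTerm, holds_or, holds_and, holds_get, holds_bind _ hpred, h.even,
    h.holds_oddTerm (x := y) (by omega), h.holds_pathTerm (x := x) (by omega),
    Function.update_self, Function.update_of_ne hx.ne]
  rfl

/-- The partner of `y` after `u` and `v` have been matched, if it was `t` before. -/
def linkTerm (u v y : ℕ) (t : ArrayTerm) : ArrayTerm :=
  .ite (.eq (.idx y) (.idx u)) (.idx v) (.ite (.eq (.idx y) (.idx v)) (.idx u) t)

theorem eval_linkTerm {t : ArrayTerm} {f : Fin n → Fin n} (ht : t.eval X e = f (e y)) :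
    (linkTerm u v y t).eval X e = link (e u) (e v) f (e y) := by
  simp only [linkTerm, eval_ite, holds_eq, eval_idx, Fin.val_inj, ht, link]
  split_ifs <;> rfl

/-- The partner of `y`, if it is `t` under the condition `c` and `u` otherwise, except that `x` is
uncovered. -/
def glueTerm (c : ArrayTerm) (x y : ℕ) (t u : ArrayTerm) : ArrayTerm :=
  .ite c t (.ite (.eq (.idx y) (.idx x)) (.idx x) u)

theorem eval_glueTerm {c t u : ArrayTerm} {s : Set (Fin n)} {f g : Fin n → Fin n}
    (hc : Holds X e c ↔ e y ∈ s) (ht : t.eval X e = f (e y)) (hu : u.eval X e = g (e y)) :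
    (glueTerm c x y t u).eval X e = glue s (e x) f g (e y) := by
  simp only [glueTerm, eval_ite, holds_eq, eval_idx, Fin.val_inj, ht, hu, glue, ← hc]
  split_ifs <;> rfl

/-- The partner of `y` in the matching `Search.cycle`. -/
def cycleTerm (u v x y : ℕ) : ArrayTerm :=
  linkTerm u v y (glueTerm (belowTerm x y) x y (.get 4 u y) (.get 4 v y))

include h in
theorem Encodes.eval_cycleTerm (hx : x < 7) (hy : y < 7) :
    (cycleTerm u v x y).eval X e = S.cycle (e u) (e v) (e x) (e y) :=
  eval_linkTerm (eval_glueTerm (h.holds_belowTerm hx hy) (h.mate _ _) (h.mate _ _))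

/-- The condition `Search.IsCandidate` for the edge `uv`. -/
def candidateTerm (u v : ℕ) : ArrayTerm :=
  .and (.get 1 u v) (.or
    (.and (.not (.ex 6 (.get 3 6 6))) (.eq (mateTerm u) (.idx u)))
    (.and (.get 3 u u) (.or (.and (.not (.get 3 v v)) (.not (oddTerm v)))
      (.and (.get 3 v v) (.ex 6 (.xor (pathTerm u 6) (pathTerm v 6)))))))

include h in
theorem Encodes.holds_not_ex_even : Holds X e (.not (.ex x (.get 3 x x))) ↔ S.even = ∅ := by
  simp only [holds_not, holds_ex, holds_get, Function.update_self, h.even, not_exists,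
    Set.eq_empty_iff_forall_notMem]

include h in
theorem Encodes.holds_candidateTerm (hu : u < 6) (hv : v < 6) :
    Holds X e (candidateTerm u v) ↔ S.IsCandidate B (e u) (e v) := by
  have hpath : Holds X e (.ex 6 (.xor (pathTerm u 6) (pathTerm v 6))) ↔
      S.path (e u) ≠ S.path (e v) := by
    simp only [holds_ex, holds_xor, h.holds_pathTerm (x := 6) (by omega), Function.update_self,
      Function.update_of_ne hu.ne, Function.update_of_ne hv.ne, ne_eq, Set.ext_iff, not_forall]
  simp only [candidateTerm, holds_and, holds_or, holds_not (t := .get 3 v v),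
    holds_not (t := oddTerm v), holds_get, holds_eq, hpath, h.holds_not_ex_even, h.graph, h.even,
    h.eval_mateTerm (x := u) (by omega), h.holds_oddTerm (x := v) (by omega), eval_idx,
    Fin.val_inj, Search.IsCandidate]

end Terms

/-- Mark the edge to be processed in array `5`. -/
def chooseProg : ArrayProg := .set 5 (first candidateTerm)

/-- The value of `t` when the variables `2` and `3` stand for the ends of the chosen edge, and the
value of `d` if there is none. -/
def chosenTerm (d t : ArrayTerm) : ArrayTerm :=
  .ite (.ex 2 (.ex 3 (.get 5 2 3))) (.sum 2 (.ite (.ex 3 (.get 5 2 3))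
    (.sum 3 (.ite (.get 5 2 3) t (.lit 0))) (.lit 0))) d

section Update

/-- The edge `uv` has been chosen. -/
def IsChosen (u v : Fin n) (X : Arrays n) : Prop := ∀ i j, X 5 i j ≠ 0 ↔ i = u ∧ j = v

variable {d t : ArrayTerm} {e : ℕ → Fin n} {u v : Fin n}

theorem IsChosen.eval_chosenTerm (hX : IsChosen u v X) :
    (chosenTerm d t).eval X e = t.eval X (Function.update (Function.update e 2 u) 3 v) := by
  have hchosen : Holds X e (.ex 2 (.ex 3 (.get 5 2 3))) := by
    simp [hX _ _]
  have hrow : ∀ i, Holds X (Function.update e 2 i) (.ex 3 (.get 5 2 3)) ↔ i = u := fun i => by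
    simp [hX _ _]
  rw [chosenTerm, eval_ite, if_pos hchosen, eval_sum_ite u hrow, eval_sum_ite v fun j => ?_]
  simp [hX _ _]

theorem eval_chosenTerm_of_eq_zero (hX : ∀ i j, X 5 i j = 0) :
    (chosenTerm d t).eval X e = d.eval X e := by
  rw [chosenTerm, eval_ite, if_neg]
  simp [hX]

theorem Encodes.exists_isChosen (h : Encodes B S X) (hc : ∃ u v, S.IsCandidate B u v) :
    ∃ u v, S.IsCandidate B u v ∧ IsChosen u v (chooseProg.eval X) := by
  obtain ⟨u, v, huv, hfirst⟩ := exists_holds_first (X := X) (φ := candidateTerm)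
    (fun x y e hx hy => h.holds_candidateTerm (by omega) (by omega)) hc
  refine ⟨u, v, huv, fun i j => ?_⟩
  rw [chooseProg, ArrayProg.eval, Function.update_self]
  exact hfirst i j

theorem Encodes.chooseProg_eq_zero (h : Encodes B S X) (hc : ∀ u v, ¬ S.IsCandidate B u v)
    (i j : Fin n) : chooseProg.eval X 5 i j = 0 := by
  have hnot : ¬ Holds X (pairEnv i j) (candidateTerm 0 1) := by
    rw [h.holds_candidateTerm (by omega) (by omega)]
    exact hc _ _
  rw [chooseProg, ArrayProg.eval, Function.update_self]
  exact if_neg hnot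

/-- Distinguish the cases of `Search.advance` for the chosen edge. -/
def caseTerm (start merge augment grow : ArrayTerm) : ArrayTerm :=
  .ite (.not (.ex 4 (.get 3 4 4))) start
    (.ite (.get 3 3 3) merge (.ite (.eq (mateTerm 3) (.idx 3)) augment grow))

/-- The new root. -/
def rootTerm : ArrayTerm :=
  caseTerm (.idx 2) (.get 2 0 0) (.get 2 0 0) (.get 2 0 0)

/-- The new set of even vertices. -/
def evenTerm : ArrayTerm :=
  caseTerm (.eq (.idx 0) (.idx 2)) (.or (.get 3 0 0) (.xor (pathTerm 2 0) (pathTerm 3 0)))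
    (.lit 0) (.or (.eq (.idx 0) (mateTerm 3)) (.get 3 0 0))

/-- The new matchings in the case of `Search.merge`. -/
def mergeTerm : ArrayTerm :=
  .ite (.and (pathTerm 2 0) (.not (pathTerm 3 0))) (cycleTerm 2 3 0 1)
    (.ite (.and (pathTerm 3 0) (.not (pathTerm 2 0))) (cycleTerm 3 2 0 1) (.get 4 0 1))

/-- The new matchings in the case of `Search.grow`. -/
def growTerm : ArrayTerm :=
  .bind 4 (mateTerm 3) (.ite (.eq (.idx 0) (.idx 4))
    (linkTerm 3 2 1 (glueTerm (.eq (.idx 1) (.idx 3)) 4 1 (.idx 1) (.get 4 2 1))) (.get 4 0 1))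

/-- The new matchings. -/
def matchingTerm : ArrayTerm :=
  caseTerm (mateTerm 1) mergeTerm (linkTerm 2 3 1 (.get 4 2 1)) growTerm

variable (h : Encodes B S X)
include h

open Classical in
theorem Encodes.eval_caseTerm {t₁ t₂ t₃ t₄ : ArrayTerm} : (caseTerm t₁ t₂ t₃ t₄).eval X e =
    if S.even = ∅ then t₁.eval X e else if e 3 ∈ S.even then t₂.eval X e
    else if S.mate S.root (e 3) = e 3 then t₃.eval X e else t₄.eval X e := by
  simp only [caseTerm, eval_ite, h.holds_not_ex_even, holds_get, h.even, holds_eq,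
    h.eval_mateTerm (x := 3) (by omega), eval_idx, Fin.val_inj]

theorem Encodes.eval_rootTerm : rootTerm.eval X e = (S.advance (e 2) (e 3)).root := by
  rw [rootTerm, h.eval_caseTerm, Search.advance]
  simp only [eval_idx, eval_get, h.root]
  split_ifs <;> rfl

theorem Encodes.holds_evenTerm :
    Holds X e evenTerm ↔ e 0 ∈ (S.advance (e 2) (e 3)).even := by
  rw [Holds, evenTerm, h.eval_caseTerm, Search.advance]
  split_ifs
  · exact holds_eq.trans Fin.val_inj
  · rw [← Holds.eq_def, Search.mem_even_merge, Set.mem_symmDiff, holds_or, holds_xor, holds_get,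
      h.even, h.holds_pathTerm (by omega), h.holds_pathTerm (by omega)]
    tauto
  · simp [Search.augment]
  · rw [← Holds.eq_def, Search.mem_even_grow, holds_or, holds_eq, holds_get, h.even,
      h.eval_mateTerm (by omega), eval_idx, Fin.val_inj]

open Classical in
theorem Encodes.eval_mergeTerm :
    mergeTerm.eval X e = (S.merge (e 2) (e 3)).mate (e 0) (e 1) := by
  simp only [mergeTerm, eval_ite, holds_and, holds_not, h.holds_pathTerm (x := 0) (by omega),
    h.eval_cycleTerm (x := 0) (y := 1) (by omega) (by omega), eval_get, h.mate, Search.merge,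
    Set.mem_sdiff]
  split_ifs <;> rfl

open Classical in
theorem Encodes.eval_growTerm :
    growTerm.eval X e = (S.grow (e 2) (e 3)).mate (e 0) (e 1) := by
  set w := S.mate S.root (e 3) with hw
  have hupdate : ∀ k, k < 4 → Function.update e 4 w k = e k := fun k hk =>
    Function.update_of_ne hk.ne _ _
  have hglue : ∀ e : ℕ → Fin n, (glueTerm (.eq (.idx 1) (.idx 3)) 4 1 (.idx 1)
      (.get 4 2 1)).eval X e = glue {e 3} (e 4) id (S.mate (e 2)) (e 1) := fun e =>
    eval_glueTerm (holds_eq.trans Fin.val_inj) rfl (h.mate _ _)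
  rw [growTerm, eval_bind w fun j => h.eval_mateTerm (by omega)]
  simp only [eval_ite, holds_eq, eval_idx, Fin.val_inj, eval_get, h.mate, eval_linkTerm (hglue _),
    hupdate, Nat.reduceLT, Function.update_self, Search.grow, ← hw]
  split_ifs <;> rfl

theorem Encodes.eval_matchingTerm :
    matchingTerm.eval X e = (S.advance (e 2) (e 3)).mate (e 0) (e 1) := by
  rw [matchingTerm, h.eval_caseTerm, Search.advance]
  split_ifs
  · exact h.eval_mateTerm (by omega)
  · exact h.eval_mergeTerm
  · exact eval_linkTerm (h.mate _ _)
  · exact h.eval_growTerm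

end Update

section Step

/-- Replace the root, the even vertices and the matchings simultaneously by the values of three
terms. -/
def assignProg (r s t : ArrayTerm) : ArrayProg :=
  .seq (.set 6 r) (.seq (.set 7 s) (.seq (.set 8 t)
    (.seq (.set 2 (.get 6 0 1)) (.seq (.set 3 (.get 7 0 1)) (.set 4 (.get 8 0 1))))))

theorem encodes_assignProg {T : Search (Fin n)} {r s t : ArrayTerm}
    (hX : ∀ i j, X 1 i j ≠ 0 ↔ B.Adj i j)
    (hr : ∀ Y : Arrays n, (∀ a < 6, Y a = X a) → ∀ i j, r.eval Y (pairEnv i j) = T.root)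
    (hs : ∀ Y : Arrays n, (∀ a < 6, Y a = X a) → ∀ i j, Holds Y (pairEnv i j) s ↔ i ∈ T.even)
    (ht : ∀ Y : Arrays n, (∀ a < 6, Y a = X a) → ∀ i j, t.eval Y (pairEnv i j) = T.mate i j) :
    Encodes B T ((assignProg r s t).eval X) where
  graph := hX
  root := hr _ fun _ _ => rfl
  even := hs _ fun a ha => Function.update_of_ne (by omega) _ _
  mate := ht _ fun a ha => (Function.update_of_ne (by omega) _ _).trans
    (Function.update_of_ne (by omega) _ _)

/-- One step of the algorithm: process the first possible edge. -/
def stepProg : ArrayProg :=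
  .seq chooseProg (assignProg (chosenTerm (.get 2 0 0) rootTerm) (chosenTerm (.get 3 0 0) evenTerm)
    (chosenTerm (.get 4 0 1) matchingTerm))

theorem Encodes.stepProg (h : Encodes B S X) :
    (∃ u v, S.IsCandidate B u v ∧ Encodes B (S.advance u v) (stepProg.eval X)) ∨
      (∀ u v, ¬ S.IsCandidate B u v) ∧ Encodes B S (stepProg.eval X) := by
  have hY : ∀ {Y : Arrays n}, (∀ a < 6, Y a = chooseProg.eval X a) → Encodes B S Y := fun hY =>
    h.congr fun a ha => (hY a (by omega)).trans (Function.update_of_ne (by omega) _ _)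
  by_cases hc : ∃ u v, S.IsCandidate B u v
  · obtain ⟨u, v, huv, hX⟩ := h.exists_isChosen hc
    have hY' : ∀ {Y : Arrays n}, (∀ a < 6, Y a = chooseProg.eval X a) → IsChosen u v Y :=
      fun hY => by simpa only [IsChosen, hY 5 (by omega)] using hX
    refine Or.inl ⟨u, v, huv, encodes_assignProg h.graph (fun Y e i j => ?_) (fun Y e i j => ?_)
      fun Y e i j => ?_⟩
    · rw [(hY' e).eval_chosenTerm, (hY e).eval_rootTerm]
      rfl
    · rw [Holds, (hY' e).eval_chosenTerm, ← Holds.eq_def, (hY e).holds_evenTerm]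
      rfl
    · rw [(hY' e).eval_chosenTerm, (hY e).eval_matchingTerm]
      rfl
  · push Not at hc
    have hY' : ∀ {Y : Arrays n}, (∀ a < 6, Y a = chooseProg.eval X a) → ∀ i j, Y 5 i j = 0 :=
      fun hY => by simpa only [hY 5 (by omega)] using h.chooseProg_eq_zero hc
    refine Or.inr ⟨hc, encodes_assignProg h.graph (fun Y e i j => ?_) (fun Y e i j => ?_)
      fun Y e i j => ?_⟩
    · rw [eval_chosenTerm_of_eq_zero (hY' e)]
      exact (hY e).root _ _
    · rw [Holds, eval_chosenTerm_of_eq_zero (hY' e)]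
      exact (hY e).even _ _
    · rw [eval_chosenTerm_of_eq_zero (hY' e)]
      exact (hY e).mate _ _

/-- The search is sound, and either the algorithm has terminated or at least `k` steps have been
performed. -/
def HasReached (B : SimpleGraph (Fin n)) (S : Search (Fin n)) (k : ℕ) : Prop :=
  S.IsSound B ∧ ((∀ u v, ¬ S.IsCandidate B u v) ∨ k ≤ S.progress)

theorem exists_hasReached_iterate (h : Encodes B S X) (hS : S.IsSound B) (k : ℕ) :
    ∃ T : Search (Fin n), Encodes B T (stepProg.eval^[k] X) ∧ HasReached B T k := by
  induction k with
  | zero => exact ⟨S, h, hS, Or.inr (Nat.zero_le _)⟩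
  | succ k ih =>
    obtain ⟨T, hT, hsound, hfinal⟩ := ih
    rw [Function.iterate_succ_apply']
    obtain ⟨u, v, huv, hstep⟩ | ⟨hnone, hstep⟩ := hT.stepProg
    · exact ⟨_, hstep, hsound.advance huv, Or.inr <| Nat.succ_le_of_lt <|
        (hfinal.resolve_left fun h => h u v huv).trans_lt (hsound.progress_lt_advance huv)⟩
    · exact ⟨T, hstep, hsound, Or.inl hnone⟩

/-- Compute in array `9` a matching of the graph in array `1`. -/
def matchProg : ArrayProg :=
  .seq (.seq (.set 2 (.lit 0)) (.seq (.set 3 (.lit 0)) (.set 4 (.idx 1))))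
    (.seq (.iter (.iter (.seq stepProg (.seq stepProg stepProg)))) (.set 9 (mateTerm 0)))

theorem eval_iter_iter_stepProg :
    (ArrayProg.iter (.iter (.seq stepProg (.seq stepProg stepProg)))).eval X =
      stepProg.eval^[3 * n * n] X := by
  rw [Function.iterate_mul, Function.iterate_mul]
  rfl

theorem eval_matchProg_of_lt {a : ℕ} (ha : 9 < a) : matchProg.eval X a = X a := by
  have hset : ∀ {b t} {Y : Arrays n}, b ≤ 9 → (ArrayProg.set b t).eval Y a = Y a := fun hb =>
    Function.update_of_ne (by omega) _ _
  have hstep : ∀ Y : Arrays n, stepProg.eval Y a = Y a := fun Y => by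
    simp only [stepProg, chooseProg, assignProg, ArrayProg.eval.eq_2, hset, Nat.reduceLeDiff]
  have hiter : ∀ (k : ℕ) (Y : Arrays n), stepProg.eval^[k] Y a = Y a := fun k => by
    induction k with
    | zero => exact fun _ => rfl
    | succ k ih => exact fun Y => (ih _).trans (hstep Y)
  simp only [matchProg, ArrayProg.eval.eq_2, eval_iter_iter_stepProg, hiter, hset, Nat.reduceLeDiff,
    le_refl]

theorem HasReached.not_isCandidate (h : HasReached B S (3 * n * n)) (u v : Fin n) :
    ¬ S.IsCandidate B u v := fun huv => by
  have hlt := h.1.progress_lt_advance huv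
  have hle := (S.advance u v).progress_le
  have hk := h.2.resolve_left fun hfinal => hfinal u v huv
  rw [Nat.card_fin] at hle
  have hn : 0 < n := u.pos
  nlinarith

theorem exists_isMate_matchProg (hB : ∀ i j, X 1 i j ≠ 0 ↔ B.Adj i j) :
    ∃ f, IsMate B f ∧ (∀ i j, matchProg.eval X 9 i j = f i) ∧
      ((∃ g, IsCoveringMate B g) → IsCoveringMate B f) := by
  obtain hn | ⟨⟨r⟩⟩ := isEmpty_or_nonempty (Fin n)
  · exact ⟨id, ⟨hn.elim, fun {y} => hn.elim y⟩, hn.elim, fun ⟨g, hg⟩ =>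
      Subsingleton.elim g id ▸ hg⟩
  have : NeZero n := ⟨r.pos.ne'⟩
  let S : Search (Fin n) := ⟨0, ∅, fun _ => id⟩
  have hS : S.IsSound B := ⟨⟨fun _ => rfl, fun h => absurd rfl h⟩,
    fun h => absurd h Set.not_nonempty_empty, fun h => absurd h Set.not_nonempty_empty⟩
  have hX : Encodes B S ((ArrayProg.seq (.set 2 (.lit 0))
      (.seq (.set 3 (.lit 0)) (.set 4 (.idx 1)))).eval X) :=
    ⟨hB, fun _ _ => rfl, fun _ _ => iff_of_false (fun h => h rfl) (Set.notMem_empty _),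
      fun _ _ => rfl⟩
  obtain ⟨T, hT, hreached⟩ := exists_hasReached_iterate hX hS (3 * n * n)
  refine ⟨T.mate T.root, hreached.1.isMate, fun i j => ?_, fun ⟨g, hg⟩ =>
    hreached.1.isCoveringMate hreached.not_isCandidate hg⟩
  rw [← eval_iter_iter_stepProg] at hT
  exact hT.eval_mateTerm (by omega)

end Step

end FallColouring

/-! ### Fall colourings and co-components -/

namespace FallColouring

variable {V α : Type*} {G : SimpleGraph V}

theorem card_mem_fallSpectrum [Finite α] (c : V → α) (hadj : ∀ v w, G.Adj v w → c v ≠ c w)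
    (hsurj : Function.Surjective c) (hfall : ∀ v j, j ≠ c v → ∃ w, G.Adj v w ∧ c w = j) :
    Nat.card α ∈ fallSpectrum G := by
  let e := Finite.equivFin α
  refine ⟨Coloring.mk (fun v => e (c v)) fun {v w} h he => hadj v w h (e.injective he),
    e.surjective.comp hsurj, fun v j hj => ?_⟩
  obtain ⟨w, hw, hwj⟩ := hfall v (e.symm j) fun h => hj (e.symm_apply_eq.1 h)
  exact ⟨w, hw, (congrArg e hwj).trans (e.apply_symm_apply j)⟩

theorem compl_adj_of_color_eq (c : G.Coloring α) {v w : V} (h : c v = c w) (hne : v ≠ w) :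
    Gᶜ.Adj v w :=
  (compl_adj _ _ _).2 ⟨hne, fun hadj => c.valid hadj h⟩

theorem adj_of_compl_component_ne {v w : V}
    (h : Gᶜ.connectedComponentMk v ≠ Gᶜ.connectedComponentMk w) : G.Adj v w := by
  by_contra hn
  exact h (ConnectedComponent.sound
    (Adj.reachable ((compl_adj _ _ _).2 ⟨fun e => h (congrArg _ e), hn⟩)))

theorem compl_component_eq_of_color_eq (c : G.Coloring α) {v w : V} (h : c v = c w) :
    Gᶜ.connectedComponentMk v = Gᶜ.connectedComponentMk w :=
  by_contra fun hne => c.valid (adj_of_compl_component_ne hne) h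

theorem IsFallColouring.card_image_supp_mem {k : ℕ} {c : G.Coloring (Fin k)}
    (hc : IsFallColouring c) (C : Gᶜ.ConnectedComponent) :
    Nat.card (c '' C.supp) ∈ fallSpectrum (coComponent G C) := by
  refine card_mem_fallSpectrum (fun v => ⟨c v, v, v.2, rfl⟩)
    (fun v w h he => c.valid h (Subtype.ext_iff.1 he)) ?_ ?_
  · rintro ⟨_, v, hv, rfl⟩
    exact ⟨⟨v, hv⟩, rfl⟩
  · rintro v ⟨_, w, hw, rfl⟩ hne
    obtain ⟨x, hx, hxc⟩ := hc.2 v (c w) fun h => hne (Subtype.ext h)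
    exact ⟨⟨x, (compl_component_eq_of_color_eq c hxc).trans hw⟩, hx, Subtype.ext hxc⟩

theorem finsum_card_image_supp [Finite V] {k : ℕ} {c : G.Coloring (Fin k)}
    (hsurj : Function.Surjective c) :
    ∑ᶠ C : Gᶜ.ConnectedComponent, Nat.card (c '' C.supp) = k := by
  have := Fintype.ofFinite Gᶜ.ConnectedComponent
  rw [finsum_eq_sum_of_fintype, ← Nat.card_sigma]
  refine (Nat.card_eq_of_bijective
    (fun x : Σ C : Gᶜ.ConnectedComponent, c '' C.supp => (x.2 : Fin k)) ⟨?_, fun j => ?_⟩).trans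
      (Nat.card_fin k)
  · rintro ⟨C, _, v, rfl, rfl⟩ ⟨D, _, w, rfl, rfl⟩ h
    replace h : c v = c w := h
    exact Sigma.subtype_ext (compl_component_eq_of_color_eq c h) h
  · obtain ⟨v, rfl⟩ := hsurj j
    exact ⟨⟨Gᶜ.connectedComponentMk v, c v, v, rfl, rfl⟩, rfl⟩

theorem finsum_mem_fallSpectrum [Finite V] {κ : Gᶜ.ConnectedComponent → ℕ}
    (hκ : ∀ C, κ C ∈ fallSpectrum (coComponent G C)) : ∑ᶠ C, κ C ∈ fallSpectrum G := by
  have := Fintype.ofFinite Gᶜ.ConnectedComponent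
  choose c hc using hκ
  have hcard : ∑ᶠ C, κ C = Nat.card (Σ C, Fin (κ C)) := by
    simp only [finsum_eq_sum_of_fintype, Nat.card_sigma, Nat.card_fin]
  let d : V → Σ C, Fin (κ C) := fun v => ⟨Gᶜ.connectedComponentMk v, c _ ⟨v, rfl⟩⟩
  have hd : ∀ (C : Gᶜ.ConnectedComponent) (v : C.supp), d v = ⟨C, c C v⟩ := by
    rintro _ ⟨v, rfl⟩
    rfl
  rw [hcard]
  refine card_mem_fallSpectrum d ?_ ?_ ?_
  · intro v w hadj he
    have hw : Gᶜ.connectedComponentMk w = Gᶜ.connectedComponentMk v := (congrArg Sigma.fst he).symm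
    rw [hd _ ⟨v, rfl⟩, hd (Gᶜ.connectedComponentMk v) ⟨w, hw⟩] at he
    exact (c _).valid (v := ⟨v, rfl⟩) (w := ⟨w, hw⟩) hadj
      (sigma_mk_injective (β := fun C => Fin (κ C)) he)
  · rintro ⟨C, j⟩
    obtain ⟨v, rfl⟩ := (hc C).1 j
    exact ⟨v, hd C v⟩
  · rintro v ⟨C, j⟩ hne
    by_cases hC : Gᶜ.connectedComponentMk v = C
    · subst hC
      obtain ⟨w, hw, rfl⟩ := (hc _).2 ⟨v, rfl⟩ j fun h => hne (by rw [h, hd _ ⟨v, rfl⟩])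
      exact ⟨w, hw, hd _ w⟩
    · obtain ⟨w, rfl⟩ := (hc C).1 j
      exact ⟨w, adj_of_compl_component_ne fun h => hC (h.trans w.2), hd C w⟩

theorem mem_fallSpectrum_iff [Finite V] {k : ℕ} :
    k ∈ fallSpectrum G ↔ ∃ κ : Gᶜ.ConnectedComponent → ℕ,
      (∀ C, κ C ∈ fallSpectrum (coComponent G C)) ∧ ∑ᶠ C, κ C = k :=
  ⟨fun ⟨_, hc⟩ => ⟨_, hc.card_image_supp_mem, finsum_card_image_supp hc.1⟩,
    fun ⟨_, hκ, h⟩ => h ▸ finsum_mem_fallSpectrum hκ⟩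

/-! ### The structure of `(P₃ + P₁)`-free graphs -/

/-- The vertex `i` is in a triangle of `H`. -/
def InTriangle (H : SimpleGraph V) (i : V) : Prop :=
  ∃ j k, H.Adj i j ∧ H.Adj j k ∧ H.Adj i k

theorem IsFree.adj_or_adj (hG : IsFree P3addP1 G) {x z w y : V} (hxz : Gᶜ.Adj x z)
    (hwx : Gᶜ.Adj w x) (hwz : Gᶜ.Adj w z) (hwy : Gᶜ.Adj w y) : Gᶜ.Adj y x ∨ Gᶜ.Adj y z := by
  by_contra! hn
  have hyx : y ≠ x := fun e => hn.2 (e ▸ hxz)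
  have hyz : y ≠ z := fun e => hn.1 (e ▸ hxz.symm)
  have h1 : G.Adj y x := by_contra fun h => hn.1 ((compl_adj _ _ _).2 ⟨hyx, h⟩)
  have h2 : G.Adj y z := by_contra fun h => hn.2 ((compl_adj _ _ _).2 ⟨hyz, h⟩)
  rw [compl_adj] at hxz hwx hwz hwy
  refine hG ⟨⟨⟨Sum.elim ![x, y, z] ![w], ?_⟩, ?_⟩⟩
  · rintro (i | i) (j | j) <;> fin_cases i <;> fin_cases j <;>
      simp [hyx, hyz, hxz.1, hwx.1, hwz.1, hwy.1, hyx.symm, hyz.symm, hxz.1.symm, Ne.symm hwx.1,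
        Ne.symm hwz.1, Ne.symm hwy.1]
  · intro i j
    change G.Adj (Sum.elim ![x, y, z] ![w] i) (Sum.elim ![x, y, z] ![w] j) ↔ _
    rcases i with i | i <;> rcases j with j | j <;> fin_cases i <;> fin_cases j <;>
      simp [pathGraph_adj, h1, h2, h1.symm, h2.symm, hxz.2, hwx.2, hwz.2, hwy.2, G.adj_comm z x,
        G.adj_comm x w, G.adj_comm z w, G.adj_comm y w]

theorem IsFree.adj_two (hG : IsFree P3addP1 G) {a b c y : V} (hab : Gᶜ.Adj a b)
    (hbc : Gᶜ.Adj b c) (hac : Gᶜ.Adj a c) (hy : Gᶜ.Reachable a y) :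
    (Gᶜ.Adj y a ∧ Gᶜ.Adj y b) ∨ (Gᶜ.Adj y b ∧ Gᶜ.Adj y c) ∨ (Gᶜ.Adj y a ∧ Gᶜ.Adj y c) := by
  rw [reachable_iff_reflTransGen] at hy
  induction hy with
  | refl => exact Or.inr (Or.inl ⟨hab, hac⟩)
  | @tail s y _ hsy ih =>
    have hy : (Gᶜ.Adj y a ∨ Gᶜ.Adj y b) ∨ Gᶜ.Adj y b ∨ Gᶜ.Adj y c := by
      rcases ih with ⟨ha, hb⟩ | ⟨hb, hc⟩ | ⟨ha, hc⟩
      · exact Or.inl (hG.adj_or_adj hab ha hb hsy)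
      · exact Or.inr (hG.adj_or_adj hbc hb hc hsy)
      · exact (hG.adj_or_adj hac ha hc hsy).imp Or.inl Or.inr
    have ha (h : Gᶜ.Adj y a) := hG.adj_or_adj hbc hab hac h.symm
    have hb (h : Gᶜ.Adj y b) := hG.adj_or_adj hac hab.symm hbc h.symm
    have hc (h : Gᶜ.Adj y c) := hG.adj_or_adj hab hac.symm hbc.symm h.symm
    tauto

theorem IsFree.inTriangle (hG : IsFree P3addP1 G) {i y : V} (h : InTriangle Gᶜ i)
    (hy : Gᶜ.Reachable i y) : InTriangle Gᶜ y := by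
  obtain ⟨b, c, hab, hbc, hac⟩ := h
  rcases hG.adj_two hab hbc hac hy with ⟨h1, h2⟩ | ⟨h1, h2⟩ | ⟨h1, h2⟩
  · exact ⟨i, b, h1, hab, h2⟩
  · exact ⟨b, c, h1, hbc, h2⟩
  · exact ⟨i, c, h1, hac, h2⟩

theorem IsFree.adj_of_inTriangle (hG : IsFree P3addP1 G) {x z y : V} (h : InTriangle Gᶜ x)
    (hxz : Gᶜ.Adj x z) (hy : Gᶜ.Reachable x y) : Gᶜ.Adj y x ∨ Gᶜ.Adj y z := by
  obtain ⟨b, c, hab, hbc, hac⟩ := h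
  obtain ⟨w, hxw, hzw⟩ : ∃ w, Gᶜ.Adj x w ∧ Gᶜ.Adj z w := by
    rcases hG.adj_two hab hbc hac hxz.reachable with h | h | h
    · exact ⟨b, hab, h.2⟩
    · exact ⟨b, hab, h.1⟩
    · exact ⟨c, hac, h.2⟩
  rcases hG.adj_two hxz hzw hxw hy with h | h | h
  · exact Or.inl h.1
  · exact Or.inr h.1
  · exact Or.inl h.1

theorem isFree_threeP1_iff : IsFree threeP1 G ↔ ∀ i, ¬ InTriangle Gᶜ i := by
  constructor
  · rintro h a ⟨b, c, h1, h2, h3⟩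
    rw [compl_adj] at h1 h2 h3
    refine h ⟨⟨⟨![a, b, c], ?_⟩, ?_⟩⟩
    · intro i j
      fin_cases i <;> fin_cases j <;>
        simp [h1.1, h2.1, h3.1, Ne.symm h1.1, Ne.symm h2.1, Ne.symm h3.1]
    · intro i j
      change G.Adj (![a, b, c] i) (![a, b, c] j) ↔ _
      fin_cases i <;> fin_cases j <;>
        simp [h1.2, h2.2, h3.2, G.adj_comm b a, G.adj_comm c a, G.adj_comm c b]
  · rintro h ⟨f⟩
    have hadj : ∀ i j : Fin 3, i ≠ j → Gᶜ.Adj (f i) (f j) := fun i j hij =>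
      (compl_adj _ _ _).2 ⟨f.injective.ne hij, fun hf => f.map_adj_iff.1 hf⟩
    exact h (f 0) ⟨f 1, f 2, hadj _ _ (by decide), hadj _ _ (by decide), hadj _ _ (by decide)⟩

theorem compl_adj_induce {s : Set V} {x y : s} : (G.induce s)ᶜ.Adj x y ↔ Gᶜ.Adj x y := by
  simp only [compl_adj, comap_adj, Function.Embedding.subtype_apply, ne_eq, Subtype.ext_iff]

theorem isFree_threeP1_coComponent {C : Gᶜ.ConnectedComponent}
    (h : ∀ i ∈ C.supp, ¬ InTriangle Gᶜ i) : IsFree threeP1 (coComponent G C) :=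
  isFree_threeP1_iff.2 fun a ⟨b, c, hab, hbc, hac⟩ => h a a.2
    ⟨b, c, compl_adj_induce.1 hab, compl_adj_induce.1 hbc, compl_adj_induce.1 hac⟩

theorem IsFree.reachable_coComponent_iff (hG : IsFree P3addP1 G) {C : Gᶜ.ConnectedComponent}
    {x y : C.supp} (h : InTriangle Gᶜ x) :
    (coComponent G C).Reachable x y ↔ ¬ Gᶜ.Adj x y := by
  constructor
  · intro hr
    rw [reachable_iff_reflTransGen] at hr
    induction hr with
    | refl => exact Gᶜ.loopless.irrefl _
    | @tail b c _ hbc ih =>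
      intro hadj
      rcases hG.adj_of_inTriangle h hadj (C.reachable_of_mem_supp x.2 b.2) with h1 | h1
      · exact ih h1.symm
      · exact ((compl_adj _ _ _).1 h1).2 hbc
  · intro hn
    by_cases he : x = y
    · rw [he]
    · exact Adj.reachable <| by_contra fun hxy =>
        hn (compl_adj_induce.1 ((compl_adj _ _ _).2 ⟨he, hxy⟩))

theorem IsFree.isDisjointUnionOfCliques (hG : IsFree P3addP1 G) {C : Gᶜ.ConnectedComponent}
    {i : V} (hi : i ∈ C.supp) (h : InTriangle Gᶜ i) :
    IsDisjointUnionOfCliques (coComponent G C) := fun D x hx y hy hne => by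
  have hr := (hG.reachable_coComponent_iff (hG.inTriangle h (C.reachable_of_mem_supp hi x.2))).1
    (D.reachable_of_mem_supp hx hy)
  rw [← compl_adj_induce, compl_adj] at hr
  tauto

theorem IsFree.isFree_or_isDisjointUnionOfCliques (hG : IsFree P3addP1 G)
    (C : Gᶜ.ConnectedComponent) :
    IsFree threeP1 (coComponent G C) ∨ IsDisjointUnionOfCliques (coComponent G C) := by
  by_cases! h : ∃ i ∈ C.supp, InTriangle Gᶜ i
  · obtain ⟨i, hi, h⟩ := h
    exact Or.inr (hG.isDisjointUnionOfCliques hi h)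
  · exact Or.inl (isFree_threeP1_coComponent h)

/-! ### Covering matchings of the complement -/

/-- The edges of `H` between vertices that are in no triangle. -/
def offTriangles (H : SimpleGraph V) : SimpleGraph V where
  Adj i j := H.Adj i j ∧ ¬ InTriangle H i ∧ ¬ InTriangle H j
  symm := ⟨fun _ _ h => ⟨h.1.symm, h.2.2, h.2.1⟩⟩
  loopless := ⟨fun i h => H.loopless.irrefl i h.1⟩

theorem offTriangles_eq_self {H : SimpleGraph V} (h : ∀ i, ¬ InTriangle H i) :
    offTriangles H = H := by
  ext i j
  exact and_iff_left ⟨h i, h j⟩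

theorem IsCoveringMate.eq_self_iff {B : SimpleGraph V} {f : V → V} (hf : IsCoveringMate B f)
    {y : V} : f y = y ↔ ∀ z, ¬ B.Adj y z :=
  ⟨fun h _ hyz => hf.ne hyz h, fun h => by_contra fun hne => h _ (hf.adj hne)⟩

theorem mem_universalVerts_iff {y : V} : y ∈ G.universalVerts ↔ ∀ z, ¬ Gᶜ.Adj y z :=
  forall_congr' fun z => by rw [compl_adj, not_and_not_right]

theorem IsCoveringMate.fixedPoints_eq {f : V → V} (hf : IsCoveringMate Gᶜ f) :
    Function.fixedPoints f = G.universalVerts :=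
  Set.ext fun _ => hf.eq_self_iff.trans mem_universalVerts_iff.symm

open Classical in
theorem sum_one_add_ite_fixed [Fintype V] (f : V → V) :
    ∑ y, (1 + if f y = y then 1 else 0) = Nat.card V + (Function.fixedPoints f).ncard := by
  rw [Finset.sum_add_distrib, Finset.sum_boole, Finset.sum_const, Finset.card_univ, smul_eq_mul,
    mul_one, Nat.card_eq_fintype_card, Nat.cast_id, ← Set.ncard_coe_finset, Finset.coe_filter_univ]
  rfl

theorem two_mul_card_of_orbits [Finite V] {α : Type*} [Finite α] {c : V → α}
    (hsurj : Function.Surjective c) {f : V → V} (hc : ∀ y z, c y = c z ↔ z = y ∨ z = f y) :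
    2 * Nat.card α = Nat.card V + (Function.fixedPoints f).ncard := by
  classical
  have := Fintype.ofFinite V
  have := Fintype.ofFinite α
  have hinv : ∀ y, f (f y) = y := fun y => by
    rcases (hc (f y) y).1 ((hc y (f y)).2 (Or.inr rfl)).symm with h | h
    · rw [← h, ← h]
    · exact h.symm
  rw [← sum_one_add_ite_fixed, ← Finset.sum_fiberwise _ c, mul_comm, Nat.card_eq_fintype_card,
    ← Finset.card_univ, ← smul_eq_mul, ← Finset.sum_const]
  refine Finset.sum_congr rfl fun j _ => ?_
  obtain ⟨y, rfl⟩ := hsurj j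
  have hfibre : (Finset.univ.filter fun z => c z = c y) = {y, f y} := by
    ext z
    rw [Finset.mem_filter_univ, eq_comm, hc, Finset.mem_insert, Finset.mem_singleton]
  rw [hfibre]
  by_cases hy : f y = y
  · rw [hy, Finset.pair_eq_singleton, Finset.sum_singleton, if_pos hy]
  · rw [Finset.sum_pair (Ne.symm hy), hinv, if_neg hy, if_neg (Ne.symm hy)]

theorem IsFallColouring.exists_isCoveringMate {k : ℕ} {c : G.Coloring (Fin k)}
    (hc : IsFallColouring c)
    (htri : ∀ {x y}, Gᶜ.Adj x y → InTriangle Gᶜ y → InTriangle Gᶜ x) :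
    ∃ f, IsCoveringMate (offTriangles Gᶜ) f ∧
      ∀ y, ¬ InTriangle Gᶜ y → ∀ z, c y = c z ↔ z = y ∨ z = f y := by
  have hex : ∀ y, ∃ w, (InTriangle Gᶜ y → w = y) ∧
      (¬ InTriangle Gᶜ y → ∀ z, c y = c z ↔ z = y ∨ z = w) := by
    intro y
    by_cases! hw : InTriangle Gᶜ y ∨ ∀ z, c y = c z → z = y
    · exact ⟨y, fun _ => rfl, fun hy z =>
        ⟨fun h => Or.inl (hw.resolve_left hy z h), fun h => (or_self_iff.1 h) ▸ rfl⟩⟩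
    · obtain ⟨hy, w, hcw, hwy⟩ := hw
      refine ⟨w, fun h => absurd h hy, fun _ z => ⟨fun hz => ?_, ?_⟩⟩
      · by_contra! hn
        exact hy ⟨w, z, compl_adj_of_color_eq c hcw hwy.symm,
          compl_adj_of_color_eq c (hcw.symm.trans hz) hn.2.symm,
          compl_adj_of_color_eq c hz hn.1.symm⟩
      · rintro (rfl | rfl)
        exacts [rfl, hcw]
  choose f hfix hcf using hex
  have hnot : ∀ {y}, f y ≠ y → ¬ InTriangle Gᶜ y := fun h hy => h (hfix _ hy)
  have hadj : ∀ {y}, f y ≠ y → (offTriangles Gᶜ).Adj y (f y) := fun {y} h =>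
    have ha := compl_adj_of_color_eq c ((hcf y (hnot h) _).2 (Or.inr rfl)) h.symm
    ⟨ha, hnot h, fun ht => hnot h (htri ha ht)⟩
  refine ⟨f, ⟨⟨fun y => ?_, hadj⟩, fun {y z} hyz hy => ?_⟩, hcf⟩
  · by_cases hy : f y = y
    · rw [hy, hy]
    · have hcy := (hcf y (hnot hy) (f y)).2 (Or.inr rfl)
      exact (((hcf (f y) (hadj hy).2.2 y).1 hcy.symm).resolve_left (Ne.symm hy)).symm
  · have honly : ∀ x, c y = c x → x = y := fun x hx =>
      ((hcf y hyz.2.1 x).1 hx).elim id fun h => h.trans hy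
    obtain ⟨x, hzx, hxy⟩ := hc.2 z (c y) fun h => hyz.ne (honly z h).symm
    rw [honly x hxy.symm] at hzx
    exact ((compl_adj _ _ _).1 hyz.1).2 hzx.symm

theorem IsFree.exists_isCoveringMate_of_mem [Finite V] (hG : IsFree threeP1 G) {k : ℕ}
    (hk : k ∈ fallSpectrum G) :
    ∃ f, IsCoveringMate Gᶜ f ∧ 2 * k = Nat.card V + (Function.fixedPoints f).ncard := by
  rw [isFree_threeP1_iff] at hG
  obtain ⟨c, hc⟩ := hk
  obtain ⟨f, hf, hcf⟩ := hc.exists_isCoveringMate fun _ h => absurd h (hG _)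
  rw [offTriangles_eq_self hG] at hf
  refine ⟨f, hf, ?_⟩
  rw [← two_mul_card_of_orbits hc.1 fun y => hcf y (hG y), Nat.card_fin]

/-- The partition into the edges of the matching and the uncovered vertices. -/
def IsMate.setoid {B : SimpleGraph V} {f : V → V} (hf : IsMate B f) : Setoid V where
  r y z := z = y ∨ z = f y
  iseqv := by
    refine ⟨fun y => Or.inl rfl, ?_, ?_⟩
    · rintro y z (rfl | rfl)
      exacts [Or.inl rfl, Or.inr (hf.involutive y).symm]
    · rintro x y z (rfl | rfl) (rfl | rfl)
      exacts [Or.inl rfl, Or.inr rfl, Or.inr rfl, Or.inl (hf.involutive x)]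

/-- The pairs and the uncovered vertices are the colour classes. A vertex outside a pair is adjacent
to one of its vertices, as otherwise there are three pairwise non-adjacent vertices. -/
theorem IsFree.exists_mem_fallSpectrum [Finite V] (hG : IsFree threeP1 G) {f : V → V}
    (hf : IsCoveringMate Gᶜ f) :
    ∃ k ∈ fallSpectrum G, 2 * k = Nat.card V + (Function.fixedPoints f).ncard := by
  rw [isFree_threeP1_iff] at hG
  let s := hf.toIsMate.setoid
  have hs : ∀ y z, Quotient.mk s y = Quotient.mk s z ↔ z = y ∨ z = f y := fun y z => Quotient.eq
  refine ⟨Nat.card (Quotient s), card_mem_fallSpectrum (Quotient.mk s) ?_ Quotient.mk_surjective ?_,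
    two_mul_card_of_orbits Quotient.mk_surjective hs⟩
  · intro v w hvw he
    rcases (hs v w).1 he with rfl | rfl
    · exact hvw.ne rfl
    · exact ((compl_adj _ _ _).1 (hf.adj hvw.ne')).2 hvw
  · intro v j hj
    obtain ⟨z, rfl⟩ := Quotient.mk_surjective j
    have hvz : v ≠ z := fun h => hj (by rw [h])
    have hvf : v ≠ f z := fun h => hj ((hs z v).2 (Or.inr h))
    by_cases hz : f z = z
    · exact ⟨z, (mem_universalVerts_iff.2 (hf.eq_self_iff.1 hz) hvz.symm).symm, rfl⟩
    · by_contra! hn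
      have h1 : ¬ G.Adj v z := fun h => hn z h rfl
      have h2 : ¬ G.Adj v (f z) := fun h => hn (f z) h ((hs z (f z)).2 (Or.inr rfl)).symm
      exact hG v ⟨z, f z, (compl_adj _ _ _).2 ⟨hvz, h1⟩, hf.adj hz, (compl_adj _ _ _).2 ⟨hvf, h2⟩⟩

theorem hasPerfectMatching_iff {H : SimpleGraph V} :
    HasPerfectMatching H ↔ ∃ f, IsMate H f ∧ ∀ y, f y ≠ y := by
  constructor
  · rintro ⟨M, hM, hspan⟩
    choose g hg hg' using fun v => hM (hspan v)
    exact ⟨g, ⟨fun v => (hg' _ _ (hg v).symm).symm, fun _ => (hg _).adj_sub⟩,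
      fun v => (hg v).adj_sub.ne'⟩
  · rintro ⟨f, hf, hne⟩
    exact ⟨{ verts := Set.univ
             Adj := fun a b => f a = b
             adj_sub := fun {a b} h => h ▸ hf.adj (hne a)
             edge_vert := fun _ => trivial
             symm := ⟨fun a b h => h ▸ hf.involutive a⟩ },
      fun v _ => ⟨f v, rfl, fun _ h => Eq.symm h⟩, fun _ => trivial⟩

theorem hasPerfectMatching_deleteDominating_iff :
    HasPerfectMatching (deleteDominating G)ᶜ ↔ ∃ f, IsCoveringMate Gᶜ f := by
  classical
  rw [hasPerfectMatching_iff]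
  constructor
  · rintro ⟨g, hg, hne⟩
    let f : V → V := fun y => if h : y ∈ G.universalVertsᶜ then g ⟨y, h⟩ else y
    have hfg (y : ↥(G.universalVertsᶜ)) : f y = g y := dif_pos y.2
    have hfu {y : V} (hy : y ∈ G.universalVerts) : f y = y := dif_neg (not_not.2 hy)
    refine ⟨f, ⟨fun y => ?_, fun {y} hy => ?_⟩, fun {y z} hyz hy => ?_⟩
    · by_cases h : y ∈ G.universalVerts
      · rw [hfu h, hfu h]
      · rw [hfg ⟨y, h⟩, hfg, hg.involutive]
    · have h : y ∉ G.universalVerts := fun h => hy (hfu h)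
      rw [hfg ⟨y, h⟩]
      exact compl_adj_induce.1 (hg.adj (hne ⟨y, h⟩))
    · have h : y ∉ G.universalVerts := fun h => mem_universalVerts_iff.1 h z hyz
      exact hne ⟨y, h⟩ (Subtype.ext ((hfg ⟨y, h⟩).symm.trans hy))
  · rintro ⟨f, hf⟩
    have hfix : ∀ {y}, f y = y ↔ y ∈ G.universalVerts := fun {y} => by
      rw [← hf.fixedPoints_eq, Function.mem_fixedPoints_iff]
    have hmaps (y : ↥(G.universalVertsᶜ)) : f y ∈ G.universalVertsᶜ := fun h =>
      y.2 (hfix.1 ((hfix.2 h).symm.trans (hf.involutive y)))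
    refine ⟨fun y => ⟨f y, hmaps y⟩, ⟨fun y => Subtype.ext (hf.involutive y), fun {y} _ => ?_⟩,
      fun y h => ?_⟩
    · exact compl_adj_induce.2 (hf.adj fun h => y.2 (hfix.1 h))
    · exact y.2 (hfix.1 (Subtype.ext_iff.1 h))

theorem IsCoveringMate.eq_of_two_mul_eq [Finite V] {f : V → V} (hf : IsCoveringMate Gᶜ f) {k : ℕ}
    (hk : 2 * k = Nat.card V + (Function.fixedPoints f).ncard) :
    k = G.universalVerts.ncard + G.universalVertsᶜ.ncard / 2 := by
  rw [hf.fixedPoints_eq] at hk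
  have := Set.ncard_add_ncard_compl G.universalVerts
  omega

theorem fallSpectrum_of_hasPerfectMatching [Finite V] (hG : IsFree threeP1 G)
    (hM : HasPerfectMatching (deleteDominating G)ᶜ) :
    fallSpectrum G = {G.universalVerts.ncard + G.universalVertsᶜ.ncard / 2} := by
  obtain ⟨f, hf⟩ := hasPerfectMatching_deleteDominating_iff.1 hM
  obtain ⟨k, hk, h⟩ := hG.exists_mem_fallSpectrum hf
  refine Set.eq_singleton_iff_unique_mem.2 ⟨hf.eq_of_two_mul_eq h ▸ hk, fun l hl => ?_⟩
  obtain ⟨g, hg, h⟩ := hG.exists_isCoveringMate_of_mem hl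
  exact hg.eq_of_two_mul_eq h

theorem fallSpectrum_of_not_hasPerfectMatching [Finite V] (hG : IsFree threeP1 G)
    (hM : ¬ HasPerfectMatching (deleteDominating G)ᶜ) : fallSpectrum G = ∅ := by
  refine Set.eq_empty_iff_forall_notMem.2 fun k hk => ?_
  obtain ⟨f, hf, -⟩ := hG.exists_isCoveringMate_of_mem hk
  exact hM (hasPerfectMatching_deleteDominating_iff.2 ⟨f, hf⟩)

/-! ### Disjoint unions of complete graphs -/

theorem IsDisjointUnionOfCliques.ncard_supp (hG : IsDisjointUnionOfCliques G) {k : ℕ}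
    (hk : k ∈ fallSpectrum G) (D : G.ConnectedComponent) : D.supp.ncard = k := by
  obtain ⟨c, -, hfall⟩ := hk
  rw [← Nat.card_coe_set_eq]
  refine (Nat.card_eq_of_bijective (fun v : D.supp => c v) ⟨fun v w h => ?_, fun j => ?_⟩).trans
    (Nat.card_fin k)
  · by_contra hne
    exact c.valid (hG D v.2 w.2 fun e => hne (Subtype.ext e)) h
  · obtain ⟨v, hv⟩ := D.nonempty_supp
    by_cases hj : j = c v
    · exact ⟨⟨v, hv⟩, hj.symm⟩
    · obtain ⟨w, hw, rfl⟩ := hfall v j hj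
      exact ⟨⟨w, (ConnectedComponent.sound hw.reachable.symm).trans hv⟩, rfl⟩

theorem IsDisjointUnionOfCliques.mem_fallSpectrum [Finite V] [Nonempty V]
    (hG : IsDisjointUnionOfCliques G) {p : ℕ}
    (hp : ∀ D : G.ConnectedComponent, D.supp.ncard = p) : p ∈ fallSpectrum G := by
  have e (D : G.ConnectedComponent) : D.supp ≃ Fin p :=
    Finite.equivFinOfCardEq ((Nat.card_coe_set_eq _).trans (hp D))
  let c : V → Fin p := fun v => e (G.connectedComponentMk v) ⟨v, rfl⟩
  have hc : ∀ (D : G.ConnectedComponent) (v : D.supp), c v = e D v := by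
    rintro _ ⟨v, rfl⟩
    rfl
  have hsymm (D : G.ConnectedComponent) (j : Fin p) : c ((e D).symm j) = j := by
    rw [hc, Equiv.apply_symm_apply]
  rw [← Nat.card_fin p]
  refine card_mem_fallSpectrum c (fun v w hadj he => ?_) (fun j => ?_) fun v j hj => ?_
  · have hw : w ∈ (G.connectedComponentMk v).supp :=
      ConnectedComponent.sound hadj.reachable.symm
    rw [hc _ ⟨v, rfl⟩, hc (G.connectedComponentMk v) ⟨w, hw⟩] at he
    exact hadj.ne (Subtype.ext_iff.1 ((e _).injective he))
  · obtain ⟨v⟩ := ‹Nonempty V›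
    exact ⟨_, hsymm (G.connectedComponentMk v) j⟩
  · refine ⟨_, hG (G.connectedComponentMk v) rfl (Subtype.coe_prop _) fun he => hj ?_, hsymm _ j⟩
    rw [he, hsymm]

theorem IsDisjointUnionOfCliques.fallSpectrum_eq [Finite V] [Nonempty V]
    (hG : IsDisjointUnionOfCliques G) {p : ℕ}
    (hp : ∀ D : G.ConnectedComponent, D.supp.ncard = p) : fallSpectrum G = {p} := by
  refine Set.eq_singleton_iff_unique_mem.2 ⟨hG.mem_fallSpectrum hp, fun k hk => ?_⟩
  obtain ⟨v⟩ := ‹Nonempty V›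
  rw [← hp (G.connectedComponentMk v), hG.ncard_supp hk]

theorem IsDisjointUnionOfCliques.fallSpectrum_eq_empty (hG : IsDisjointUnionOfCliques G)
    (hp : ¬ ∃ p : ℕ, ∀ D : G.ConnectedComponent, D.supp.ncard = p) : fallSpectrum G = ∅ :=
  Set.eq_empty_iff_forall_notMem.2 fun k hk => hp ⟨k, hG.ncard_supp hk⟩

/-! ### Uniqueness -/

theorem IsFree.subsingleton_fallSpectrum_coComponent [Finite V] (hG : IsFree P3addP1 G)
    (C : Gᶜ.ConnectedComponent) : (fallSpectrum (coComponent G C)).Subsingleton := by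
  have : Nonempty C.supp := C.nonempty_supp.to_subtype
  rcases hG.isFree_or_isDisjointUnionOfCliques C with h | h
  · by_cases hM : HasPerfectMatching (deleteDominating (coComponent G C))ᶜ
    · exact fallSpectrum_of_hasPerfectMatching h hM ▸ Set.subsingleton_singleton
    · exact fallSpectrum_of_not_hasPerfectMatching h hM ▸ Set.subsingleton_empty
  · intro k hk l hl
    obtain ⟨v⟩ := this
    rw [← h.ncard_supp hk ((coComponent G C).connectedComponentMk v), h.ncard_supp hl]

theorem IsFree.subsingleton_fallSpectrum [Finite V] (hG : IsFree P3addP1 G) :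
    (fallSpectrum G).Subsingleton := fun k hk l hl => by
  obtain ⟨κ, hκ, rfl⟩ := mem_fallSpectrum_iff.1 hk
  obtain ⟨μ, hμ, rfl⟩ := mem_fallSpectrum_iff.1 hl
  exact finsum_congr fun C => hG.subsingleton_fallSpectrum_coComponent C (hκ C) (hμ C)

theorem IsFree.fallSpectrum_eq_singleton [Finite V] (hG : IsFree P3addP1 G) {k : ℕ}
    (hk : k ∈ fallSpectrum G) : fallSpectrum G = {k} :=
  hG.subsingleton_fallSpectrum.eq_singleton_of_mem hk

/-! ### The fall spectrum from a matching and the sizes of parts -/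

/-- The vertices `i` and `j` are not adjacent but have a common neighbour. In a complete
multipartite component this means that they are in the same part. -/
def SamePart (H : SimpleGraph V) (i j : V) : Prop :=
  ¬ H.Adj i j ∧ ∃ z, H.Adj i z ∧ H.Adj z j

/-- The size of the part of `i`, if the component of `i` is complete multipartite. -/
noncomputable def partSize (H : SimpleGraph V) (i : V) : ℕ :=
  {j | SamePart H i j}.ncard

theorem IsFree.samePart_iff (hG : IsFree P3addP1 G) {i j : V} (h : InTriangle Gᶜ i) :
    SamePart Gᶜ i j ↔ Gᶜ.Reachable i j ∧ ¬ Gᶜ.Adj i j := by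
  constructor
  · rintro ⟨hij, z, hiz, hzj⟩
    exact ⟨hiz.reachable.trans hzj.reachable, hij⟩
  · rintro ⟨hr, hij⟩
    obtain ⟨z, -, hz, -⟩ := id h
    rcases hG.adj_of_inTriangle h hz hr with h' | h'
    · exact absurd h'.symm hij
    · exact ⟨hij, z, hz, h'.symm⟩

theorem IsFree.adj_or_samePart_iff (hG : IsFree P3addP1 G) {i j : V} (h : InTriangle Gᶜ i) :
    Gᶜ.Adj i j ∨ SamePart Gᶜ i j ↔ Gᶜ.Reachable i j := by
  rw [hG.samePart_iff h]
  have (ha : Gᶜ.Adj i j) := ha.reachable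
  tauto

theorem IsFree.ncard_supp_eq_partSize (hG : IsFree P3addP1 G) {C : Gᶜ.ConnectedComponent}
    {x : C.supp} (h : InTriangle Gᶜ x) :
    ((coComponent G C).connectedComponentMk x).supp.ncard = partSize Gᶜ x := by
  rw [partSize, ← Set.ncard_image_of_injective _ Subtype.val_injective]
  congr 1
  ext j
  rw [Set.mem_ofPred_eq, hG.samePart_iff h]
  constructor
  · rintro ⟨y, hy, rfl⟩
    exact ⟨C.reachable_of_mem_supp x.2 y.2,
      (hG.reachable_coComponent_iff h).1 (ConnectedComponent.exact hy).symm⟩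
  · rintro ⟨hr, hadj⟩
    have hj : j ∈ C.supp := (ConnectedComponent.sound hr.symm).trans x.2
    exact ⟨⟨j, hj⟩, ConnectedComponent.sound
      ((hG.reachable_coComponent_iff h (y := ⟨j, hj⟩)).2 hadj).symm, rfl⟩

theorem IsFree.partSize_eq [Finite V] (hG : IsFree P3addP1 G) (h : (fallSpectrum G).Nonempty)
    {i j : V} (hi : InTriangle Gᶜ i) (hij : Gᶜ.Adj i j) : partSize Gᶜ i = partSize Gᶜ j := by
  obtain ⟨k, hk⟩ := h
  obtain ⟨κ, hκ, -⟩ := mem_fallSpectrum_iff.1 hk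
  let C := Gᶜ.connectedComponentMk i
  have hj : j ∈ C.supp := ConnectedComponent.sound hij.reachable.symm
  have hcl := hG.isDisjointUnionOfCliques (C := C) rfl hi
  rw [← hG.ncard_supp_eq_partSize (C := C) (x := ⟨i, rfl⟩) hi, hcl.ncard_supp (hκ C),
    ← hG.ncard_supp_eq_partSize (x := ⟨j, hj⟩) (hG.inTriangle hi hij.reachable),
    hcl.ncard_supp (hκ C)]

theorem IsFree.exists_isCoveringMate_offTriangles (hG : IsFree P3addP1 G)
    (h : (fallSpectrum G).Nonempty) : ∃ f, IsCoveringMate (offTriangles Gᶜ) f := by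
  obtain ⟨k, c, hc⟩ := h
  obtain ⟨f, hf, -⟩ := hc.exists_isCoveringMate fun hxy hy => hG.inTriangle hy hxy.symm.reachable
  exact ⟨f, hf⟩

theorem IsCoveringMate.restrict_coComponent {f : V → V} (hf : IsCoveringMate (offTriangles Gᶜ) f)
    {C : Gᶜ.ConnectedComponent} (h : ∀ i ∈ C.supp, ¬ InTriangle Gᶜ i) :
    ∃ g : C.supp → C.supp, IsCoveringMate (coComponent G C)ᶜ g ∧ ∀ x, (g x : V) = f x := by
  have hmaps (x : C.supp) : f x ∈ C.supp := by
    by_cases hx : f x = x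
    · exact hx.symm ▸ x.2
    · exact (ConnectedComponent.sound (hf.adj hx).1.symm.reachable).trans x.2
  refine ⟨fun x => ⟨f x, hmaps x⟩, ⟨⟨fun x => Subtype.ext (hf.involutive x), fun {x} hx => ?_⟩,
    fun {x y} hxy hx => ?_⟩, fun _ => rfl⟩
  · exact compl_adj_induce.2 (hf.adj fun e => hx (Subtype.ext e)).1
  · exact hf.ne ⟨compl_adj_induce.1 hxy, h x x.2, h y y.2⟩ (Subtype.ext_iff.1 hx)

variable [LinearOrder V] {mate : V → V}

open Classical in
/-- The contribution of the vertex `i` to the number of colours. The first vertex of a component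
with triangles stands for all colours of the component, and the first vertex of a pair or an
uncovered vertex in any other component for one colour. -/
noncomputable def weight (H : SimpleGraph V) (mate : V → V) (i : V) : ℕ :=
  if InTriangle H i then if ∃ j < i, H.Adj i j ∨ SamePart H i j then 0 else partSize H i
  else if i ≤ mate i then 1 else 0

theorem two_mul_sum_ite_le_apply [Fintype V] {f : V → V} (hf : Function.Involutive f) :
    2 * ∑ y, (if y ≤ f y then 1 else 0) = Nat.card V + (Function.fixedPoints f).ncard := by
  classical
  rw [two_mul, ← sum_one_add_ite_fixed]
  nth_rewrite 2 [← Equiv.sum_comp hf.toPerm]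
  rw [← Finset.sum_add_distrib]
  refine Finset.sum_congr rfl fun y _ => ?_
  rw [hf.coe_toPerm, hf y]
  rcases lt_trichotomy y (f y) with h | h | h
  · rw [if_pos h.le, if_neg h.not_ge, if_neg h.ne']
  · rw [if_pos h.le, if_pos h.ge, if_pos h.symm]
  · rw [if_neg h.not_ge, if_pos h.le, if_neg h.ne]

theorem IsFree.sum_weight_eq_partSize [Finite V] (hG : IsFree P3addP1 G)
    {C : Gᶜ.ConnectedComponent} [Fintype C.supp] (htri : ∀ x ∈ C.supp, InTriangle Gᶜ x) :
    ∃ x₀ ∈ C.supp, ∑ x : C.supp, weight Gᶜ mate x = partSize Gᶜ x₀ := by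
  have : Nonempty C.supp := C.nonempty_supp.to_subtype
  obtain ⟨x₀, hmin⟩ := Finite.exists_min (fun x : C.supp => x.1)
  refine ⟨x₀, x₀.2, ?_⟩
  rw [Finset.sum_eq_single x₀ (fun x _ hx => ?_)
    fun h => absurd (Finset.mem_univ _) h]
  · rw [weight, if_pos (htri x₀ x₀.2), if_neg]
    rintro ⟨j, hj, hadj⟩
    have hr := (hG.adj_or_samePart_iff (htri x₀ x₀.2)).1 hadj
    exact (hmin ⟨j, (ConnectedComponent.sound hr.symm).trans x₀.2⟩).not_gt hj
  · rw [weight, if_pos (htri x x.2), if_pos]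
    exact ⟨x₀, (hmin x).lt_of_ne fun e => hx (Subtype.ext e.symm),
      (hG.adj_or_samePart_iff (htri x x.2)).2 (C.reachable_of_mem_supp x.2 x₀.2)⟩

theorem IsFree.sum_weight_mem_of_inTriangle [Finite V] (hG : IsFree P3addP1 G)
    (hpart : ∀ i j, InTriangle Gᶜ i → Gᶜ.Adj i j → partSize Gᶜ i = partSize Gᶜ j)
    {C : Gᶜ.ConnectedComponent} [Fintype C.supp] {i : V} (hi : i ∈ C.supp)
    (h : InTriangle Gᶜ i) :
    ∑ x : C.supp, weight Gᶜ mate x ∈ fallSpectrum (coComponent G C) := by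
  have htri : ∀ x ∈ C.supp, InTriangle Gᶜ x := fun x hx =>
    hG.inTriangle h (C.reachable_of_mem_supp hi hx)
  obtain ⟨x₀, hx₀, hsum⟩ := hG.sum_weight_eq_partSize (mate := mate) htri
  have : Nonempty C.supp := ⟨⟨i, hi⟩⟩
  rw [hsum]
  refine (hG.isDisjointUnionOfCliques hi h).mem_fallSpectrum fun D => ?_
  obtain ⟨x, rfl⟩ := D.exists_rep
  change ((coComponent G C).connectedComponentMk x).supp.ncard = _
  by_cases hadj : Gᶜ.Adj x x₀
  · rw [hG.ncard_supp_eq_partSize (htri x x.2), hpart x x₀ (htri x x.2) hadj]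
  · rw [← hG.ncard_supp_eq_partSize (x := ⟨x₀, hx₀⟩) (htri x₀ hx₀), ConnectedComponent.sound
      ((hG.reachable_coComponent_iff (htri x x.2) (y := ⟨x₀, hx₀⟩)).2 hadj)]

theorem IsCoveringMate.sum_weight_mem_of_not_inTriangle [Finite V]
    (hm : IsCoveringMate (offTriangles Gᶜ) mate) {C : Gᶜ.ConnectedComponent} [Fintype C.supp]
    (h : ∀ i ∈ C.supp, ¬ InTriangle Gᶜ i) :
    ∑ x : C.supp, weight Gᶜ mate x ∈ fallSpectrum (coComponent G C) := by
  obtain ⟨f, hf, hfm⟩ := hm.restrict_coComponent h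
  obtain ⟨k, hk, hk2⟩ := (isFree_threeP1_coComponent h).exists_mem_fallSpectrum hf
  have hsum : ∑ x : C.supp, weight Gᶜ mate x = ∑ x : C.supp, if x ≤ f x then 1 else 0 :=
    Finset.sum_congr rfl fun x _ => by
      simp only [weight, if_neg (h x x.2), ← hfm, Subtype.coe_le_coe]
  rw [← two_mul_sum_ite_le_apply hf.involutive, ← hsum] at hk2
  rwa [← Nat.eq_of_mul_eq_mul_left two_pos hk2]

theorem IsFree.sum_weight_mem [Fintype V] (hG : IsFree P3addP1 G)
    (hm : IsCoveringMate (offTriangles Gᶜ) mate)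
    (hpart : ∀ i j, InTriangle Gᶜ i → Gᶜ.Adj i j → partSize Gᶜ i = partSize Gᶜ j) :
    ∑ i, weight Gᶜ mate i ∈ fallSpectrum G := by
  classical
  have := Fintype.ofFinite Gᶜ.ConnectedComponent
  have hsum : ∑ᶠ C : Gᶜ.ConnectedComponent, ∑ x : C.supp, weight Gᶜ mate x =
      ∑ i, weight Gᶜ mate i := by
    rw [finsum_eq_sum_of_fintype, ← Fintype.sum_sigma'
      (fun (C : Gᶜ.ConnectedComponent) (x : C.supp) => weight Gᶜ mate x)]
    let e : ((C : Gᶜ.ConnectedComponent) × C.supp) ≃ V :=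
      Equiv.sigmaFiberEquiv Gᶜ.connectedComponentMk
    exact Equiv.sum_comp e (weight Gᶜ mate)
  rw [← hsum]
  refine finsum_mem_fallSpectrum fun C => ?_
  by_cases! h : ∃ i ∈ C.supp, InTriangle Gᶜ i
  · obtain ⟨i, hi, h⟩ := h
    exact hG.sum_weight_mem_of_inTriangle hpart hi h
  · exact hm.sum_weight_mem_of_not_inTriangle h

end FallColouring

/-! ### The decision and computation of the fall spectrum -/

namespace FallColouring

open RAM RAM.ArrayTerm

/-- The vertex `i` shows that `mate` does not cover all vertices that are not isolated in
`offTriangles H`, or that two adjacent parts have different sizes. -/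
def IsObstruction {V : Type*} (H : SimpleGraph V) (mate : V → V) (i : V) : Prop :=
  (mate i = i ∧ ∃ z, (offTriangles H).Adj i z) ∨
    (InTriangle H i ∧ ∃ j, H.Adj i j ∧ partSize H i ≠ partSize H j)

theorem IsFree.not_isObstruction {V : Type*} [Finite V] {G : SimpleGraph V} {mate : V → V}
    (hG : IsFree P3addP1 G) (h : (fallSpectrum G).Nonempty)
    (hm : IsCoveringMate (offTriangles Gᶜ) mate) (i : V) : ¬ IsObstruction Gᶜ mate i := by
  rintro (⟨hi, z, hz⟩ | ⟨hi, j, hij, hne⟩)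
  · exact hm.ne hz hi
  · exact hne (hG.partSize_eq h hi hij)

theorem IsFree.sum_weight_mem_of_not_isObstruction {V : Type*} [Fintype V] [LinearOrder V]
    {G : SimpleGraph V} {mate : V → V} (hG : IsFree P3addP1 G)
    (hm : IsMate (offTriangles Gᶜ) mate) (h : ∀ i, ¬ IsObstruction Gᶜ mate i) :
    ∑ i, weight Gᶜ mate i ∈ fallSpectrum G := by
  refine hG.sum_weight_mem ⟨hm, fun hyz hy => h _ (Or.inl ⟨hy, _, hyz⟩)⟩ fun i j hi hij => ?_
  by_contra hne
  exact h i (Or.inr ⟨hi, j, hij, hne⟩)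

/-- The condition that `0` and `1` are adjacent in the complement. -/
def complTerm : ArrayTerm := .and (.not (.eq (.idx 0) (.idx 1))) (.not (.get 0 0 1))

/-- The condition that `0` is in a triangle of the complement. -/
def triangleTerm : ArrayTerm :=
  .ex 2 (.ex 3 (.and (.get 20 0 2) (.and (.get 20 2 3) (.get 20 0 3))))

/-- The condition that `x` and `y` are adjacent in the complement and in no triangles. -/
def offTrianglesTerm (x y : ℕ) : ArrayTerm :=
  .and (.get 20 x y) (.and (.not (.get 21 x x)) (.not (.get 21 y y)))

/-- The condition that `0` and `1` are in the same part. -/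
def samePartTerm : ArrayTerm := .and (.not (.get 20 0 1)) (.ex 2 (.and (.get 20 0 2) (.get 20 2 1)))

/-- The size of the part of `0`. -/
def partSizeTerm : ArrayTerm := .sum 2 (.ite (.get 22 0 2) (.lit 1) (.lit 0))

/-- The condition `IsObstruction` for `0`. -/
def obstructionTerm : ArrayTerm :=
  .or (.and (.eq (.get 9 0 0) (.idx 0)) (.ex 2 (offTrianglesTerm 0 2)))
    (.and (.get 21 0 0) (.ex 2 (.and (.get 20 0 2) (.not (.eq (.get 23 0 0) (.get 23 2 2))))))

/-- The weight of `0`. -/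
def weightTerm : ArrayTerm :=
  .ite (.get 21 0 0)
    (.ite (.ex 2 (.and (.lt (.idx 2) (.idx 0)) (.or (.get 20 0 2) (.get 22 0 2))))
      (.lit 0) (.get 23 0 0))
    (.ite (.lt (.get 9 0 0) (.idx 0)) (.lit 0) (.lit 1))

/-- Compute the complement of the graph in array `0`, its triangles and the graph for
`matchProg`. -/
def prepareProg : ArrayProg :=
  .seq (.set 20 complTerm) (.seq (.set 21 triangleTerm) (.set 1 (offTrianglesTerm 0 1)))

/-- Compute the parts, the obstructions and the weights from the results of `prepareProg` and
`matchProg`. -/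
def evaluateProg : ArrayProg :=
  .seq (.seq (.set 22 samePartTerm) (.set 23 partSizeTerm))
    (.seq (.set 24 obstructionTerm) (.set 25 weightTerm))

/-- For a graph in array `0`, compute the obstructions to a fall colouring in array `24` and the
contributions of the vertices to the number of colours in array `25`. -/
def fallProg : ArrayProg := .seq prepareProg (.seq matchProg evaluateProg)

variable {n : ℕ} {H : SimpleGraph (Fin n)} {mate : Fin n → Fin n} {X : Arrays n}

/-- The arrays hold the graph `H` (array `20`) and its vertices in triangles (array `21`). -/
structure Prepared (H : SimpleGraph (Fin n)) (X : Arrays n) : Prop where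
  graph : ∀ i j, X 20 i j ≠ 0 ↔ H.Adj i j
  triangle : ∀ i j, X 21 i j ≠ 0 ↔ InTriangle H i

/-- In addition, the arrays hold the relation `SamePart` (array `22`) and the sizes of the parts
(array `23`). -/
structure Partitioned (H : SimpleGraph (Fin n)) (X : Arrays n) : Prop extends Prepared H X where
  samePart : ∀ i j, X 22 i j ≠ 0 ↔ SamePart H i j
  partSize : ∀ i j, X 23 i j = partSize H i

theorem Prepared.congr {Y : Arrays n} (h : Prepared H X) (h₂₀ : Y 20 = X 20) (h₂₁ : Y 21 = X 21) :
    Prepared H Y where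
  graph := by simpa only [h₂₀] using h.graph
  triangle := by simpa only [h₂₁] using h.triangle

theorem holds_complTerm (G : SimpleGraph (Fin n)) (i j : Fin n) :
    Holds (inputArrays (adjArray G)) (pairEnv i j) complTerm ↔ Gᶜ.Adj i j := by
  by_cases h : G.Adj i j <;> simp [complTerm, pairEnv, inputArrays, adjArray, Fin.ext_iff, h]

theorem holds_triangleTerm (h : ∀ i j, X 20 i j ≠ 0 ↔ H.Adj i j) (i j : Fin n) :
    Holds X (pairEnv i j) triangleTerm ↔ InTriangle H i := by
  simp only [triangleTerm, holds_ex, holds_and, holds_get, h]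
  simp [pairEnv, InTriangle]

theorem Prepared.holds_offTrianglesTerm (h : Prepared H X) {e : ℕ → Fin n} {x y : ℕ} :
    Holds X e (offTrianglesTerm x y) ↔ (offTriangles H).Adj (e x) (e y) := by
  simp only [offTrianglesTerm, holds_and, holds_not, holds_get, h.graph, h.triangle]
  rfl

theorem Prepared.holds_samePartTerm (h : Prepared H X) (i j : Fin n) :
    Holds X (pairEnv i j) samePartTerm ↔ SamePart H i j := by
  simp only [samePartTerm, holds_and, holds_not, holds_ex, holds_get, h.graph]
  simp [pairEnv, SamePart]

open Classical in
theorem eval_partSizeTerm (h : ∀ i j, X 22 i j ≠ 0 ↔ SamePart H i j) (i j : Fin n) :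
    partSizeTerm.eval X (pairEnv i j) = partSize H i := by
  simp only [partSizeTerm, ArrayTerm.eval, h]
  simp [pairEnv, partSize, Set.ncard_eq_toFinset_card']

theorem Partitioned.holds_obstructionTerm (h : Partitioned H X) (hm : ∀ i j, X 9 i j = mate i)
    (i j : Fin n) : Holds X (pairEnv i j) obstructionTerm ↔ IsObstruction H mate i := by
  simp only [obstructionTerm, holds_or, holds_and, holds_not, holds_ex, holds_eq, holds_get,
    eval_get, eval_idx, h.holds_offTrianglesTerm, h.graph, h.triangle, h.partSize, hm]
  simp [pairEnv, IsObstruction, Fin.ext_iff]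

open Classical in
theorem Partitioned.eval_weightTerm (h : Partitioned H X) (hm : ∀ i j, X 9 i j = mate i)
    (i j : Fin n) : weightTerm.eval X (pairEnv i j) = weight H mate i := by
  simp only [weightTerm, eval_ite, eval_lit, eval_get, eval_idx, holds_ex, holds_and, holds_or,
    holds_lt, holds_get, h.graph, h.triangle, h.samePart, h.partSize, hm, weight]
  simp only [pairEnv, ← not_lt (b := i), ite_not, zero_ne_one, ↓reduceIte, Function.update_self,
    ne_eq, OfNat.zero_ne_ofNat, not_false_eq_true, Function.update_of_ne, Fin.val_fin_lt]
  congr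

theorem prepared_prepareProg (G : SimpleGraph (Fin n)) :
    Prepared Gᶜ (prepareProg.eval (inputArrays (adjArray G))) ∧
      ∀ i j, prepareProg.eval (inputArrays (adjArray G)) 1 i j ≠ 0 ↔
        (offTriangles Gᶜ).Adj i j := by
  have hG : Prepared Gᶜ ((ArrayProg.seq (.set 20 complTerm) (.set 21 triangleTerm)).eval
      (inputArrays (adjArray G))) :=
    ⟨holds_complTerm G, holds_triangleTerm (holds_complTerm G)⟩
  exact ⟨hG.congr rfl rfl, fun i j => hG.holds_offTrianglesTerm⟩

theorem Prepared.evaluateProg (h : Prepared H X) (hm : ∀ i j, X 9 i j = mate i) (i : Fin n) :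
    (evaluateProg.eval X 24 i i = 0 ↔ ¬ IsObstruction H mate i) ∧
      evaluateProg.eval X 25 i i = weight H mate i := by
  have hX : Partitioned H ((ArrayProg.seq (.set 22 samePartTerm) (.set 23 partSizeTerm)).eval X) :=
    ⟨h.congr rfl rfl, h.holds_samePartTerm, eval_partSizeTerm h.holds_samePartTerm⟩
  have hX' : Partitioned H ((ArrayProg.set 24 obstructionTerm).eval
      ((ArrayProg.seq (.set 22 samePartTerm) (.set 23 partSizeTerm)).eval X)) :=
    ⟨h.congr rfl rfl, hX.samePart, hX.partSize⟩
  exact ⟨not_not.symm.trans (hX.holds_obstructionTerm hm i i).not, hX'.eval_weightTerm hm i i⟩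

theorem exists_isMate_fallProg (G : SimpleGraph (Fin n)) :
    ∃ mate, IsMate (offTriangles Gᶜ) mate ∧
      ((∃ f, IsCoveringMate (offTriangles Gᶜ) f) → IsCoveringMate (offTriangles Gᶜ) mate) ∧
      ∀ i, (fallProg.eval (inputArrays (adjArray G)) 24 i i = 0 ↔ ¬ IsObstruction Gᶜ mate i) ∧
        fallProg.eval (inputArrays (adjArray G)) 25 i i = weight Gᶜ mate i := by
  obtain ⟨hprep, hgraph⟩ := prepared_prepareProg G
  obtain ⟨mate, hm, hmate, hcov⟩ := exists_isMate_matchProg hgraph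
  exact ⟨mate, hm, hcov, (hprep.congr (eval_matchProg_of_lt (by omega))
    (eval_matchProg_of_lt (by omega))).evaluateProg hmate⟩

theorem mem_fallSpectrum_iff_fallProg {G : SimpleGraph (Fin n)} (hG : IsFree P3addP1 G) (k : ℕ) :
    k ∈ fallSpectrum G ↔ ∑ i, fallProg.eval (inputArrays (adjArray G)) 24 i i = 0 ∧
      ∑ i, fallProg.eval (inputArrays (adjArray G)) 25 i i = k := by
  obtain ⟨mate, hm, hcov, heval⟩ := exists_isMate_fallProg G
  simp only [Finset.sum_eq_zero_iff, Finset.mem_univ, true_imp_iff, heval]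
  constructor
  · intro hk
    have hobs := hG.not_isObstruction ⟨k, hk⟩
      (hcov (hG.exists_isCoveringMate_offTriangles ⟨k, hk⟩))
    exact ⟨hobs, hG.subsingleton_fallSpectrum
      (hG.sum_weight_mem_of_not_isObstruction hm hobs) hk⟩
  · rintro ⟨hobs, rfl⟩
    exact hG.sum_weight_mem_of_not_isObstruction hm hobs

theorem fallSpectrum_eq_of_fallProg {G : SimpleGraph (Fin n)} (hG : IsFree P3addP1 G) :
    fallSpectrum G = if ∑ i, fallProg.eval (inputArrays (adjArray G)) 24 i i = 0 then
      {∑ i, fallProg.eval (inputArrays (adjArray G)) 25 i i} else ∅ := by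
  ext k
  rw [mem_fallSpectrum_iff_fallProg hG]
  split_ifs with h
  · simp only [h, true_and, Set.mem_singleton_iff, eq_comm]
  · simp only [h, false_and, Set.mem_empty_iff_false]

end FallColouring

open FallColouring in
theorem mainTheorem7 :
    -- Fall Colouring, Fall Chromatic Number and Fall Achromatic Number are polynomial-time solvable
    -- for (P₃ + P₁)-free graphs
    RAM.PolyTimeDecidableOn (fun x : InputGraph × ℕ => IsFree P3addP1 x.1.2) encodeGraphNat
      (fun x => x.2 ∈ fallSpectrum x.1.2) ∧
    RAM.PolyTimeOn (fun G : InputGraph => IsFree P3addP1 G.2) encodeGraph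
      (fun G => fallChromaticNumber G.2) ∧
    RAM.PolyTimeOn (fun G : InputGraph => IsFree P3addP1 G.2) encodeGraph
      (fun G => fallAchromaticNumber G.2) ∧
    ∀ (V : Type*) [Finite V] (G : SimpleGraph V), IsFree P3addP1 G →
      -- a graph with a fall colouring is fall-unique
      ((fallSpectrum G).Nonempty → FallUnique G) ∧
      -- the spectrum is determined by those of the co-components
      (∀ k, k ∈ fallSpectrum G ↔ ∃ κ : Gᶜ.ConnectedComponent → ℕ,
        (∀ C, κ C ∈ fallSpectrum (coComponent G C)) ∧ ∑ᶠ C, κ C = k) ∧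
      ∀ C : Gᶜ.ConnectedComponent,
        (IsFree threeP1 (coComponent G C) ∨ IsDisjointUnionOfCliques (coComponent G C)) ∧
        -- the spectrum of a 3P₁-free co-component
        (IsFree threeP1 (coComponent G C) →
          (HasPerfectMatching (deleteDominating (coComponent G C))ᶜ →
            fallSpectrum (coComponent G C) =
              {(coComponent G C).universalVerts.ncard +
                (coComponent G C).universalVertsᶜ.ncard / 2}) ∧
          (¬ HasPerfectMatching (deleteDominating (coComponent G C))ᶜ →
            fallSpectrum (coComponent G C) = ∅)) ∧
        -- the spectrum of a co-component that is a disjoint union of complete graphs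
        (IsDisjointUnionOfCliques (coComponent G C) →
          (∀ p : ℕ, (∀ D : (coComponent G C).ConnectedComponent, D.supp.ncard = p) →
            fallSpectrum (coComponent G C) = {p}) ∧
          ((¬ ∃ p : ℕ, ∀ D : (coComponent G C).ConnectedComponent, D.supp.ncard = p) →
            fallSpectrum (coComponent G C) = ∅)) := by
  refine ⟨polyTimeDecidableOn_of_arrayProg fallProg 24 25 fun G k hG =>
      mem_fallSpectrum_iff_fallProg hG k,
    polyTimeOn_of_arrayProg fallProg 24 25 fun G hG => ?_,
    polyTimeOn_of_arrayProg fallProg 24 25 fun G hG => ?_, fun V _ G hG => ⟨?_, ?_, fun C => ?_⟩⟩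
  · rw [fallChromaticNumber, fallSpectrum_eq_of_fallProg hG]
    split_ifs <;> simp
  · rw [fallAchromaticNumber, fallSpectrum_eq_of_fallProg hG]
    split_ifs <;> simp
  · rintro ⟨k, hk⟩
    exact ⟨k, hG.fallSpectrum_eq_singleton hk⟩
  · exact fun k => mem_fallSpectrum_iff
  · have : Nonempty C.supp := C.nonempty_supp.to_subtype
    exact ⟨hG.isFree_or_isDisjointUnionOfCliques C,
      fun h => ⟨fallSpectrum_of_hasPerfectMatching h, fallSpectrum_of_not_hasPerfectMatching h⟩,
      fun h => ⟨fun _ => h.fallSpectrum_eq, h.fallSpectrum_eq_empty⟩⟩
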